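/- **Proposition 3.1 (Near field domination).** *Setting.* For $f\in L^2(\mathbb R;\mathbb C)$ let $\hat f(\kappa)=\int f(x)e^{-i\kappa x}\,dx$, and let $H^4=H^4(\mathbb R;\mathbb C)$ carry the norm $\|v\|_{H^4}^2=\int(1+\kappa^2)^4|\hat v(\kappa)|^2\,d\kappa$. Let $\mu(x)=1$ for $x\le 0$ and $\mu(x)=-1$ for $x>0$. *Rolls.* For $\delta>0$ and $\Omega\in(-\frac13,\frac13)$ put $\omega=\omega(\delta,\Omega)=\sqrt{1+\delta\Omega}$. The roll of phase $0$ is the even $2\pi$-periodic solution $U=U^{(\delta,\omega)}\in C^4(\mathbb R;\mathbb R)$ of $$-(1+\omega^2\partial_x^2)^2U+\delta^2U-U^3=0$$ whose first cosine coefficient $\varepsilon=\varepsilon(\delta,\Omega)=\frac1\pi\int_0^{2\pi}U(x)\cos x\,dx$ is positive, and $u_{\rm rolls}^{(\delta,\omega,\gamma)}(x)=U^{(\delta,\omega)}(x+\gamma)$ for $\gamma\in\mathbb R$; that such a $U$ exists for all small $\delta>0$ and all $\Omega\in(-\frac13,\frac13)$ is part of the claim. *Partition function.* Let $\chi\in C^\infty(\mathbb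 R;\mathbb R)$ satisfy $\chi(x)\to1$ as $x\to-\infty$ and $\chi(x)\to0$ as $x\to+\infty$, and suppose that for some $C_*,S_*,K>0$ and all $0\le j\le4$ we have $|\partial_x^j(\chi-1)(x)|\le Ke^{-C_*|x|}$ for $x<-S_*$ and $|\partial_x^j\chi(x)|\le Ke^{-C_*|x|}$ for $x>S_*$. *Far-projected equation.* Let $\tau,\beta$ be real numbers, $\mathcal B=[-1,1]$ and $I_\varepsilon=\{-1+\varepsilon^\tau\mathcal B\}\cup\{1+\varepsilon^\tau\mathcal B\}$. Let $X_{\rm near,\varepsilon^\tau}$ (resp. $X_{\rm far,\varepsilon^\tau}$) be the space of all $v\in H^4$ with $\hat v=0$ a.e. outside (resp. inside) $I_\varepsilon$. Writing $\chi=\chi(\varepsilon^\beta x)$ and $u=u_{\rm rolls}^{(\delta,\omega,\gamma)}$, let $$\mathscr N[v]=-\big(\delta^2\mu-3(\chi u)^2\big)v+3\chi u\,v^2+v^3+\chi(\chi^2-1)u^3+[(1+\omega^2\partial_x^2)^2,\chi]u-\delta^2\chi(\mu-1)u ,$$ where $[A,B]=AB-BA$. Let $m(\kappa)=-(1-\omega^2\kappa^2)^2$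 and $$\mathscr E[v_{\rm near},v_{\rm far},\delta,\Omega,\gamma]=\mathscr F^{-1}\Big[\tfrac1{m}\,\mathbb 1_{\mathbb R\setminus I_\varepsilon}\,\mathscr F\big[\mathscr N[v_{\rm near}+v_{\rm far}]\big]\Big].$$ *Statement.* Let $R>0$, $0<\tau<\frac1{16}$, $1\le\beta\le1+\tau$ and $\chi$ be fixed as above. Then there are $\delta_*>0$ and $C>0$ such that the rolls $U^{(\delta,\omega)}$ exist for all $\delta\in(0,\delta_*)$ and $\Omega\in(-\frac13,\frac13)$, and there is a mapping $(v_{\rm near},\delta,\Omega,\gamma)\mapsto v_{\rm far}[v_{\rm near},\delta,\Omega,\gamma]\in H^4$ such that, for all $\delta\in(0,\delta_*)$, $\Omega\in(-\frac13,\frac13)$, $\gamma\in\mathbb R$ and $v_{\rm near}\in X_{\rm near,\varepsilon^\tau}$ with $\|v_{\rm near}\|_{H^4}\le R\varepsilon^{\beta/2}$, the function $v_{\rm far}=v_{\rm far}[v_{\rm near},\delta,\Omega,\gamma]$ satisfies $v_{\rm far}\in X_{\rm far,\varepsilon^\tau}$, $\|v_{\rm far}\|_{H^4}\le R\varepsilon^{1/16}$,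 $\mathscr N[v_{\rm near}+v_{\rm far}]\in L^2(\mathbb R)$ and $$v_{\rm far}=\mathscr E[v_{\rm near},v_{\rm far},\delta,\Omega,\gamma];$$ if $v_{\rm near}$ is real-valued, then so is $v_{\rm far}$. Furthermore: 1. for all these arguments $$\|v_{\rm far}\|_{H^4}\le C\Big(\sum_{j=1}^3\varepsilon^{3-j-2\tau+\frac\beta2(j-1)}\Big)\|v_{\rm near}\|_{H^4}+C\big(\varepsilon^{3-\frac\beta2}+\varepsilon^{1+\frac{3\beta}2}+\varepsilon^{2+\frac\beta2}\big);$$ 2. the mapping extends continuously to $\delta=0$ by $v_{\rm far}[\cdot,0,\Omega,\gamma]=0$; 3. the mapping so extended is jointly continuous in $(v_{\rm near},\delta,\Omega,\gamma)$, in the $H^4$ norm, on the set of all $(v_{\rm near},\delta,\Omega,\gamma)$ with $\delta\in[0,\delta_*)$, $\Omega\in(-\frac13,\frac13)$, $\gamma\in\mathbb R$ and, if $\delta>0$, $v_{\rm near}\in X_{\rm near,\varepsilon^\tau}$ and $\|v_{\rm near}\|_{H^4}\le R\varepsilon^{\beta/2}$; and it is $2\pi$-periodic in $\gamma$. -/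

import Mathlib

open Real Set Filter Topology MeasureTheory FourierTransform
open scoped ENNReal

namespace QuenchedSH

noncomputable section

/-! ### Fourier transform and the Sobolev space `H⁴(ℝ)` -/

/-- Complex-valued square integrable functions on the line. -/
abbrev L2 : Type := Lp ℂ 2 (volume : Measure ℝ)

/-- The Fourier transform `f̂(κ) = ∫ f(x) e^{-iκx} dx` of `f ∈ L²(ℝ)`. Mathlib's transform uses the
kernel `e^{-2πixξ}`, whence the rescaling `ξ = κ / 2π`. -/
def hat (f : L2) (κ : ℝ) : ℂ := (𝓕 f : L2) (κ / (2 * π))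

theorem quasi_scale : Measure.QuasiMeasurePreserving (fun κ : ℝ => κ / (2 * π)) volume volume := by
  refine ⟨by fun_prop, ?_⟩
  have h : (fun κ : ℝ => κ / (2 * π)) = fun κ => κ * (2 * π)⁻¹ := by
    ext κ; rw [div_eq_mul_inv]
  rw [h, Real.map_volume_mul_right (inv_ne_zero (by positivity))]
  exact Measure.smul_absolutelyContinuous

theorem quasi_unscale :
    Measure.QuasiMeasurePreserving (fun κ : ℝ => κ * (2 * π)) volume volume := by
  refine ⟨by fun_prop, ?_⟩
  rw [Real.map_volume_mul_right (by positivity)]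
  exact Measure.smul_absolutelyContinuous

theorem hat_add (f g : L2) : hat (f + g) =ᵐ[volume] fun κ => hat f κ + hat g κ := by
  have h : (𝓕 (f + g) : L2) = 𝓕 f + 𝓕 g := FourierTransform.fourier_add f g
  have h2 := quasi_scale.ae_eq_comp (Lp.coeFn_add (𝓕 f : L2) (𝓕 g : L2))
  filter_upwards [h2] with κ hκ
  simp only [hat, h]
  simpa using hκ

theorem hat_smul (c : ℂ) (f : L2) : hat (c • f) =ᵐ[volume] fun κ => c * hat f κ := by
  have h : (𝓕 (c • f) : L2) = c • 𝓕 f := FourierTransform.fourier_smul c f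
  have h2 := quasi_scale.ae_eq_comp (Lp.coeFn_smul c (𝓕 f : L2))
  filter_upwards [h2] with κ hκ
  simp only [hat, h]
  simpa using hκ

theorem eq_zero_of_hat (f : L2) (h : hat f =ᵐ[volume] 0) : f = 0 := by
  have h1 : (𝓕 f : L2) = 0 := by
    refine Lp.ext ?_
    have h2 := quasi_unscale.ae_eq_comp h
    filter_upwards [h2, Lp.coeFn_zero ℂ 2 (volume : Measure ℝ)] with ξ hξ h0
    rw [h0]
    have hpi : ξ * (2 * π) / (2 * π) = ξ := by field_simp
    simpa [hat, hpi] using hξ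
  have h3 : ‖f‖ = 0 := by rw [← Lp.norm_fourier_eq f, h1, norm_zero]
  exact norm_eq_zero.mp h3

/-- The function `(1 + κ²)² f̂(κ)`, whose `L²` norm is the `H⁴` norm of `f`. -/
def weighted (f : L2) (κ : ℝ) : ℂ := (((1 + κ ^ 2) ^ 2 : ℝ) : ℂ) * hat f κ

theorem weighted_add (f g : L2) :
    weighted (f + g) =ᵐ[volume] weighted f + weighted g := by
  filter_upwards [hat_add f g] with κ hκ
  simp only [weighted, hκ, Pi.add_apply]; ring

theorem weighted_smul (c : ℂ) (f : L2) :
    weighted (c • f) =ᵐ[volume] c • weighted f := by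
  filter_upwards [hat_smul c f] with κ hκ
  simp only [weighted, hκ, Pi.smul_apply, smul_eq_mul]; ring

theorem weighted_zero : weighted 0 =ᵐ[volume] 0 := by
  filter_upwards [hat_smul 0 0] with κ hκ
  rw [zero_smul, zero_mul] at hκ
  simp [weighted, hκ]

/-- `H⁴(ℝ)` as a linear subspace of `L²(ℝ)`. -/
def sobolev4 : Submodule ℂ L2 where
  carrier := {f | MemLp (weighted f) 2 volume}
  add_mem' {f g} hf hg := (memLp_congr_ae (weighted_add f g)).mpr (MemLp.add hf hg)
  zero_mem' := (memLp_congr_ae weighted_zero).mpr MemLp.zero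
  smul_mem' c f hf := (memLp_congr_ae (weighted_smul c f)).mpr (MemLp.const_smul hf c)

/-- The Sobolev space `H⁴(ℝ)` of complex-valued functions. It is a type of its own, so that it
carries the `H⁴` norm below and not the norm of `L²`. -/
def H4 : Type := sobolev4

instance : AddCommGroup H4 := inferInstanceAs (AddCommGroup sobolev4)
instance : Module ℂ H4 := inferInstanceAs (Module ℂ sobolev4)

/-- The underlying (class of a) square integrable function. -/
def H4.toL2 (v : H4) : L2 := Subtype.val (p := fun f => f ∈ sobolev4) v

theorem H4.mem (v : H4) : MemLp (weighted v.toL2) 2 volume :=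
  Subtype.property (p := fun f => f ∈ sobolev4) v

/-- `v ↦ (1 + κ²)² v̂(κ)` as a linear map into `L²`. -/
def H4.weightMap : H4 →ₗ[ℂ] L2 where
  toFun v := v.mem.toLp (weighted v.toL2)
  map_add' v w := by
    rw [← MemLp.toLp_add v.mem w.mem]
    exact MemLp.toLp_congr _ _ (weighted_add v.toL2 w.toL2)
  map_smul' c v := by
    rw [RingHom.id_apply, ← MemLp.toLp_const_smul c v.mem]
    exact MemLp.toLp_congr _ _ (weighted_smul c v.toL2)

theorem H4.weightMap_injective : Function.Injective H4.weightMap := by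
  refine (injective_iff_map_eq_zero H4.weightMap).mpr fun v hv => ?_
  have h1 : weighted v.toL2 =ᵐ[volume] 0 := by
    refine (MemLp.coeFn_toLp v.mem).symm.trans ?_
    have h2 : v.mem.toLp (weighted v.toL2) = 0 := hv
    rw [h2]
    exact Lp.coeFn_zero ℂ 2 volume
  refine Subtype.ext (eq_zero_of_hat v.toL2 ?_)
  filter_upwards [h1] with κ hκ
  have hne : (((1 + κ ^ 2) ^ 2 : ℝ) : ℂ) ≠ 0 := by
    exact_mod_cast (by positivity : ((1 + κ ^ 2) ^ 2 : ℝ) ≠ 0)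
  simpa [weighted, hne] using (mul_eq_zero.mp hκ).resolve_left hne

/-- The `H⁴` norm `‖v‖² = ∫ (1 + κ²)⁴ |v̂(κ)|² dκ`, and the topology that it induces. -/
instance : NormedAddCommGroup H4 :=
  NormedAddCommGroup.induced H4 L2 H4.weightMap H4.weightMap_injective

theorem H4.norm_eq (v : H4) :
    ‖v‖ = (∫ κ : ℝ, (1 + κ ^ 2) ^ 4 * ‖hat v.toL2 κ‖ ^ 2) ^ ((1 : ℝ) / 2) := by
  have h0 : ‖v‖ = ‖v.mem.toLp (weighted v.toL2)‖ := rfl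
  rw [h0, Lp.norm_toLp, MemLp.eLpNorm_eq_integral_rpow_norm (by norm_num) (by norm_num) v.mem,
    ENNReal.toReal_ofReal (by positivity)]
  norm_num
  congr 1
  refine integral_congr_ae (Eventually.of_forall fun κ => ?_)
  have hp : 0 ≤ 1 + κ ^ 2 := by positivity
  have e1 : ‖(1 + (κ : ℂ) ^ 2)‖ = 1 + κ ^ 2 := by
    have e2 := Complex.norm_real (1 + κ ^ 2)
    rw [Real.norm_of_nonneg hp] at e2
    rw [← e2]; push_cast; rfl
  simp only [weighted]
  push_cast
  rw [norm_mul, norm_pow, e1]; ring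

/-- Real-valued elements of `H⁴(ℝ)`. -/
def H4.IsReal (v : H4) : Prop := ∀ᵐ x : ℝ, (v.toL2 x).im = 0

/-! ### Near and far frequencies -/

/-- The near frequencies `{-1 + ηB} ∪ {1 + ηB}`, where `B = [-1, 1]`. -/
def nearFreq (η : ℝ) : Set ℝ := Metric.closedBall (-1) η ∪ Metric.closedBall 1 η

/-- Elements of `H⁴(ℝ)` whose Fourier transform is supported in the near frequencies. -/
def Xnear (η : ℝ) : Set H4 := {v | ∀ᵐ κ : ℝ, κ ∉ nearFreq η → hat v.toL2 κ = 0}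

/-- Elements of `H⁴(ℝ)` whose Fourier transform is supported in the far frequencies. -/
def Xfar (η : ℝ) : Set H4 := {v | ∀ᵐ κ : ℝ, κ ∈ nearFreq η → hat v.toL2 κ = 0}

/-! ### The Swift–Hohenberg operator and its rolls -/

/-- `(1 + ω² ∂ₓ²)² f`. -/
def shOp (ω : ℝ) (f : ℝ → ℝ) (x : ℝ) : ℝ :=
  f x + 2 * ω ^ 2 * iteratedDeriv 2 f x + ω ^ 4 * iteratedDeriv 4 f x

/-- The first cosine coefficient of a `2π`-periodic function. -/
def cosCoeff (U : ℝ → ℝ) : ℝ := 1 / π * ∫ x in (0 : ℝ)..(2 * π), U x * cos x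

/-- Rolls of the homogeneous equation with phase zero: `2π`-periodic even solutions of
`-(1 + ω² ∂ₓ²)² U + δ² U - U³ = 0` whose leading harmonic is `ε cos x` with `ε > 0`. -/
structure IsRollProfile (δ ω : ℝ) (U : ℝ → ℝ) : Prop where
  contDiff : ContDiff ℝ 4 U
  periodic : Function.Periodic U (2 * π)
  even : ∀ x, U (-x) = U x
  equation : ∀ x, -shOp ω U x + δ ^ 2 * U x - U x ^ 3 = 0
  amplitude_pos : 0 < cosCoeff U

open Classical in
/-- The roll with phase zero (the zero function for parameters without rolls, as `δ = 0`). -/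
def rollProfile (δ ω : ℝ) : ℝ → ℝ :=
  if h : ∃ U, IsRollProfile δ ω U then h.choose else 0

/-- The roll `u_rolls^{(δ,ω,γ)}` with phase `γ`. -/
def roll (δ ω γ x : ℝ) : ℝ := rollProfile δ ω (x + γ)

/-- The wavenumber given by `ω² = 1 + δ Ω`. -/
def wavenumber (δ Ω : ℝ) : ℝ := √(1 + δ * Ω)

/-- The amplitude `ε(δ, Ω)` in `u_rolls = ε cos (x + γ) + O(ε²)`. -/
def amp (δ Ω : ℝ) : ℝ := cosCoeff (rollProfile δ (wavenumber δ Ω))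

/-! ### The equation for the corrector -/

/-- The quenched control parameter. -/
def mu (x : ℝ) : ℝ := if x ≤ 0 then 1 else -1

/-- The smooth partition function `χ`, with exponential convergence to `1` at `-∞` and to `0` at
`+∞`, together with its derivatives up to order four. -/
structure IsPartition (χ : ℝ → ℝ) : Prop where
  smooth : ContDiff ℝ (⊤ : ℕ∞) χ
  tendsto_left : Tendsto χ atBot (𝓝 1)
  tendsto_right : Tendsto χ atTop (𝓝 0)
  decay : ∃ c > 0, ∃ S > 0, ∃ K : ℝ, ∀ j ≤ 4,
    (∀ x < -S, |iteratedDeriv j (fun y => χ y - 1) x| ≤ K * exp (-c * |x|)) ∧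
    (∀ x > S, |iteratedDeriv j χ x| ≤ K * exp (-c * |x|))

section Nonlinearities

variable (χ : ℝ → ℝ) (β δ Ω γ : ℝ)

/-- The slowly varying envelope `χ(ε^β x)`. -/
def envelope (x : ℝ) : ℝ := χ (amp δ Ω ^ β * x)

/-- The far field profile `χ(ε^β x) u_rolls(x)`. -/
def farField (x : ℝ) : ℝ := envelope χ β δ Ω x * roll δ (wavenumber δ Ω) γ x

/-- `N⁽¹⁾[v] = -(δ² μ - 3 (χ u_rolls)²) v`. -/
def N1 (v : ℝ → ℂ) (x : ℝ) : ℂ :=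
  -((δ ^ 2 * mu x - 3 * farField χ β δ Ω γ x ^ 2 : ℝ) : ℂ) * v x

/-- `N⁽²⁾[v] = 3 χ u_rolls v²`. -/
def N2 (v : ℝ → ℂ) (x : ℝ) : ℂ := ((3 * farField χ β δ Ω γ x : ℝ) : ℂ) * v x ^ 2

/-- `N⁽³⁾[v] = v³`. -/
def N3 (v : ℝ → ℂ) (x : ℝ) : ℂ := v x ^ 3

/-- `N⁽⁴⁾ = χ (χ² - 1) u_rolls³ + [(1 + ω² ∂ₓ²)², χ] u_rolls - δ² χ (μ - 1) u_rolls`. -/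
def N4 (x : ℝ) : ℝ :=
  envelope χ β δ Ω x * (envelope χ β δ Ω x ^ 2 - 1) * roll δ (wavenumber δ Ω) γ x ^ 3
    + (shOp (wavenumber δ Ω) (farField χ β δ Ω γ) x
      - envelope χ β δ Ω x * shOp (wavenumber δ Ω) (roll δ (wavenumber δ Ω) γ) x)
    - δ ^ 2 * envelope χ β δ Ω x * (mu x - 1) * roll δ (wavenumber δ Ω) γ x

/-- The right hand side `∑ⱼ N⁽ʲ⁾[v]` of the equation `-(1 + ω² ∂ₓ²)² v = ∑ⱼ N⁽ʲ⁾[v]`. -/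
def nonlinearity (v : ℝ → ℂ) (x : ℝ) : ℂ :=
  N1 χ β δ Ω γ v x + N2 χ β δ Ω γ v x + N3 v x + (N4 χ β δ Ω γ x : ℂ)

/-- The Fourier multiplier `m(κ) = -(1 - ω² κ²)²` of `-(1 + ω² ∂ₓ²)²`. -/
def symbol (κ : ℝ) : ℝ := -(1 - wavenumber δ Ω ^ 2 * κ ^ 2) ^ 2

open Classical in
/-- The fixed point equation `v_far = 𝓔[v_near, v_far, δ, Ω, γ]`, where
`𝓔 = 𝓕⁻¹ [ m⁻¹ 1_far 𝓕 [∑ⱼ N⁽ʲ⁾[v_near + v_far]] ]`; it includes that the nonlinearity belongs to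
`L²(ℝ)`, so that its Fourier transform is meaningful. -/
def IsFarFixedPoint (τ : ℝ) (vnear vfar : H4) : Prop :=
  ∃ h : MemLp (nonlinearity χ β δ Ω γ ((vnear + vfar).toL2 : ℝ → ℂ)) 2 volume,
    ∀ᵐ κ : ℝ, hat vfar.toL2 κ =
      if κ ∈ nearFreq (amp δ Ω ^ τ) then 0
      else ((1 / symbol δ Ω κ : ℝ) : ℂ) * hat (h.toLp _) κ

end Nonlinearities

/-- The admissible near fields: the ball of radius `R ε^{β/2}` of the near-frequency space. -/
def nearBall (R τ β δ Ω : ℝ) : Set H4 :=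
  {v | v ∈ Xnear (amp δ Ω ^ τ) ∧ ‖v‖ ≤ R * amp δ Ω ^ (β / 2)}

end

end QuenchedSH

/-! The proof rests on two contraction arguments, one for the rolls and one for the far field,
joined by a frequency-localised estimate of the residual.

Rolls. With U = δW and ω² = 1 + δΩ the roll equation reads (1 + ω²∂²)²W = δ²(W - W³). On cos x the
operator acts as (1 - ω²)² = δ²Ω², while on every other harmonic of an even 2π-periodic function it
is bounded below. Write W = a cos x + δg with g free of the first harmonic. The first harmonic,
divided by δ², gives (1 - Ω²)a = (3/4)a³ + O(δ); the others give g = δ `green`(W - W³). A damped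
iteration in (a, g) contracts on 1 ≤ a ≤ 6/5, ‖g‖ ≤ 1 (`rollMap_mapsTo`, `rollMap_lipschitz`). Since
`rollProfile` is an arbitrary choice among solutions, every solution must be located: an energy
identity bounds ∫W⁴, hence all cosine coefficients, hence sup |W|, and the amplitude equation then
forces W into the contraction region (`exists_fixed_of_isRollProfile`). So the chosen roll is the
constructed one (`rollProfile_spec`): ε = δa is comparable to δ, and U = ε cos x + δ³ρ with ρ =
`rollRem` bounded in C³ and continuous in the parameters.

Far field. Put η = ε^τ. As H⁴ embeds in L^∞, the nonlinearity maps H⁴ to L² with Lipschitz constant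
O(ε² + εr + r²) on a ball of radius r. The symbol vanishes quadratically near ±1, so its inverse on
the far frequencies maps L² to H⁴ with norm O(η⁻²). For r of order ε^{1/16} the product is
O(ε^{1/8-2τ}), which is small precisely because τ < 1/16 (`exists_contracting_threshold`).

Residual. The claimed bound has no factor η⁻² on the terms independent of the near field, so the
norm of the inverse cannot be used on all of N⁽⁴⁾. Its leading part is a sum of profiles G(ε^β x)
times harmonics e^{ikx}, possibly cut at x = 0, with Fourier transform concentrated at the integer
k. Near k = ±1 the multiplier is cut off, near any other integer it is O(1), and away from k
integration by parts bounds the transform by O(1/|κ - k|). The tail costs η⁻⁵, which is at most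
ε^{-β}, the squared norm of a profile, because 5τ ≤ β (`Admissible.multBound_indicator`). The
remainder of N⁽⁴⁾ is smaller by a factor ε ≤ η², which pays for the crude norm (`restSize_div_le`).

Uniqueness of the fixed point in the far ball gives reality (the conjugate is also a fixed point)
and, with the uniform contraction rate 1/2, continuity in all parameters. At δ = 0 continuity
follows from the radius Rε^{1/16} tending to zero. -/

namespace QuenchedSH

noncomputable section

/-! ### Cosine series of even periodic functions -/

/-- The cosine coefficients of a `2π`-periodic function. -/
def cosC (k : ℕ) (f : ℝ → ℝ) : ℝ :=
  (if k = 0 then 1 / (2 * π) else 1 / π) * ∫ x in (0 : ℝ)..(2 * π), f x * cos (k * x)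

theorem cosC_one (f : ℝ → ℝ) : cosC 1 f = cosCoeff f := by
  simp [cosC, cosCoeff]

theorem intervalIntegral_odd_periodic {f : ℝ → ℝ} (hp : Function.Periodic f (2 * π))
    (ho : ∀ x, f (-x) = -f x) : ∫ x in (0 : ℝ)..(2 * π), f x = 0 := by
  have h1 : ∫ x in (0 : ℝ)..(2 * π), f x = ∫ x in (-π)..π, f x := by
    have := hp.intervalIntegral_add_eq 0 (-π)
    rw [zero_add] at this
    rw [this]; congr 1; ring
  have h2 : ∫ x in (-π)..π, f (-x) = ∫ x in (-π)..π, f x := by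
    rw [intervalIntegral.integral_comp_neg]; simp
  have h3 : ∫ x in (-π)..π, f (-x) = -∫ x in (-π)..π, f x := by
    rw [← intervalIntegral.integral_neg]; exact intervalIntegral.integral_congr fun x _ => ho x
  rw [h1]; linarith

/-- Evenness removes the sine integrals, so the complex Fourier coefficients at k and -k coincide
and, for k ≠ 0, equal half the cosine coefficient. The absolutely convergent exponential series is
then folded into pairs ±k. -/
theorem hasSum_cosC {f : ℝ → ℝ} (hc : Continuous f) (hp : Function.Periodic f (2 * π))
    (he : ∀ x, f (-x) = f x) (hs : Summable fun k => cosC k f) (x : ℝ) :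
    HasSum (fun k : ℕ => cosC k f * cos (k * x)) (f x) := by
  have : Fact (0 < 2 * π) := ⟨by positivity⟩
  have hpC : Function.Periodic (fun x => (f x : ℂ)) (2 * π) := fun x => by simp [hp x]
  have hlc : Continuous (hpC.lift) := by
    refine continuous_coinduced_dom.mpr ?_
    exact Complex.continuous_ofReal.comp hc
  set g : C(AddCircle (2 * π), ℂ) := ⟨hpC.lift, hlc⟩ with hg
  have hgx : ∀ x : ℝ, g (x : AddCircle (2 * π)) = f x := fun x => rfl
  have hexp : ∀ (n : ℤ) (x : ℝ), (fourier n (x : AddCircle (2 * π)) : ℂ)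
      = cos (n * x) + sin (n * x) * Complex.I := by
    intro n x
    rw [fourier_coe_apply, Complex.ofReal_cos, Complex.ofReal_sin, ← Complex.exp_mul_I]
    congr 1
    push_cast
    have : (π : ℂ) ≠ 0 := by exact_mod_cast pi_ne_zero
    field_simp
  have hint : ∀ n : ℤ, ∫ x in (0 : ℝ)..(2 * π), f x * sin (n * x) = 0 := by
    intro n
    apply intervalIntegral_odd_periodic
    · intro y
      have : (n : ℝ) * (y + 2 * π) = n * y + n * (2 * π) := by ring
      simp only [hp y, this, Real.sin_add_int_mul_two_pi]
    · intro y; simp [he]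
  have hcoef : ∀ n : ℤ, fourierCoeff g n
      = (((1 / (2 * π)) * ∫ x in (0 : ℝ)..(2 * π), f x * cos (n * x) : ℝ) : ℂ) := by
    intro n
    rw [fourierCoeff_eq_intervalIntegral g n 0, zero_add]
    have h1 : ∀ x : ℝ, (fourier (-n) (x : AddCircle (2 * π)) : ℂ) • g (x : AddCircle (2 * π))
        = ((f x * cos (n * x) : ℝ) : ℂ) - ((f x * sin (n * x) : ℝ) : ℂ) * Complex.I := by
      intro x
      rw [hexp, hgx]
      push_cast
      simp only [neg_mul, Complex.cos_neg, Complex.sin_neg, smul_eq_mul]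
      ring
    simp_rw [h1]
    rw [intervalIntegral.integral_sub, intervalIntegral.integral_mul_const,
      intervalIntegral.integral_ofReal, intervalIntegral.integral_ofReal, hint]
    · simp
    · apply Continuous.intervalIntegrable; fun_prop
    · apply Continuous.intervalIntegrable; fun_prop
  have hc0 : fourierCoeff g 0 = (cosC 0 f : ℂ) := by rw [hcoef]; simp [cosC]
  have hcp : ∀ k : ℕ, k ≠ 0 → fourierCoeff g k = ((cosC k f / 2 : ℝ) : ℂ) := by
    intro k hk; rw [hcoef]; congr 1; simp only [cosC, hk, if_false, Int.cast_natCast]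
    field_simp
  have hcn : ∀ k : ℕ, fourierCoeff g (-k) = fourierCoeff g k := by
    intro k; rw [hcoef, hcoef]; simp
  have hsum : Summable (fourierCoeff g) := by
    have h1 : Summable fun k : ℕ => fourierCoeff g k := by
      refine Summable.of_norm_bounded (g := fun k => ‖cosC k f‖) hs.norm ?_
      intro k
      rcases eq_or_ne k 0 with rfl | hk
      · simp [hc0]
      · rw [hcp k hk, Complex.norm_real, norm_div]
        have := norm_nonneg (cosC k f)
        simp
    exact Summable.of_nat_of_neg h1 (by simpa [hcn] using h1)
  have hmain := (has_pointwise_sum_fourier_series_of_summable hsum (x : AddCircle (2 * π))).nat_add_neg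
  rw [hgx] at hmain
  have hfin : HasSum (fun k : ℕ => ((cosC k f * cos (k * x) : ℝ) : ℂ)) (f x : ℂ) := by
    -- Folding the integers into pairs counts the zeroth coefficient twice; one copy is subtracted.
    have h0 : HasSum (fun k : ℕ => if k = 0 then (cosC 0 f : ℂ) else 0) (cosC 0 f : ℂ) :=
      hasSum_ite_eq 0 _
    have h3 := hmain.sub h0
    have e0 : (fourier 0 (x : AddCircle (2 * π)) : ℂ) = 1 := fourier_zero
    rw [hc0, e0, smul_eq_mul, mul_one, add_sub_cancel_right] at h3
    refine h3.congr_fun fun k => ?_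
    rw [hcn, hexp, hexp]
    rcases Nat.eq_zero_or_pos k with rfl | hk
    · simp only [Nat.cast_zero, hc0]; simp
    · rw [hcp k hk.ne']
      simp only [hk.ne', if_false, smul_eq_mul]
      push_cast
      simp only [neg_mul, Complex.cos_neg, Complex.sin_neg]
      ring
  exact_mod_cast hfin

/-- The difference has zero, hence summable, coefficients, so its cosine series converges to it;
continuity alone suffices. -/
theorem eq_of_cosC_eq {f g : ℝ → ℝ} (hf : Continuous f) (hg : Continuous g)
    (hfp : Function.Periodic f (2 * π)) (hgp : Function.Periodic g (2 * π))
    (hfe : ∀ x, f (-x) = f x) (hge : ∀ x, g (-x) = g x) (h : ∀ k, cosC k f = cosC k g) :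
    f = g := by
  have hz : ∀ k, cosC k (fun x => f x - g x) = 0 := by
    intro k
    have : ∫ x in (0 : ℝ)..(2 * π), (f x - g x) * cos (k * x)
        = (∫ x in (0 : ℝ)..(2 * π), f x * cos (k * x)) - ∫ x in (0 : ℝ)..(2 * π), g x * cos (k * x) := by
      rw [← intervalIntegral.integral_sub]
      · simp_rw [sub_mul]
      · apply Continuous.intervalIntegrable; fun_prop
      · apply Continuous.intervalIntegrable; fun_prop
    rw [cosC, this, mul_sub]
    exact sub_eq_zero.mpr (h k)
  ext x
  have := hasSum_cosC (f := fun x => f x - g x) (by fun_prop) (fun y => by simp [hfp y, hgp y])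
    (fun y => by simp [hfe, hge]) (by simp [hz]) x
  simp only [hz, zero_mul] at this
  have := this.unique hasSum_zero
  linarith

theorem abs_cosC_le {f : ℝ → ℝ} {M : ℝ} (h : ∀ x, |f x| ≤ M) (k : ℕ) : |cosC k f| ≤ 2 * M := by
  have hM : 0 ≤ M := (abs_nonneg _).trans (h 0)
  have h1 : ‖∫ x in (0 : ℝ)..(2 * π), f x * cos (k * x)‖ ≤ M * |2 * π - 0| := by
    refine intervalIntegral.norm_integral_le_of_norm_le_const fun x _ => ?_
    rw [norm_mul]
    exact (mul_le_mul (h x) (abs_cos_le_one _) (abs_nonneg _) hM).trans (by simp)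
  rw [sub_zero, abs_of_pos (by positivity : 0 < 2 * π)] at h1
  rw [cosC, abs_mul]
  have h2 : |(if k = 0 then 1 / (2 * π) else 1 / π)| ≤ 1 / π := by
    split_ifs
    · rw [abs_of_pos (by positivity)]
      exact one_div_le_one_div_of_le pi_pos (by linarith [pi_pos])
    · rw [abs_of_pos (by positivity)]
  calc _ ≤ 1 / π * (M * (2 * π)) := mul_le_mul h2 h1 (abs_nonneg _) (by positivity)
    _ = 2 * M := by field_simp

theorem cosC_add {f g : ℝ → ℝ} (hf : Continuous f) (hg : Continuous g) (k : ℕ) :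
    cosC k (fun x => f x + g x) = cosC k f + cosC k g := by
  simp only [cosC, ← mul_add]
  rw [← intervalIntegral.integral_add]
  · simp_rw [add_mul]
  · apply Continuous.intervalIntegrable; fun_prop
  · apply Continuous.intervalIntegrable; fun_prop

theorem cosC_const_mul (c : ℝ) (f : ℝ → ℝ) (k : ℕ) :
    cosC k (fun x => c * f x) = c * cosC k f := by
  simp only [cosC, mul_assoc, intervalIntegral.integral_const_mul]
  ring

theorem periodic_deriv {f : ℝ → ℝ} {T : ℝ} (hp : Function.Periodic f T) :
    Function.Periodic (deriv f) T := by
  intro x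
  rw [← deriv_comp_add_const]
  exact congrArg (fun g => deriv g x) (funext hp)

theorem periodic_iteratedDeriv {f : ℝ → ℝ} {T : ℝ} (hp : Function.Periodic f T) (n : ℕ) :
    Function.Periodic (iteratedDeriv n f) T := by
  induction n with
  | zero => simpa using hp
  | succ n ih => rw [iteratedDeriv_succ]; exact periodic_deriv ih

/-- Green's identity over a period. -/
theorem integral_iteratedDeriv_two_mul {f g : ℝ → ℝ} (hf : ContDiff ℝ 2 f) (hg : ContDiff ℝ 2 g)
    (hfp : Function.Periodic f (2 * π)) (hgp : Function.Periodic g (2 * π)) :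
    ∫ x in (0 : ℝ)..(2 * π), iteratedDeriv 2 f x * g x
      = ∫ x in (0 : ℝ)..(2 * π), f x * iteratedDeriv 2 g x := by
  have key : ∀ f g : ℝ → ℝ, ContDiff ℝ 2 f → ContDiff ℝ 2 g → Function.Periodic f (2 * π) →
      Function.Periodic g (2 * π) → ∫ x in (0 : ℝ)..(2 * π), f x * iteratedDeriv 2 g x
      = -∫ x in (0 : ℝ)..(2 * π), deriv f x * deriv g x := by
    intro f g hf hg hfp hgp
    have hf1 : ContDiff ℝ 1 (deriv f) := hf.deriv' (n := 1)
    have hg1 : ContDiff ℝ 1 (deriv g) := hg.deriv' (n := 1)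
    have e : iteratedDeriv 2 g = deriv (deriv g) := by
      rw [iteratedDeriv_succ, iteratedDeriv_one]
    rw [e, intervalIntegral.integral_mul_deriv_eq_deriv_mul (u := f) (v := deriv g)
      (u' := deriv f) (v' := deriv (deriv g))
      (fun x _ => (hf.differentiable (by norm_num) x).hasDerivAt)
      (fun x _ => (hg1.differentiable (by norm_num) x).hasDerivAt)
      (hf1.continuous.intervalIntegrable _ _)
      ((hg1.continuous_deriv le_rfl).intervalIntegrable _ _)]
    have h1 := hfp 0
    have h2 := periodic_deriv hgp 0
    rw [zero_add] at h1 h2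
    rw [h1, h2]; ring
  rw [key f g hf hg hfp hgp]
  have := key g f hg hf hgp hfp
  simp_rw [mul_comm (iteratedDeriv 2 f _)]
  rw [this]
  simp_rw [mul_comm (deriv f _)]

theorem iteratedDeriv_two_cos_mul (k : ℝ) (x : ℝ) :
    iteratedDeriv 2 (fun x => cos (k * x)) x = -k ^ 2 * cos (k * x) := by
  have h1 : deriv (fun x => cos (k * x)) = fun x => -k * sin (k * x) := by
    ext x
    have := ((Real.hasDerivAt_cos (k * x)).comp x ((hasDerivAt_id x).const_mul k)).deriv
    simp only [Function.comp_def] at this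
    rw [this]; ring
  rw [iteratedDeriv_succ, iteratedDeriv_one, h1]
  have := (((Real.hasDerivAt_sin (k * x)).comp x ((hasDerivAt_id x).const_mul k)).const_mul (-k)).deriv
  simp only [Function.comp_def] at this
  rw [this]; ring

theorem periodic_cos_nat_mul (k : ℕ) : Function.Periodic (fun x : ℝ => cos (k * x)) (2 * π) := by
  intro x
  simp only [mul_add]
  exact Real.cos_add_nat_mul_two_pi _ _

theorem cosC_iteratedDeriv_two {f : ℝ → ℝ} (hf : ContDiff ℝ 2 f)
    (hfp : Function.Periodic f (2 * π)) (k : ℕ) :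
    cosC k (iteratedDeriv 2 f) = -(k : ℝ) ^ 2 * cosC k f := by
  rw [cosC, integral_iteratedDeriv_two_mul hf (by fun_prop) hfp (periodic_cos_nat_mul k)]
  simp_rw [iteratedDeriv_two_cos_mul, mul_left_comm (f _)]
  rw [intervalIntegral.integral_const_mul, cosC]; ring

theorem even_iteratedDeriv_two {f : ℝ → ℝ} (he : ∀ x, f (-x) = f x) (x : ℝ) :
    iteratedDeriv 2 f (-x) = iteratedDeriv 2 f x := by
  have h := iteratedDeriv_comp_neg 2 f x
  have h2 : (fun x => f (-x)) = f := funext he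
  rw [h2] at h
  simpa using h.symm

theorem iteratedDeriv_four (f : ℝ → ℝ) :
    iteratedDeriv 4 f = iteratedDeriv 2 (iteratedDeriv 2 f) := by
  simp only [iteratedDeriv_eq_iterate]; rfl

theorem ContDiff.iteratedDeriv_two {f : ℝ → ℝ} {n : ℕ} (hf : ContDiff ℝ (n + 2 : ℕ) f) :
    ContDiff ℝ n (iteratedDeriv 2 f) := by
  rw [iteratedDeriv_eq_iterate]
  exact ContDiff.iterate_deriv' n 2 hf

theorem continuous_shOp {f : ℝ → ℝ} (hf : ContDiff ℝ 4 f) (ω : ℝ) : Continuous (shOp ω f) := by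
  have h2 := hf.continuous_iteratedDeriv 2 (by norm_num)
  have h4 := hf.continuous_iteratedDeriv 4 (by norm_num)
  unfold shOp
  have := hf.continuous
  fun_prop

theorem cosC_shOp {f : ℝ → ℝ} (hf : ContDiff ℝ 4 f) (hfp : Function.Periodic f (2 * π))
    (ω : ℝ) (k : ℕ) : cosC k (shOp ω f) = (1 - ω ^ 2 * k ^ 2) ^ 2 * cosC k f := by
  have h2 := hf.continuous_iteratedDeriv 2 (by norm_num)
  have h4 := hf.continuous_iteratedDeriv 4 (by norm_num)
  have := hf.continuous
  have e : shOp ω f = fun x => (f x + 2 * ω ^ 2 * iteratedDeriv 2 f x)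
      + ω ^ 4 * iteratedDeriv 4 f x := rfl
  have hc2 : ContDiff ℝ 2 (iteratedDeriv 2 f) := ContDiff.iteratedDeriv_two (n := 2) hf
  rw [e, cosC_add (by fun_prop) (by fun_prop), cosC_add (by fun_prop) (by fun_prop),
    cosC_const_mul, cosC_const_mul, iteratedDeriv_four, cosC_iteratedDeriv_two hc2
      (periodic_iteratedDeriv hfp 2), cosC_iteratedDeriv_two (hf.of_le (by norm_num)) hfp]
  ring

end

/-! ### Contraction principle and Green operator. -/

noncomputable section

open BoundedContinuousFunction

/-- Banach's theorem for a map that contracts only on a closed invariant set. It serves both the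
rolls and the far field. -/
theorem exists_fixedPoint_of_contraction {X : Type*} [MetricSpace X] [CompleteSpace X] {s : Set X}
    (hs : IsClosed s) (hne : s.Nonempty) {f : X → X} (hm : MapsTo f s s) {K : ℝ} (hK0 : 0 ≤ K)
    (hK : K < 1) (hl : ∀ x ∈ s, ∀ y ∈ s, dist (f x) (f y) ≤ K * dist x y) :
    ∃ x ∈ s, f x = x := by
  obtain ⟨x, hx⟩ := hne
  have hc : ContractingWith (⟨K, hK0⟩ : NNReal) (hm.restrict f s s) := by
    refine ⟨by exact_mod_cast hK, LipschitzWith.of_dist_le_mul fun a b => ?_⟩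
    exact hl a a.2 b b.2
  obtain ⟨y, hy, hfy, -⟩ := hc.exists_fixedPoint' hs.isComplete hm hx (edist_ne_top _ _)
  exact ⟨y, hy, hfy⟩

/-! ### The Green operator of `(1 + ω² ∂ₓ²)²` on even periodic functions without first harmonic -/

/-- The inverse of the symbol `(1 - ω² k²)²` off the first harmonic. -/
def wt (ω : ℝ) (k : ℕ) : ℝ := if k = 1 then 0 else 1 / (1 - ω ^ 2 * k ^ 2) ^ 2

theorem wt_nonneg (ω : ℝ) (k : ℕ) : 0 ≤ wt ω k := by
  unfold wt; split_ifs <;> positivity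

/-- For k ≥ 2 the bounds ω² ≥ 9/10 and k² ≥ 4 give ω²k² - 1 ≥ (2/5)(1 + k²), and (2/5)² > 1/7. The
case k = 0 is immediate. -/
theorem symbol_sq_ge {ω : ℝ} (hω : |ω ^ 2 - 1| ≤ 1 / 10) {k : ℕ} (hk : k ≠ 1) :
    (1 + (k : ℝ) ^ 2) ^ 2 / 7 ≤ (1 - ω ^ 2 * k ^ 2) ^ 2 := by
  obtain ⟨h1, h2⟩ := abs_le.mp hω
  rcases Nat.eq_zero_or_pos k with rfl | hk0
  · norm_num
  · have hk2 : (2 : ℝ) ≤ k := by exact_mod_cast (by omega : 2 ≤ k)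
    have hk4 : (4 : ℝ) ≤ (k : ℝ) ^ 2 := by nlinarith
    have h3 : (2 / 5) * (1 + (k : ℝ) ^ 2) ≤ ω ^ 2 * k ^ 2 - 1 := by nlinarith
    nlinarith

theorem wt_le {ω : ℝ} (hω : |ω ^ 2 - 1| ≤ 1 / 10) (k : ℕ) : wt ω k ≤ 7 / (1 + (k : ℝ) ^ 2) ^ 2 := by
  unfold wt
  split_ifs with hk
  · positivity
  · have h := symbol_sq_ge hω hk
    have hp : 0 < (1 + (k : ℝ) ^ 2) ^ 2 / 7 := by positivity
    calc _ ≤ 1 / ((1 + (k : ℝ) ^ 2) ^ 2 / 7) := one_div_le_one_div_of_le hp h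
      _ = _ := by field_simp

theorem symbol_mul_wt {ω : ℝ} (hω : |ω ^ 2 - 1| ≤ 1 / 10) {k : ℕ} (hk : k ≠ 1) :
    (1 - ω ^ 2 * k ^ 2) ^ 2 * wt ω k = 1 := by
  have h := symbol_sq_ge hω hk
  have hp : 0 < (1 + (k : ℝ) ^ 2) ^ 2 / 7 := by positivity
  rw [wt, if_neg hk, mul_one_div, div_self (hp.trans_le h).ne']

theorem summable_inv_one_add_sq : Summable fun k : ℕ => 1 / (1 + (k : ℝ) ^ 2) := by
  have h : Summable fun k : ℕ => (1 : ℝ) / (k : ℝ) ^ 2 :=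
    Real.summable_one_div_nat_pow.mpr (by norm_num)
  refine Summable.of_norm_bounded_eventually_nat h ?_
  filter_upwards [eventually_gt_atTop 0] with k hk
  have hk' : (0 : ℝ) < k := by exact_mod_cast hk
  rw [norm_of_nonneg (by positivity)]
  exact one_div_le_one_div_of_le (by positivity) (by linarith)

/-- A summable majorant of the Green operator and its second derivative. -/
def majorant (k : ℕ) : ℝ := 14 * (1 / (1 + (k : ℝ) ^ 2))

theorem summable_majorant : Summable majorant := summable_inv_one_add_sq.mul_left 14

/-- A bound for the norm of the Green operator. -/
def greenBound : ℝ := ∑' k, majorant k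

theorem majorant_nonneg (k : ℕ) : 0 ≤ majorant k := by unfold majorant; positivity

theorem greenBound_nonneg : 0 ≤ greenBound := tsum_nonneg majorant_nonneg

/-- The constant 14 in `majorant` is 7 from the inverse symbol times 2 from the coefficient bound.
Of the decay (1 + k²)⁻² one factor is kept for summability and the other is available for two
derivatives. -/
theorem sq_mul_wt_mul_le {ω : ℝ} (hω : |ω ^ 2 - 1| ≤ 1 / 10) (k : ℕ) {c M : ℝ}
    (hc : |c| ≤ 2 * M) : |(1 + (k : ℝ) ^ 2) * (wt ω k * c)| ≤ majorant k * M := by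
  have hM : 0 ≤ M := by linarith [abs_nonneg c]
  rw [abs_mul, abs_mul, abs_of_nonneg (wt_nonneg ω k), abs_of_pos (by positivity)]
  calc (1 + (k : ℝ) ^ 2) * (wt ω k * |c|)
      ≤ (1 + (k : ℝ) ^ 2) * (7 / (1 + (k : ℝ) ^ 2) ^ 2 * (2 * M)) := by
        gcongr
        exact wt_le hω k
    _ = majorant k * M := by unfold majorant; field_simp; ring

theorem wt_mul_le {ω : ℝ} (hω : |ω ^ 2 - 1| ≤ 1 / 10) (k : ℕ) {c M : ℝ}
    (hc : |c| ≤ 2 * M) : |wt ω k * c| ≤ majorant k * M := by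
  refine le_trans ?_ (sq_mul_wt_mul_le hω k hc)
  rw [abs_mul (1 + (k : ℝ) ^ 2), abs_of_pos (by positivity : 0 < 1 + (k : ℝ) ^ 2)]
  nlinarith [abs_nonneg (wt ω k * c), sq_nonneg (k : ℝ)]

/-- The function `cos (k x)`. -/
def cosB (k : ℕ) : ℝ →ᵇ ℝ :=
  BoundedContinuousFunction.ofNormedAddCommGroup (fun x => cos (k * x)) (by fun_prop) 1
    fun x => abs_cos_le_one _

@[simp] theorem cosB_apply (k : ℕ) (x : ℝ) : cosB k x = cos (k * x) := rfl

theorem norm_cosB_le (k : ℕ) : ‖cosB k‖ ≤ 1 :=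
  BoundedContinuousFunction.norm_ofNormedAddCommGroup_le _ zero_le_one _

theorem abs_apply_le (f : ℝ →ᵇ ℝ) (x : ℝ) : |f x| ≤ ‖f‖ := f.norm_coe_le_norm x

/-- The cosine coefficient as a continuous linear functional. -/
def cosCL (k : ℕ) : (ℝ →ᵇ ℝ) →L[ℝ] ℝ :=
  LinearMap.mkContinuous
    { toFun := fun f => cosC k f
      map_add' := fun f g => cosC_add f.continuous g.continuous k
      map_smul' := fun c f => cosC_const_mul c f k } 2 fun f => abs_cosC_le (abs_apply_le f) k

theorem cosCL_apply (k : ℕ) (f : ℝ →ᵇ ℝ) : cosCL k f = cosC k f := rfl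

theorem cosC_sub (f g : ℝ →ᵇ ℝ) (k : ℕ) : cosC k (f - g : ℝ →ᵇ ℝ) = cosC k f - cosC k g :=
  map_sub (cosCL k) f g

/-- Green's identity moves ∂² from one cosine to the other, so (k² - m²) times the coefficient is
zero. -/
theorem cosC_cos_of_ne {k m : ℕ} (h : k ≠ m) : cosC k (fun x => cos (m * x)) = 0 := by
  have h1 := cosC_iteratedDeriv_two (f := fun x => cos (m * x)) (by fun_prop)
    (periodic_cos_nat_mul m) k
  have h2 : iteratedDeriv 2 (fun x : ℝ => cos (m * x)) = fun x => -(m : ℝ) ^ 2 * cos (m * x) :=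
    funext (iteratedDeriv_two_cos_mul m)
  rw [h2, cosC_const_mul] at h1
  have h3 : ((k : ℝ) ^ 2 - (m : ℝ) ^ 2) * cosC k (fun x => cos (m * x)) = 0 := by linarith
  refine (mul_eq_zero.mp h3).resolve_left fun h4 => h ?_
  have h5 : (k : ℝ) ^ 2 = (m : ℝ) ^ 2 := by linarith
  exact_mod_cast (sq_eq_sq₀ (by positivity) (by positivity)).mp h5

theorem cosC_cos_self (k : ℕ) : cosC k (fun x => cos (k * x)) = 1 := by
  rcases Nat.eq_zero_or_pos k with rfl | hk
  · simp [cosC]; field_simp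
  · have h0 := cosC_cos_of_ne (k := 0) (m := 2 * k) (by omega)
    simp only [cosC, if_true, Nat.cast_zero, zero_mul, cos_zero, mul_one] at h0
    have h1 : ∫ x in (0 : ℝ)..(2 * π), cos ((2 * k : ℕ) * x) = 0 :=
      (mul_eq_zero.mp h0).resolve_left (by positivity)
    have h2 : ∀ x : ℝ, cos (k * x) * cos (k * x) = 1 / 2 + 1 / 2 * cos ((2 * k : ℕ) * x) := by
      intro x
      have : ((2 * k : ℕ) : ℝ) * x = 2 * (k * x) := by push_cast; ring
      rw [this, cos_two_mul]; ring
    simp only [cosC, hk.ne', if_false, h2]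
    rw [intervalIntegral.integral_add, intervalIntegral.integral_const_mul, h1]
    · simp; field_simp
    · simp
    · apply Continuous.intervalIntegrable; fun_prop

/-- The inverse of `(1 + ω² ∂ₓ²)²` off the first harmonic. -/
def green (ω : ℝ) (f : ℝ →ᵇ ℝ) : ℝ →ᵇ ℝ := ∑' k, (wt ω k * cosC k f) • cosB k

section Green

variable {ω : ℝ} (hω : |ω ^ 2 - 1| ≤ 1 / 10)
include hω

theorem norm_green_term_le (f : ℝ →ᵇ ℝ) (k : ℕ) :
    ‖(wt ω k * cosC k f) • cosB k‖ ≤ majorant k * ‖f‖ := by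
  rw [norm_smul]
  calc _ ≤ (majorant k * ‖f‖) * 1 :=
        mul_le_mul (wt_mul_le hω k (abs_cosC_le (abs_apply_le f) k)) (norm_cosB_le k)
          (norm_nonneg _) (mul_nonneg (majorant_nonneg k) (norm_nonneg _))
    _ = _ := mul_one _

theorem summable_green (f : ℝ →ᵇ ℝ) : Summable fun k => (wt ω k * cosC k f) • cosB k :=
  Summable.of_norm_bounded (summable_majorant.mul_right ‖f‖) (norm_green_term_le hω f)

theorem hasSum_green (f : ℝ →ᵇ ℝ) (x : ℝ) :
    HasSum (fun k : ℕ => wt ω k * cosC k f * cos (k * x)) (green ω f x) := by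
  simpa [green] using (BoundedContinuousFunction.evalCLM ℝ x).hasSum (summable_green hω f).hasSum

theorem norm_green_le (f : ℝ →ᵇ ℝ) : ‖green ω f‖ ≤ greenBound * ‖f‖ := by
  have h := tsum_of_norm_bounded (summable_majorant.mul_right ‖f‖).hasSum (norm_green_term_le hω f)
  rwa [tsum_mul_right] at h

theorem green_sub (f g : ℝ →ᵇ ℝ) : green ω f - green ω g = green ω (f - g) := by
  rw [green, green, ← (summable_green hω f).tsum_sub (summable_green hω g), green]
  congr 1; ext1 k
  ext x
  simp only [BoundedContinuousFunction.sub_apply, BoundedContinuousFunction.smul_apply, cosC_sub,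
    smul_eq_mul]
  ring

theorem cosC_green (f : ℝ →ᵇ ℝ) (k : ℕ) : cosC k (green ω f) = wt ω k * cosC k f := by
  have h := (cosCL k).hasSum (summable_green hω f).hasSum
  have h2 : HasSum (fun m => cosCL k ((wt ω m * cosC m f) • cosB m)) (wt ω k * cosC k f) := by
    have h3 := hasSum_ite_eq k (wt ω k * cosC k f)
    refine h3.congr_fun fun m => ?_
    rw [map_smul, smul_eq_mul, cosCL_apply]
    split_ifs with hm
    · rw [hm]
      exact (congrArg _ (cosC_cos_self k)).trans (mul_one _)
    · exact (congrArg _ (cosC_cos_of_ne (Ne.symm hm))).trans (mul_zero _)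
  exact h.unique h2

theorem green_periodic (f : ℝ →ᵇ ℝ) : Function.Periodic (green ω f) (2 * π) := by
  intro x
  refine (hasSum_green hω f (x + 2 * π)).unique ?_
  have h := hasSum_green hω f x
  exact h.congr_fun fun k => congrArg (_ * ·) (periodic_cos_nat_mul k x)

theorem green_even (f : ℝ →ᵇ ℝ) (x : ℝ) : green ω f (-x) = green ω f x := by
  refine (hasSum_green hω f (-x)).unique ?_
  have h := hasSum_green hω f x
  exact h.congr_fun fun k => by rw [mul_neg, cos_neg]

omit hω in
theorem norm_iteratedDeriv_cos_le (k : ℕ) (c : ℝ) (n : ℕ) (x : ℝ) :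
    ‖iteratedFDeriv ℝ n (fun x : ℝ => c * cos (k * x)) x‖ ≤ |c| * (k : ℝ) ^ n := by
  rw [norm_iteratedFDeriv_eq_norm_iteratedDeriv]
  have h1 : iteratedDeriv n (fun x : ℝ => c * cos (k * x)) x
      = c * iteratedDeriv n (fun x : ℝ => cos (k * x)) x :=
    iteratedDeriv_const_mul_field c _
  have h2 := congrFun (iteratedDeriv_comp_const_mul (n := n) (f := Real.cos) (by fun_prop) (k : ℝ)) x
  rw [h1, h2, norm_mul, norm_mul, norm_pow]
  have h3 : ‖iteratedDeriv n cos (k * x)‖ ≤ 1 := Real.abs_iteratedDeriv_cos_le_one n _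
  simp only [Real.norm_eq_abs, Nat.abs_cast]
  have : 0 ≤ |c| * (k : ℝ) ^ n := by positivity
  calc _ = (|c| * (k : ℝ) ^ n) * ‖iteratedDeriv n cos (k * x)‖ := by rw [Real.norm_eq_abs]; ring
    _ ≤ (|c| * (k : ℝ) ^ n) * 1 := by gcongr
    _ = _ := mul_one _

omit hω in
theorem pow_le_one_add_pow (k : ℕ) {m n : ℕ} (h : m ≤ n) : (k : ℝ) ^ m ≤ 1 + (k : ℝ) ^ n := by
  rcases Nat.eq_zero_or_pos k with rfl | hk
  · rcases Nat.eq_zero_or_pos m with rfl | hm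
    · simp
    · simp [hm.ne']; positivity
  · have : (1 : ℝ) ≤ k := by exact_mod_cast hk
    have := pow_le_pow_right₀ this h
    linarith

omit hω in
/-- A cosine series with rapidly decaying coefficients is smooth. -/
theorem contDiff_tsum_cos {b : ℕ → ℝ} {n : ℕ} (h : Summable fun k : ℕ => |b k| * (1 + (k : ℝ) ^ n)) :
    ContDiff ℝ n fun x => ∑' k : ℕ, b k * cos (k * x) := by
  refine contDiff_tsum (N := (n : ℕ∞)) (v := fun m k => |b k| * (k : ℝ) ^ m)
    (fun k => by fun_prop) (fun m hm => ?_) (fun m k x _ => norm_iteratedDeriv_cos_le k (b k) m x)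
  refine Summable.of_nonneg_of_le (fun k => by positivity) (fun k => ?_) h
  exact mul_le_mul_of_nonneg_left (pow_le_one_add_pow k (by exact_mod_cast hm)) (abs_nonneg _)

theorem contDiff_two_green (f : ℝ →ᵇ ℝ) : ContDiff ℝ 2 (green ω f) := by
  have e : (green ω f : ℝ → ℝ) = fun x => ∑' k : ℕ, wt ω k * cosC k f * cos (k * x) :=
    funext fun x => (hasSum_green hω f x).tsum_eq.symm
  rw [e]
  refine contDiff_tsum_cos (n := 2) ?_
  refine Summable.of_nonneg_of_le (fun k => by positivity) (fun k => ?_)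
    (summable_majorant.mul_right ‖f‖)
  have := sq_mul_wt_mul_le hω k (abs_cosC_le (abs_apply_le f) k)
  rwa [mul_comm, abs_mul, abs_of_pos (by positivity : 0 < 1 + (k : ℝ) ^ 2)] at this

/-- For bounded data the majorant allows only two derivatives. For f in C² the relation k² c_k(f) =
-c_k(f'') transfers two more to f''. -/
theorem contDiff_four_green (f : ℝ →ᵇ ℝ) (hf : ContDiff ℝ 2 f)
    (hfp : Function.Periodic f (2 * π)) : ContDiff ℝ 4 (green ω f) := by
  have e : (green ω f : ℝ → ℝ) = fun x => ∑' k : ℕ, wt ω k * cosC k f * cos (k * x) :=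
    funext fun x => (hasSum_green hω f x).tsum_eq.symm
  rw [e]
  refine contDiff_tsum_cos (n := 4) ?_
  have hc := hf.continuous_iteratedDeriv 2 le_rfl
  obtain ⟨M, hM⟩ : ∃ M, ∀ x, |iteratedDeriv 2 f x| ≤ M := by
    obtain ⟨M, hM⟩ := (isCompact_Icc (a := (0 : ℝ)) (b := 2 * π)).exists_bound_of_continuousOn
      hc.continuousOn
    refine ⟨M, fun x => ?_⟩
    obtain ⟨y, hy, hxy⟩ := (periodic_iteratedDeriv hfp 2).exists_mem_Ico₀ (by positivity) x
    rw [hxy]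
    exact hM y ⟨hy.1, hy.2.le⟩
  refine Summable.of_nonneg_of_le (fun k => by positivity) (fun k => ?_)
    (summable_majorant.mul_right (‖f‖ + M))
  have h1 := sq_mul_wt_mul_le hω k (abs_cosC_le (abs_apply_le f) k)
  have h2 := sq_mul_wt_mul_le hω k (abs_cosC_le hM k)
  rw [cosC_iteratedDeriv_two hf hfp] at h2
  have h5 : (0 : ℝ) < 1 + (k : ℝ) ^ 2 := by positivity
  rw [abs_mul, abs_of_pos h5, abs_mul] at h1 h2
  rw [abs_mul, abs_neg, abs_of_nonneg (by positivity : (0 : ℝ) ≤ (k : ℝ) ^ 2)] at h2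
  rw [abs_mul]
  have h3 : (0 : ℝ) ≤ (k : ℝ) ^ 2 := by positivity
  have h4 : 0 ≤ |wt ω k| * |cosC k f| := by positivity
  nlinarith

/-- Both sides are continuous, even and periodic, so comparing cosine coefficients is enough: symbol
and inverse cancel off the first harmonic, and on it both sides vanish. -/
theorem shOp_green (f : ℝ →ᵇ ℝ) (hf : ContDiff ℝ 2 f) (hfp : Function.Periodic f (2 * π))
    (hfe : ∀ x, f (-x) = f x) (x : ℝ) :
    shOp ω (green ω f) x = f x - cosC 1 f * cos x := by
  have h4 := contDiff_four_green hω f hf hfp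
  have hp := green_periodic hω f
  have he := green_even hω f
  have hc := f.continuous
  refine congrFun (eq_of_cosC_eq (continuous_shOp h4 ω) (g := fun x => f x - cosC 1 f * cos x)
    (by fun_prop) (fun x => ?_) (fun x => ?_) (fun x => ?_) (fun x => ?_) fun k => ?_) x
  · simp only [shOp, hp x, periodic_iteratedDeriv hp _ x]
  · simp only [hfp x, cos_add_two_pi]
  · simp only [shOp, he, iteratedDeriv_four, even_iteratedDeriv_two he,
      even_iteratedDeriv_two (even_iteratedDeriv_two he)]
  · simp only [hfe, cos_neg]
  · have e : (fun x => f x - cosC 1 f * cos x) = fun x => f x + (-cosC 1 f) * cos x := by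
      ext x; ring
    have e1 : cos = fun x : ℝ => cos ((1 : ℕ) * x) := by simp
    rw [cosC_shOp h4 hp, cosC_green hω, e, cosC_add hc (by fun_prop), cosC_const_mul, ← mul_assoc]
    rcases eq_or_ne k 1 with rfl | hk
    · have := cosC_cos_self 1
      rw [← e1] at this
      rw [this]; simp [wt]
    · have := cosC_cos_of_ne hk
      rw [← e1] at this
      rw [this, symbol_mul_wt hω hk]; simp

end Green

theorem tendsto_wt {ι : Type*} {l : Filter ι} {ω : ι → ℝ} {ω₀ : ℝ} (hω₀ : |ω₀ ^ 2 - 1| ≤ 1 / 10)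
    (h : Tendsto ω l (𝓝 ω₀)) (k : ℕ) : Tendsto (fun i => wt (ω i) k) l (𝓝 (wt ω₀ k)) := by
  unfold wt
  split_ifs with hk
  · exact tendsto_const_nhds
  · have h0 := symbol_sq_ge hω₀ hk
    have hp : 0 < (1 + (k : ℝ) ^ 2) ^ 2 / 7 := by positivity
    refine Tendsto.div tendsto_const_nhds ?_ (hp.trans_le h0).ne'
    exact ((tendsto_const_nhds.sub ((h.pow 2).mul_const _)).pow 2)

/-- The series converges termwise under a majorant that does not depend on ω. -/
theorem tendsto_green {ι : Type*} {l : Filter ι} {ω : ι → ℝ} {ω₀ : ℝ}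
    (hω₀ : |ω₀ ^ 2 - 1| ≤ 1 / 10) (hω : ∀ᶠ i in l, |ω i ^ 2 - 1| ≤ 1 / 10)
    (h : Tendsto ω l (𝓝 ω₀)) {f : ι → ℝ →ᵇ ℝ} {f₀ : ℝ →ᵇ ℝ} (hf : Tendsto f l (𝓝 f₀)) :
    Tendsto (fun i => green (ω i) (f i)) l (𝓝 (green ω₀ f₀)) := by
  have hb : ∀ᶠ i in l, ‖f i‖ ≤ ‖f₀‖ + 1 := by
    filter_upwards [hf.norm.eventually (gt_mem_nhds (lt_add_one ‖f₀‖))] with i hi using hi.le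
  refine tendsto_tsum_of_dominated_convergence
    (bound := fun k => majorant k * (‖f₀‖ + 1)) (summable_majorant.mul_right _) (fun k => ?_) ?_
  · have h1 : Tendsto (fun i => cosC k (f i)) l (𝓝 (cosC k f₀)) :=
      ((cosCL k).continuous.tendsto f₀).comp hf
    exact ((tendsto_wt hω₀ h k).mul h1).smul_const _
  · filter_upwards [hω, hb] with i hi hi' k
    exact (norm_green_term_le hi _ k).trans (mul_le_mul_of_nonneg_left hi' (majorant_nonneg k))

end

noncomputable section

open BoundedContinuousFunction

/-! ### Existence, uniqueness and continuous dependence of the rolls -/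

/-- The profile `a cos x + δ g`, which is the roll divided by `δ`. -/
def profileB (δ : ℝ) (p : ℝ × (ℝ →ᵇ ℝ)) : ℝ →ᵇ ℝ := p.1 • cosB 1 + δ • p.2

theorem profileB_apply (δ : ℝ) (p : ℝ × (ℝ →ᵇ ℝ)) (x : ℝ) :
    profileB δ p x = p.1 * cos x + δ * p.2 x := by
  simp [profileB]

/-- The Lyapunov–Schmidt fixed point map for the rolls. -/
def rollMap (δ Ω : ℝ) (p : ℝ × (ℝ →ᵇ ℝ)) : ℝ × (ℝ →ᵇ ℝ) :=
  (p.1 + ((1 - Ω ^ 2) * p.1 - cosC 1 (profileB δ p ^ 3 : ℝ →ᵇ ℝ)) / 2,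
    δ • green (wavenumber δ Ω) (profileB δ p - profileB δ p ^ 3))

/-- The region in which the rolls are found. -/
def rollRegion : Set (ℝ × (ℝ →ᵇ ℝ)) := Icc 1 (6 / 5) ×ˢ Metric.closedBall 0 1

/-- From cos³ = (3/4) cos + (1/4) cos 3x; this is the cubic coefficient of the amplitude equation.
-/
theorem cosC_one_cube (a : ℝ) : cosC 1 ((a • cosB 1) ^ 3 : ℝ →ᵇ ℝ) = 3 / 4 * a ^ 3 := by
  have e : ((a • cosB 1) ^ 3 : ℝ →ᵇ ℝ) = (3 / 4 * a ^ 3) • cosB 1 + (a ^ 3 / 4) • cosB 3 := by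
    ext x
    have := cos_three_mul x
    simp only [BoundedContinuousFunction.coe_pow, Pi.pow_apply,
      BoundedContinuousFunction.smul_apply, BoundedContinuousFunction.add_apply, cosB_apply,
      smul_eq_mul, Nat.cast_one, one_mul, Nat.cast_ofNat, this]
    ring
  have h1 : cosCL 1 (cosB 1) = 1 := cosC_cos_self 1
  have h3 : cosCL 1 (cosB 3) = 0 := cosC_cos_of_ne (by norm_num)
  rw [e, ← cosCL_apply, map_add, map_smul, map_smul, h1, h3]
  simp

theorem abs_cosC_sub_le (f g : ℝ →ᵇ ℝ) (k : ℕ) : |cosC k f - cosC k g| ≤ 2 * ‖f - g‖ := by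
  rw [← cosC_sub]; exact abs_cosC_le (abs_apply_le _) k

theorem norm_le_of_pointwise {f : ℝ →ᵇ ℝ} {C : ℝ} (h : ∀ x, |f x| ≤ C) : ‖f‖ ≤ C :=
  (BoundedContinuousFunction.norm_le ((abs_nonneg _).trans (h 0))).mpr h

theorem mem_rollRegion {p : ℝ × (ℝ →ᵇ ℝ)} :
    p ∈ rollRegion ↔ 1 ≤ p.1 ∧ p.1 ≤ 6 / 5 ∧ ‖p.2‖ ≤ 1 := by
  simp [rollRegion, mem_prod, and_assoc]

theorem wavenumber_sq {δ Ω : ℝ} (hδ : 0 < δ) (hδ1 : δ ≤ 1 / 1000) (hΩ : Ω ∈ Ioo (-1 / 3 : ℝ) (1 / 3)) :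
    wavenumber δ Ω ^ 2 = 1 + δ * Ω := by
  refine Real.sq_sqrt ?_
  nlinarith [hΩ.1, hΩ.2]

theorem abs_wavenumber_sq_sub_one {δ Ω : ℝ} (hδ : 0 < δ) (hδ1 : δ ≤ 1 / 1000)
    (hΩ : Ω ∈ Ioo (-1 / 3 : ℝ) (1 / 3)) : |wavenumber δ Ω ^ 2 - 1| ≤ 1 / 10 := by
  rw [wavenumber_sq hδ hδ1 hΩ, abs_le]
  constructor <;> nlinarith [hΩ.1, hΩ.2]

theorem abs_profile_le {δ a c g : ℝ} (hδ : 0 < δ) (hδ1 : δ ≤ 1 / 1000) (ha : 1 ≤ a)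
    (ha' : a ≤ 6 / 5) (hc : |c| ≤ 1) (hg : |g| ≤ 1) : |a * c + δ * g| ≤ 13 / 10 := by
  rw [abs_le] at *
  constructor <;> nlinarith

theorem abs_mul_le_of {a b A B : ℝ} (ha : |a| ≤ A) (hb : |b| ≤ B) : |a * b| ≤ A * B := by
  rw [abs_mul]; exact mul_le_mul ha hb (abs_nonneg _) ((abs_nonneg _).trans ha)

theorem abs_cube_sub_cube_le {x y M : ℝ} (hx : |x| ≤ M) (hy : |y| ≤ M) :
    |x ^ 3 - y ^ 3| ≤ 3 * M ^ 2 * |x - y| := by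
  have e : x ^ 3 - y ^ 3 = (x * x + x * y + y * y) * (x - y) := by ring
  rw [e, abs_mul]
  refine mul_le_mul_of_nonneg_right ?_ (abs_nonneg _)
  calc _ ≤ |x * x| + |x * y| + |y * y| := abs_add_three _ _ _
    _ ≤ M * M + M * M + M * M := by
      gcongr <;> exact abs_mul_le_of (by assumption) (by assumption)
    _ = _ := by ring

theorem norm_profileB_le {δ : ℝ} (hδ : 0 < δ) (hδ1 : δ ≤ 1 / 1000) {p : ℝ × (ℝ →ᵇ ℝ)}
    (hp : p ∈ rollRegion) (x : ℝ) : |profileB δ p x| ≤ 13 / 10 := by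
  obtain ⟨h1, h2, h3⟩ := mem_rollRegion.mp hp
  rw [profileB_apply]
  exact abs_profile_le hδ hδ1 h1 h2 (abs_cos_le_one x) ((abs_apply_le _ x).trans h3)

/-- Up to O(δ) the amplitude component is a + ((1 - Ω²)a - (3/4)a³)/2, which keeps [1, 6/5] strictly
inside itself for Ω² ≤ 1/9. The other component carries a factor δ. -/
theorem rollMap_mapsTo {δ Ω : ℝ} (hδ : 0 < δ) (hδ1 : δ ≤ 1 / 1000)
    (hδ2 : 8 * (δ * greenBound) ≤ 1) (hΩ : Ω ∈ Ioo (-1 / 3 : ℝ) (1 / 3)) :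
    MapsTo (rollMap δ Ω) rollRegion rollRegion := by
  intro p hp
  have hW := norm_profileB_le hδ hδ1 hp
  obtain ⟨h1, h2, h3⟩ := mem_rollRegion.mp hp
  have hcube : |cosC 1 (profileB δ p ^ 3 : ℝ →ᵇ ℝ) - 3 / 4 * p.1 ^ 3| ≤ 2 * (6 * δ) := by
    rw [← cosC_one_cube]
    refine (abs_cosC_sub_le _ _ 1).trans ?_
    refine mul_le_mul_of_nonneg_left (norm_le_of_pointwise fun x => ?_) zero_le_two
    have hac : |p.1 * cos x| ≤ 13 / 10 := by
      have := abs_mul_le_of (abs_le.mpr ⟨by linarith, h2⟩ : |p.1| ≤ 6 / 5) (abs_cos_le_one x)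
      linarith
    have := abs_cube_sub_cube_le (hW x) hac
    have e : profileB δ p x - p.1 * cos x = δ * p.2 x := by rw [profileB_apply]; ring
    rw [e, abs_mul, abs_of_pos hδ] at this
    have hg : |p.2 x| ≤ 1 := (abs_apply_le _ x).trans h3
    have e2 : (profileB δ p ^ 3 - (p.1 • cosB 1) ^ 3 : ℝ →ᵇ ℝ) x
        = profileB δ p x ^ 3 - (p.1 * cos x) ^ 3 := by simp
    rw [e2]
    nlinarith
  rw [mem_rollRegion]
  obtain ⟨c1, c2⟩ := abs_le.mp hcube
  have hO : Ω ^ 2 ≤ 1 / 9 := by nlinarith [hΩ.1, hΩ.2]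
  have hO' : 0 ≤ Ω ^ 2 := sq_nonneg _
  simp only [rollMap]
  refine ⟨?_, ?_, ?_⟩
  · nlinarith [mul_nonneg (sub_nonneg.mpr h1) (sub_nonneg.mpr h2)]
  · have hq : p.1 * Ω ^ 2 ≥ 0 := by positivity
    -- At Ω = 0 the map a ↦ 3a/2 - 3a³/8 has its maximum at its fixed point t = 2/√3 ≈ 1.1547. The
    -- hint is the tangent bound a³ - 3t²a + 2t³ = (a + 2t)(a - t)² ≥ 0, with t and 2t rounded.
    nlinarith [mul_nonneg (by linarith : (0 : ℝ) ≤ p.1 + 2.3) (sq_nonneg (p.1 - 1.1547)), sq_nonneg (p.1 - 1.1547)]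
  · have hb : ‖profileB δ p - profileB δ p ^ 3‖ ≤ 8 := by
      refine norm_le_of_pointwise fun x => ?_
      have h := abs_cube_sub_cube_le (hW x) (y := 0) (by norm_num)
      rw [BoundedContinuousFunction.sub_apply]
      refine (abs_sub _ _).trans ?_
      simp only [BoundedContinuousFunction.coe_pow, Pi.pow_apply]
      have := hW x
      norm_num at h
      rw [abs_pow] at *
      nlinarith [abs_nonneg (profileB δ p x)]
    rw [norm_smul, Real.norm_of_nonneg hδ.le]
    calc _ ≤ δ * (greenBound * 8) := by
          gcongr
          refine (norm_green_le (abs_wavenumber_sq_sub_one hδ hδ1 hΩ) _).trans ?_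
          exact mul_le_mul_of_nonneg_left hb greenBound_nonneg
      _ ≤ 1 := by linarith

/-- The damping 1/2 makes the slope 1 + (1 - Ω²)/2 - (3/8)(p² + pq + q²) of the leading amplitude
map at most 2/5 in modulus on [1, 6/5]. What the cubic adds beyond its leading part is O(δ), and the
second component has Lipschitz constant 14 δ `greenBound` ≤ 1/2. -/
theorem rollMap_lipschitz {δ Ω : ℝ} (hδ : 0 < δ) (hδ1 : δ ≤ 1 / 1000)
    (hδ2 : 28 * (δ * greenBound) ≤ 1) (hΩ : Ω ∈ Ioo (-1 / 3 : ℝ) (1 / 3))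
    (p : ℝ × (ℝ →ᵇ ℝ)) (hp : p ∈ rollRegion) (q : ℝ × (ℝ →ᵇ ℝ)) (hq : q ∈ rollRegion) :
    dist (rollMap δ Ω p) (rollMap δ Ω q) ≤ 1 / 2 * dist p q := by
  have hWp := norm_profileB_le hδ hδ1 hp
  have hWq := norm_profileB_le hδ hδ1 hq
  obtain ⟨p1, p2, p3⟩ := mem_rollRegion.mp hp
  obtain ⟨q1, q2, q3⟩ := mem_rollRegion.mp hq
  set d := dist p q with hd
  have hd0 : 0 ≤ d := dist_nonneg
  have hda : |p.1 - q.1| ≤ d := by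
    rw [hd, Prod.dist_eq, ← Real.dist_eq]; exact le_max_left _ _
  have hdg : ‖p.2 - q.2‖ ≤ d := by
    rw [hd, Prod.dist_eq, ← dist_eq_norm]; exact le_max_right _ _
  have hdgx : ∀ x, |p.2 x - q.2 x| ≤ d := fun x =>
    (abs_apply_le (p.2 - q.2) x).trans hdg
  rw [Prod.dist_eq]
  refine max_le ?_ ?_
  · set P : ℝ →ᵇ ℝ := profileB δ p ^ 3 - (p.1 • cosB 1) ^ 3 with hP
    set Q : ℝ →ᵇ ℝ := profileB δ q ^ 3 - (q.1 • cosB 1) ^ 3 with hQ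
    have ep : cosC 1 (profileB δ p ^ 3 : ℝ →ᵇ ℝ) = cosC 1 P + 3 / 4 * p.1 ^ 3 := by
      rw [hP, cosC_sub, cosC_one_cube]; ring
    have eq : cosC 1 (profileB δ q ^ 3 : ℝ →ᵇ ℝ) = cosC 1 Q + 3 / 4 * q.1 ^ 3 := by
      rw [hQ, cosC_sub, cosC_one_cube]; ring
    have hPQ : ‖P - Q‖ ≤ 16 * δ * d := by
      refine norm_le_of_pointwise fun x => ?_
      have hgp : |p.2 x| ≤ 1 := (abs_apply_le _ x).trans p3
      have hgq : |q.2 x| ≤ 1 := (abs_apply_le _ x).trans q3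
      have hc := abs_cos_le_one x
      have hacp : |p.1 * cos x| ≤ 13 / 10 := by
        have := abs_mul_le_of (abs_le.mpr ⟨by linarith, p2⟩ : |p.1| ≤ 6 / 5) hc
        linarith
      have hacq : |q.1 * cos x| ≤ 13 / 10 := by
        have := abs_mul_le_of (abs_le.mpr ⟨by linarith, q2⟩ : |q.1| ≤ 6 / 5) hc
        linarith
      have hwp := hWp x
      have hwq := hWq x
      -- Arranged so that every term carries a factor δ: P and Q vanish at δ = 0, so their
      -- dependence on the amplitudes is O(δ) as well.
      have e : (P - Q) x = (p.1 - q.1) * (cos x * (δ * (p.2 x * (profileB δ p x + p.1 * cos x)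
          + (p.1 * cos x * q.2 x + p.2 x * profileB δ q x)
          + q.2 x * (profileB δ q x + q.1 * cos x))))
          + δ * (p.2 x - q.2 x) * (profileB δ p x * profileB δ p x
          + profileB δ p x * profileB δ q x + profileB δ q x * profileB δ q x) := by
        simp only [hP, hQ, BoundedContinuousFunction.sub_apply, BoundedContinuousFunction.coe_pow,
          Pi.pow_apply, BoundedContinuousFunction.smul_apply, cosB_apply, smul_eq_mul,
          Nat.cast_one, one_mul, profileB_apply]
        ring
      rw [e]
      have b1 : |p.2 x * (profileB δ p x + p.1 * cos x)| ≤ 1 * (13 / 10 + 13 / 10) :=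
        abs_mul_le_of hgp ((abs_add_le _ _).trans (add_le_add hwp hacp))
      have b2 : |p.1 * cos x * q.2 x| ≤ 13 / 10 * 1 := abs_mul_le_of hacp hgq
      have b3 : |p.2 x * profileB δ q x| ≤ 1 * (13 / 10) := abs_mul_le_of hgp hwq
      have b4 : |q.2 x * (profileB δ q x + q.1 * cos x)| ≤ 1 * (13 / 10 + 13 / 10) :=
        abs_mul_le_of hgq ((abs_add_le _ _).trans (add_le_add hwq hacq))
      have b5 : |p.2 x * (profileB δ p x + p.1 * cos x)
          + (p.1 * cos x * q.2 x + p.2 x * profileB δ q x)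
          + q.2 x * (profileB δ q x + q.1 * cos x)| ≤ 9 := by
        have := abs_add_three (p.2 x * (profileB δ p x + p.1 * cos x))
          (p.1 * cos x * q.2 x + p.2 x * profileB δ q x) (q.2 x * (profileB δ q x + q.1 * cos x))
        have := abs_add_le (p.1 * cos x * q.2 x) (p.2 x * profileB δ q x)
        linarith
      have b6 : |profileB δ p x * profileB δ p x
          + profileB δ p x * profileB δ q x + profileB δ q x * profileB δ q x| ≤ 6 := by
        have := abs_add_three (profileB δ p x * profileB δ p x)
          (profileB δ p x * profileB δ q x) (profileB δ q x * profileB δ q x)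
        have := abs_mul_le_of hwp hwp
        have := abs_mul_le_of hwp hwq
        have := abs_mul_le_of hwq hwq
        linarith
      refine (abs_add_le _ _).trans ?_
      have hδa : |δ| ≤ δ := (abs_of_pos hδ).le
      have t1 := abs_mul_le_of hda (abs_mul_le_of hc (abs_mul_le_of hδa b5))
      have t2 := abs_mul_le_of (abs_mul_le_of hδa (hdgx x)) b6
      nlinarith [mul_nonneg hδ.le hd0]
    have hPQ' := (abs_cosC_sub_le P Q 1).trans (mul_le_mul_of_nonneg_left hPQ zero_le_two)
    have hO : Ω ^ 2 ≤ 1 / 9 := by nlinarith [hΩ.1, hΩ.2]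
    have hO' : 0 ≤ Ω ^ 2 := sq_nonneg _
    simp only [rollMap]
    rw [ep, eq, Real.dist_eq]
    have e : p.1 + ((1 - Ω ^ 2) * p.1 - (cosC 1 P + 3 / 4 * p.1 ^ 3)) / 2
        - (q.1 + ((1 - Ω ^ 2) * q.1 - (cosC 1 Q + 3 / 4 * q.1 ^ 3)) / 2)
        = (p.1 - q.1) * (1 + (1 - Ω ^ 2) / 2 - 3 / 8 * (p.1 * p.1 + p.1 * q.1 + q.1 * q.1))
          + (-1 / 2) * (cosC 1 P - cosC 1 Q) := by ring
    rw [e]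
    have b : |1 + (1 - Ω ^ 2) / 2 - 3 / 8 * (p.1 * p.1 + p.1 * q.1 + q.1 * q.1)| ≤ 2 / 5 := by
      rw [abs_le]; constructor <;> nlinarith
    have t1 := abs_mul_le_of hda b
    have t2 := abs_mul_le_of (by norm_num [abs_div] : |(-1 / 2 : ℝ)| ≤ 1 / 2) hPQ'
    have := abs_add_le ((p.1 - q.1) * (1 + (1 - Ω ^ 2) / 2
      - 3 / 8 * (p.1 * p.1 + p.1 * q.1 + q.1 * q.1))) ((-1 / 2) * (cosC 1 P - cosC 1 Q))
    nlinarith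
  · simp only [rollMap]
    rw [dist_eq_norm, (smul_sub δ (green (wavenumber δ Ω) _) (green (wavenumber δ Ω) _)).symm, green_sub (abs_wavenumber_sq_sub_one hδ hδ1 hΩ), norm_smul,
      Real.norm_of_nonneg hδ.le]
    have hb : ‖profileB δ p - profileB δ p ^ 3 - (profileB δ q - profileB δ q ^ 3)‖ ≤ 14 * d := by
      refine norm_le_of_pointwise fun x => ?_
      have h := abs_cube_sub_cube_le (hWp x) (hWq x)
      have hw : |profileB δ p x - profileB δ q x| ≤ 2 * d := by
        have e : profileB δ p x - profileB δ q x
            = (p.1 - q.1) * cos x + δ * (p.2 x - q.2 x) := by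
          rw [profileB_apply, profileB_apply]; ring
        rw [e]
        have t1 := abs_mul_le_of hda (abs_cos_le_one x)
        have t2 := abs_mul_le_of (abs_of_pos hδ).le (hdgx x)
        have := abs_add_le ((p.1 - q.1) * cos x) (δ * (p.2 x - q.2 x))
        nlinarith
      have e : (profileB δ p - profileB δ p ^ 3 - (profileB δ q - profileB δ q ^ 3) : ℝ →ᵇ ℝ) x
          = (profileB δ p x - profileB δ q x) - (profileB δ p x ^ 3 - profileB δ q x ^ 3) := by
        simp only [BoundedContinuousFunction.sub_apply, BoundedContinuousFunction.coe_pow,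
          Pi.pow_apply]; ring
      rw [e]
      have := abs_sub (profileB δ p x - profileB δ q x) (profileB δ p x ^ 3 - profileB δ q x ^ 3)
      nlinarith
    calc _ ≤ δ * (greenBound * (14 * d)) := by
          gcongr
          refine (norm_green_le (abs_wavenumber_sq_sub_one hδ hδ1 hΩ) _).trans ?_
          exact mul_le_mul_of_nonneg_left hb greenBound_nonneg
      _ ≤ 1 / 2 * d := by nlinarith

theorem isClosed_rollRegion : IsClosed rollRegion := isClosed_Icc.prod Metric.isClosed_closedBall

theorem exists_rollMap_fixed {δ Ω : ℝ} (hδ : 0 < δ) (hδ1 : δ ≤ 1 / 1000)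
    (hδ2 : 28 * (δ * greenBound) ≤ 1) (hΩ : Ω ∈ Ioo (-1 / 3 : ℝ) (1 / 3)) :
    ∃ p ∈ rollRegion, rollMap δ Ω p = p :=
  exists_fixedPoint_of_contraction isClosed_rollRegion
    ⟨(1, 0), mem_rollRegion.mpr (by norm_num)⟩
    (rollMap_mapsTo hδ hδ1 (by nlinarith [mul_nonneg hδ.le greenBound_nonneg]) hΩ) (by norm_num)
    (by norm_num : (1 / 2 : ℝ) < 1) (rollMap_lipschitz hδ hδ1 hδ2 hΩ)

theorem rollMap_fixed_unique {δ Ω : ℝ} (hδ : 0 < δ) (hδ1 : δ ≤ 1 / 1000)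
    (hδ2 : 28 * (δ * greenBound) ≤ 1) (hΩ : Ω ∈ Ioo (-1 / 3 : ℝ) (1 / 3))
    {p q : ℝ × (ℝ →ᵇ ℝ)} (hp : p ∈ rollRegion) (hq : q ∈ rollRegion)
    (hpf : rollMap δ Ω p = p) (hqf : rollMap δ Ω q = q) : p = q := by
  have h := rollMap_lipschitz hδ hδ1 hδ2 hΩ p hp q hq
  rw [hpf, hqf] at h
  exact dist_le_zero.mp (by linarith [dist_nonneg (x := p) (y := q)])

end

/-! ### Fixed points are exactly the rolls. -/

noncomputable section

open BoundedContinuousFunction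

theorem shOp_const_mul (ω c : ℝ) (f : ℝ → ℝ) (x : ℝ) :
    shOp ω (fun x => c * f x) x = c * shOp ω f x := by
  have h2 : iteratedDeriv 2 (fun x => c * f x) x = c * iteratedDeriv 2 f x :=
    iteratedDeriv_const_mul_field c f
  have h4 : iteratedDeriv 4 (fun x => c * f x) x = c * iteratedDeriv 4 f x :=
    iteratedDeriv_const_mul_field c f
  simp only [shOp, h2, h4]; ring

theorem shOp_add {f g : ℝ → ℝ} (hf : ContDiff ℝ 4 f) (hg : ContDiff ℝ 4 g) (ω x : ℝ) :
    shOp ω (fun x => f x + g x) x = shOp ω f x + shOp ω g x := by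
  have h2 : iteratedDeriv 2 (fun x => f x + g x) x = iteratedDeriv 2 f x + iteratedDeriv 2 g x :=
    iteratedDeriv_fun_add (hf.of_le (by norm_num)).contDiffAt (hg.of_le (by norm_num)).contDiffAt
  have h4 : iteratedDeriv 4 (fun x => f x + g x) x = iteratedDeriv 4 f x + iteratedDeriv 4 g x :=
    iteratedDeriv_fun_add hf.contDiffAt hg.contDiffAt
  simp only [shOp, h2, h4]; ring

theorem iteratedDeriv_two_cos : iteratedDeriv 2 cos = fun x => (-1) * cos x := by
  ext x; have := iteratedDeriv_two_cos_mul 1 x; simp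

theorem shOp_cos (ω x : ℝ) : shOp ω cos x = (1 - ω ^ 2) ^ 2 * cos x := by
  have h4 : iteratedDeriv 4 cos x = cos x := by
    rw [iteratedDeriv_four, iteratedDeriv_two_cos, iteratedDeriv_const_mul_field,
      iteratedDeriv_two_cos]; ring
  rw [shOp, h4, iteratedDeriv_two_cos]; ring

/-- The relaxation factor in the amplitude component disappears at a fixed point and leaves the
projected equations on and off the first harmonic. -/
theorem rollMap_fixed_iff {δ Ω : ℝ} {p : ℝ × (ℝ →ᵇ ℝ)} :
    rollMap δ Ω p = p ↔ (1 - Ω ^ 2) * p.1 = cosC 1 (profileB δ p ^ 3 : ℝ →ᵇ ℝ) ∧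
      p.2 = δ • green (wavenumber δ Ω) (profileB δ p - profileB δ p ^ 3) := by
  rw [Prod.ext_iff]
  simp only [rollMap]
  constructor
  · rintro ⟨h1, h2⟩; exact ⟨by linarith, h2.symm⟩
  · rintro ⟨h1, h2⟩; exact ⟨by linarith, h2.symm⟩

/-- Regularity is bootstrapped: the Green operator puts the profile in C², hence W - W³ in C², hence
the profile in C⁴. The resonant part Ω²a cos x of W - W³, which `green` discards, is restored by (1
- ω²)² a cos x = δ²Ω² a cos x; this is where the amplitude equation enters. -/
theorem isRollProfile_of_fixed {δ Ω : ℝ} (hδ : 0 < δ) (hδ1 : δ ≤ 1 / 1000)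
    (hΩ : Ω ∈ Ioo (-1 / 3 : ℝ) (1 / 3)) {p : ℝ × (ℝ →ᵇ ℝ)} (hp : p ∈ rollRegion)
    (hf : rollMap δ Ω p = p) :
    IsRollProfile δ (wavenumber δ Ω) (fun x => δ * profileB δ p x) ∧
      cosCoeff (fun x => δ * profileB δ p x) = δ * p.1 := by
  have hω := abs_wavenumber_sq_sub_one hδ hδ1 hΩ
  obtain ⟨e1, e2⟩ := rollMap_fixed_iff.mp hf
  set ω := wavenumber δ Ω with hωd
  set F : ℝ →ᵇ ℝ := profileB δ p - profileB δ p ^ 3 with hF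
  have hgx : ∀ x, p.2 x = δ * green ω F x := fun x => by
    conv_lhs => rw [e2]
    rfl
  have hFx : ∀ x, F x = profileB δ p x - profileB δ p x ^ 3 := fun x => rfl
  have hWx : (profileB δ p : ℝ → ℝ) = fun x => p.1 * cos x + δ ^ 2 * green ω F x := by
    ext x; rw [profileB_apply, hgx]; ring
  have hW2 : ContDiff ℝ 2 (profileB δ p) := by
    rw [hWx]
    have := contDiff_two_green hω F
    fun_prop
  have hWp : Function.Periodic (profileB δ p) (2 * π) := fun x => by
    simp only [hWx, cos_add_two_pi, green_periodic hω F x]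
  have hWe : ∀ x, profileB δ p (-x) = profileB δ p x := fun x => by
    simp only [hWx, cos_neg, green_even hω F x]
  have hF2 : ContDiff ℝ 2 F := by
    have : (F : ℝ → ℝ) = fun x => profileB δ p x - profileB δ p x ^ 3 := funext hFx
    rw [this]; fun_prop
  have hFp : Function.Periodic F (2 * π) := fun x => by rw [hFx, hFx, hWp x]
  have hFe : ∀ x, F (-x) = F x := fun x => by rw [hFx, hFx, hWe x]
  have hG4 := contDiff_four_green hω F hF2 hFp
  have hW4 : ContDiff ℝ 4 (profileB δ p) := by rw [hWx]; fun_prop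
  have hc1 : cosC 1 (profileB δ p) = p.1 := by
    have h : cosC 1 (fun x => cos x) = 1 := by simpa using cosC_cos_self 1
    rw [hWx, cosC_add (by fun_prop) (by fun_prop), cosC_const_mul, cosC_const_mul, h,
      cosC_green hω]
    simp [wt]
  have hcF : cosC 1 F = Ω ^ 2 * p.1 := by
    rw [hF, cosC_sub, ← e1, hc1]; ring
  have hsh : ∀ x, shOp ω (profileB δ p) x = δ ^ 2 * F x := by
    intro x
    rw [hWx, shOp_add (by fun_prop) (by fun_prop), shOp_const_mul, shOp_const_mul, shOp_cos,
      shOp_green hω F hF2 hFp hFe, hcF, hωd, wavenumber_sq hδ hδ1 hΩ]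
    ring
  have hcc : cosCoeff (fun x => δ * profileB δ p x) = δ * p.1 := by
    rw [← cosC_one, cosC_const_mul, hc1]
  refine ⟨⟨by fun_prop, fun x => by simp only [hWp x], fun x => by simp only [hWe x],
    fun x => ?_, ?_⟩, hcc⟩
  · rw [shOp_const_mul, hsh, hFx]; ring
  · rw [hcc]
    have := (mem_rollRegion.mp hp).1
    positivity

/-! ### A priori bounds for arbitrary rolls -/

/-- Testing the equation with W gives ∫(W + ω²W'')² = δ²∫(W² - W⁴), so the right side is
nonnegative; then W² ≤ 1/2 + W⁴/2 absorbs half of ∫W⁴. -/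
theorem IsRollProfile.energy {δ ω : ℝ} {W : ℝ → ℝ} (hδ : 0 < δ) (hW : ContDiff ℝ 4 W)
    (hp : Function.Periodic W (2 * π)) (h : ∀ x, shOp ω W x = δ ^ 2 * (W x - W x ^ 3)) :
    ∫ x in (0 : ℝ)..(2 * π), W x ^ 4 ≤ 2 * π := by
  have hW2 : ContDiff ℝ 2 (iteratedDeriv 2 W) := ContDiff.iteratedDeriv_two (n := 2) hW
  have hc := hW.continuous
  have hc2 := hW2.continuous
  have hc4 : Continuous (iteratedDeriv 4 W) := hW.continuous_iteratedDeriv 4 le_rfl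
  have h1 : ∫ x in (0 : ℝ)..(2 * π), iteratedDeriv 4 W x * W x
      = ∫ x in (0 : ℝ)..(2 * π), iteratedDeriv 2 W x * iteratedDeriv 2 W x := by
    rw [iteratedDeriv_four]
    exact integral_iteratedDeriv_two_mul hW2 (hW.of_le (by norm_num))
      (periodic_iteratedDeriv hp 2) hp
  have h2 : ∫ x in (0 : ℝ)..(2 * π), shOp ω W x * W x
      = ∫ x in (0 : ℝ)..(2 * π), (W x + ω ^ 2 * iteratedDeriv 2 W x) ^ 2 := by
    have e : ∀ x, shOp ω W x * W x = (W x + ω ^ 2 * iteratedDeriv 2 W x) ^ 2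
        + ω ^ 4 * (iteratedDeriv 4 W x * W x - iteratedDeriv 2 W x * iteratedDeriv 2 W x) := by
      intro x; rw [shOp]; ring
    simp_rw [e]
    rw [intervalIntegral.integral_add (by apply Continuous.intervalIntegrable; fun_prop)
      (by apply Continuous.intervalIntegrable; fun_prop), intervalIntegral.integral_const_mul,
      intervalIntegral.integral_sub (by apply Continuous.intervalIntegrable; fun_prop)
      (by apply Continuous.intervalIntegrable; fun_prop), h1]
    ring
  have h3 : 0 ≤ ∫ x in (0 : ℝ)..(2 * π), shOp ω W x * W x := by
    rw [h2]
    exact intervalIntegral.integral_nonneg (by positivity) fun x _ => sq_nonneg _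
  have h4 : ∫ x in (0 : ℝ)..(2 * π), shOp ω W x * W x
      = δ ^ 2 * ∫ x in (0 : ℝ)..(2 * π), (W x ^ 2 - W x ^ 4) := by
    rw [← intervalIntegral.integral_const_mul]
    refine intervalIntegral.integral_congr fun x _ => ?_
    simp only [h]; ring
  rw [h4] at h3
  have h5 : 0 ≤ ∫ x in (0 : ℝ)..(2 * π), (W x ^ 2 - W x ^ 4) :=
    nonneg_of_mul_nonneg_right h3 (by positivity)
  have h6 : ∫ x in (0 : ℝ)..(2 * π), (W x ^ 2 - W x ^ 4)
      ≤ ∫ x in (0 : ℝ)..(2 * π), (1 / 2 - 1 / 2 * W x ^ 4) := by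
    refine intervalIntegral.integral_mono_on (by positivity)
      (by apply Continuous.intervalIntegrable; fun_prop)
      (by apply Continuous.intervalIntegrable; fun_prop) fun x _ => ?_
    nlinarith [sq_nonneg (W x ^ 2 - 1)]
  have h7 : ∫ x in (0 : ℝ)..(2 * π), (1 / 2 - 1 / 2 * W x ^ 4)
      = π - 1 / 2 * ∫ x in (0 : ℝ)..(2 * π), W x ^ 4 := by
    rw [intervalIntegral.integral_sub (by apply Continuous.intervalIntegrable; fun_prop)
      (by apply Continuous.intervalIntegrable; fun_prop), intervalIntegral.integral_const_mul]
    simp; ring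
  rw [h7] at h6
  linarith

theorem abs_le_one_add_pow_four (x : ℝ) : |x| ≤ 1 + x ^ 4 ∧ |x - x ^ 3| ≤ 2 + 2 * x ^ 4 := by
  have h1 : |x| ≤ 1 + x ^ 4 := by
    rw [abs_le]; constructor <;> nlinarith [sq_nonneg (x ^ 2 - 1 / 2), sq_nonneg (x - 1 / 2), sq_nonneg (x + 1 / 2)]
  have h3 : |x ^ 3| ≤ 1 + x ^ 4 := by
    rw [abs_le]; constructor <;> nlinarith [sq_nonneg (x ^ 2 - 1), sq_nonneg (x ^ 2 - x), sq_nonneg (x ^ 2 + x), sq_nonneg (x - 1), sq_nonneg (x + 1)]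
  exact ⟨h1, (abs_sub _ _).trans (by linarith)⟩

theorem abs_cosC_le_of_integral {f g : ℝ → ℝ} (hg : Continuous g) (h : ∀ x, |f x| ≤ g x)
    {M : ℝ} (hM : ∫ x in (0 : ℝ)..(2 * π), g x ≤ M) (k : ℕ) : |cosC k f| ≤ M / π := by
  have h1 : ‖∫ x in (0 : ℝ)..(2 * π), f x * cos (k * x)‖ ≤ ∫ x in (0 : ℝ)..(2 * π), g x := by
    refine intervalIntegral.norm_integral_le_of_norm_le (by positivity)
      (Eventually.of_forall fun x _ => ?_) (hg.intervalIntegrable _ _)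
    rw [norm_mul]
    exact (mul_le_mul (h x) (abs_cos_le_one _) (abs_nonneg _) ((abs_nonneg _).trans (h x))).trans
      (by simp)
  rw [cosC, abs_mul]
  have h2 : |(if k = 0 then 1 / (2 * π) else 1 / π)| ≤ 1 / π := by
    split_ifs
    · rw [abs_of_pos (by positivity)]
      exact one_div_le_one_div_of_le pi_pos (by linarith [pi_pos])
    · rw [abs_of_pos (by positivity)]
  calc _ ≤ 1 / π * M := mul_le_mul h2 (h1.trans hM) (abs_nonneg _) (by positivity)
    _ = M / π := by ring

/-- The error is relative to a³, so the positive factor a can be divided out. This excludes small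
amplitudes and pins a² near (4/3)(1 - o). -/
theorem amplitude_range {a o : ℝ} (ha : 0 < a) (h0 : 0 ≤ o) (h1 : o ≤ 1 / 9)
    (t1 : -(a ^ 3 / 100) ≤ (1 - o) * a - 3 / 4 * a ^ 3)
    (t2 : (1 - o) * a - 3 / 4 * a ^ 3 ≤ a ^ 3 / 100) : 1 ≤ a ∧ a ≤ 6 / 5 := by
  have s1 : a * (1 - o) ≤ a * (19 / 25 * a ^ 2) := by linarith
  have s2 : a * (37 / 50 * a ^ 2) ≤ a * (1 - o) := by linarith
  have s1' := le_of_mul_le_mul_left s1 ha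
  have s2' := le_of_mul_le_mul_left s2 ha
  constructor <;> nlinarith

/-- A bound for all rolls divided by `δ`. -/
def rollBound : ℝ := 4 + 4 * greenBound

/-- The energy bound controls the coefficients of W by 4 and those of W - W³ by 8. Inverting the
symbol off the first harmonic makes the coefficients of W summable, so |W| ≤ `rollBound`. Then W = a
cos x + δ²G, and since `green` annihilates a cos x, also G = `green`(δ²G - W³). As ‖W³‖ ≤
`rollBound`²(a + δ²‖G‖), this bounds ‖G‖ by a multiple of a, not just by a constant. Such a relative
estimate is what `amplitude_range` needs. -/
theorem exists_fixed_of_isRollProfile {δ Ω : ℝ} (hδ : 0 < δ) (hδ1 : δ ≤ 1 / 1000)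
    (hδ2 : 8000 * (δ * (greenBound * (1 + rollBound ^ 2))) ≤ 1)
    (hΩ : Ω ∈ Ioo (-1 / 3 : ℝ) (1 / 3)) {U : ℝ → ℝ}
    (hU : IsRollProfile δ (wavenumber δ Ω) U) :
    ∃ p ∈ rollRegion, rollMap δ Ω p = p ∧ U = fun x => δ * profileB δ p x := by
  have hω := abs_wavenumber_sq_sub_one hδ hδ1 hΩ
  set ω := wavenumber δ Ω with hωd
  have hgB := greenBound_nonneg
  obtain ⟨W, hWd⟩ : ∃ W : ℝ → ℝ, W = fun x => δ⁻¹ * U x := ⟨_, rfl⟩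
  have hU4 := hU.contDiff
  have hUc := hU4.continuous
  have hW4 : ContDiff ℝ 4 W := by rw [hWd]; fun_prop
  have hWc := hW4.continuous
  have hWp : Function.Periodic W (2 * π) := fun x => by simp only [hWd, hU.periodic x]
  have hWe : ∀ x, W (-x) = W x := fun x => by simp only [hWd, hU.even x]
  have hUW : ∀ x, U x = δ * W x := fun x => by simp only [hWd]; field_simp
  have hsh : ∀ x, shOp ω W x = δ ^ 2 * (W x - W x ^ 3) := by
    intro x
    have h := hU.equation x
    have h1 : shOp ω W x = δ⁻¹ * shOp ω U x := by rw [hWd, shOp_const_mul]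
    have h2 : shOp ω U x = δ ^ 2 * U x - U x ^ 3 := by linarith
    rw [h1, h2, hUW]; field_simp
  have hen := IsRollProfile.energy hδ hW4 hWp hsh
  have hI1 : ∫ x in (0 : ℝ)..(2 * π), (1 + W x ^ 4) ≤ 4 * π := by
    rw [intervalIntegral.integral_add (by simp) (by apply Continuous.intervalIntegrable; fun_prop)]
    simp; linarith
  have hI2 : ∫ x in (0 : ℝ)..(2 * π), (2 + 2 * W x ^ 4) ≤ 8 * π := by
    have : ∀ x, 2 + 2 * W x ^ 4 = 2 * (1 + W x ^ 4) := fun x => by ring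
    simp_rw [this, intervalIntegral.integral_const_mul]; linarith
  have ha4 : ∀ k, |cosC k W| ≤ 4 := fun k =>
    (abs_cosC_le_of_integral (by fun_prop) (fun x => (abs_le_one_add_pow_four (W x)).1) hI1 k).trans
      (by field_simp; rfl)
  have hF8 : ∀ k, |cosC k (fun x => W x - W x ^ 3)| ≤ 2 * 4 := fun k =>
    (abs_cosC_le_of_integral (by fun_prop) (fun x => (abs_le_one_add_pow_four (W x)).2) hI2 k).trans
      (by field_simp; norm_num)
  have hcc : ∀ k : ℕ, (1 - ω ^ 2 * k ^ 2) ^ 2 * cosC k W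
      = δ ^ 2 * cosC k (fun x => W x - W x ^ 3) := fun k => by
    rw [← cosC_shOp hW4 hWp, ← cosC_const_mul]; congr 1; ext x; exact hsh x
  have hck : ∀ k : ℕ, k ≠ 1 → cosC k W = δ ^ 2 * (wt ω k * cosC k (fun x => W x - W x ^ 3)) := by
    intro k hk
    have h := symbol_mul_wt hω hk
    calc cosC k W = ((1 - ω ^ 2 * k ^ 2) ^ 2 * wt ω k) * cosC k W := by rw [h, one_mul]
      _ = wt ω k * ((1 - ω ^ 2 * k ^ 2) ^ 2 * cosC k W) := by ring
      _ = _ := by rw [hcc k]; ring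
  set a := cosC 1 W with ha
  have ha0 : 0 < a := by
    have h := hU.amplitude_pos
    rw [ha, hWd, cosC_const_mul, cosC_one]
    positivity
  have hckb : ∀ k : ℕ, k ≠ 1 → |cosC k W| ≤ majorant k * 4 := by
    intro k hk
    rw [hck k hk, abs_mul, abs_of_nonneg (sq_nonneg δ)]
    have h := wt_mul_le hω k (hF8 k)
    have h1 : δ ^ 2 ≤ 1 := by nlinarith
    exact (mul_le_of_le_one_left (abs_nonneg _) h1).trans h
  have hsum4 : HasSum (fun k : ℕ => majorant k * 4 + if k = 1 then 4 else 0)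
      (greenBound * 4 + 4) := (summable_majorant.hasSum.mul_right 4).add (hasSum_ite_eq 1 _)
  have hckb' : ∀ k : ℕ, |cosC k W| ≤ majorant k * 4 + if k = 1 then 4 else 0 := by
    intro k
    rcases eq_or_ne k 1 with rfl | hk
    · have := majorant_nonneg 1
      have := ha4 1
      simp; linarith
    · simpa [hk] using hckb k hk
  have hcs : Summable fun k => cosC k W := Summable.of_norm_bounded hsum4.summable hckb'
  have hWb : ∀ x, |W x| ≤ rollBound := by
    intro x
    have h := hasSum_cosC hWc hWp hWe hcs x
    rw [← h.tsum_eq]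
    have h2 := tsum_of_norm_bounded (f := fun k : ℕ => cosC k W * cos (k * x)) hsum4 (fun k => by
      rw [norm_mul]
      exact (mul_le_of_le_one_right (norm_nonneg _) (abs_cos_le_one _)).trans (hckb' k))
    refine h2.trans ?_
    rw [rollBound]; linarith
  let WB : ℝ →ᵇ ℝ := BoundedContinuousFunction.ofNormedAddCommGroup W hWc rollBound hWb
  have hWB : ∀ x, WB x = W x := fun x => rfl
  set F : ℝ →ᵇ ℝ := WB - WB ^ 3 with hF
  have hFx : (F : ℝ → ℝ) = fun x => W x - W x ^ 3 := rfl
  obtain ⟨G, hG⟩ : ∃ G, G = green ω F := ⟨_, rfl⟩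
  have hWG : ∀ x, W x = a * cos x + δ ^ 2 * G x := by
    refine congrFun (eq_of_cosC_eq hWc (by fun_prop) hWp (fun x => ?_) hWe (fun x => ?_) fun k => ?_)
    · simp only [cos_add_two_pi, hG, green_periodic hω F x]
    · simp only [cos_neg, hG, green_even hω F x]
    · rw [cosC_add (by fun_prop) (by fun_prop), cosC_const_mul, cosC_const_mul, hG, cosC_green hω]
      rcases eq_or_ne k 1 with rfl | hk
      · have : cosC 1 cos = 1 := by simpa using cosC_cos_self 1
        rw [this]; simp [wt, ha]
      · have : cosC k cos = 0 := by simpa using cosC_cos_of_ne hk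
        rw [this, hck k hk, hFx]; simp
  -- the correction is small relative to the amplitude
  have hGk : G = green ω (δ ^ 2 • G - WB ^ 3) := by
    conv_lhs => rw [hG]
    rw [green, green]
    congr 1; ext1 k
    congr 1
    rcases eq_or_ne k 1 with rfl | hk
    · simp [wt]
    · congr 1
      have e : (F : ℝ →ᵇ ℝ) = a • cosB 1 + (δ ^ 2 • G - WB ^ 3) := by
        ext x
        have : F x = W x - W x ^ 3 := rfl
        rw [this]
        simp only [BoundedContinuousFunction.add_apply, BoundedContinuousFunction.sub_apply,
          BoundedContinuousFunction.smul_apply, BoundedContinuousFunction.coe_pow, Pi.pow_apply,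
          cosB_apply, smul_eq_mul, Nat.cast_one, one_mul, hWB]
        linarith [hWG x]
      have h0 : cosCL k (cosB 1) = 0 := cosC_cos_of_ne hk
      conv_lhs => rw [e]
      rw [← cosCL_apply, map_add, map_smul, h0, smul_zero, zero_add, cosCL_apply]
  have hWBn : ‖WB‖ ≤ rollBound := norm_le_of_pointwise hWb
  have hrB : 4 ≤ rollBound := by rw [rollBound]; linarith
  have hWa : ‖WB‖ ≤ a + δ ^ 2 * ‖G‖ := by
    refine norm_le_of_pointwise fun x => ?_
    rw [hWB, hWG]
    refine (abs_add_le _ _).trans (add_le_add ?_ ?_)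
    · rw [abs_mul, abs_of_pos ha0]
      exact mul_le_of_le_one_right ha0.le (abs_cos_le_one x)
    · rw [abs_mul, abs_of_nonneg (sq_nonneg δ)]
      exact mul_le_mul_of_nonneg_left (abs_apply_le G x) (sq_nonneg δ)
  have hGn : ‖G‖ ≤ 2 * greenBound * rollBound ^ 2 * a := by
    have h1 : ‖δ ^ 2 • G - WB ^ 3‖ ≤ δ ^ 2 * ‖G‖ + rollBound ^ 2 * (a + δ ^ 2 * ‖G‖) := by
      refine (norm_sub_le _ _).trans (add_le_add ?_ ?_)
      · rw [norm_smul, Real.norm_of_nonneg (sq_nonneg δ)]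
      · calc ‖WB ^ 3‖ ≤ ‖WB‖ ^ 3 := norm_pow_le WB 3
          _ = ‖WB‖ ^ 2 * ‖WB‖ := by ring
          _ ≤ _ := by gcongr
    have h2 := norm_green_le hω (δ ^ 2 • G - WB ^ 3)
    rw [← hGk] at h2
    have h3 := h2.trans (mul_le_mul_of_nonneg_left h1 hgB)
    have h4 : δ ^ 2 * (greenBound * (1 + rollBound ^ 2)) ≤ 1 / 2 := by
      have : 0 ≤ δ * (greenBound * (1 + rollBound ^ 2)) := by positivity
      nlinarith
    have h5 := mul_le_mul_of_nonneg_right h4 (norm_nonneg G)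
    nlinarith
  set g : ℝ →ᵇ ℝ := δ • G with hg
  have hgx : ∀ x, g x = δ * G x := fun x => rfl
  have hWg : profileB δ (a, g) = WB := by
    ext x; rw [profileB_apply, hWB, hWG, hgx]; ring
  have hκ : δ ^ 2 * ‖G‖ ≤ a / 4000 := by
    have h1 : δ * (2 * greenBound * rollBound ^ 2 * a) ≤ 1 / 4 * a := by
      have : 0 ≤ δ * greenBound := by positivity
      nlinarith
    have h2 := mul_le_mul_of_nonneg_left hGn hδ.le
    have h3 : δ * (δ * ‖G‖) ≤ 1 / 1000 * (1 / 4 * a) :=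
      mul_le_mul hδ1 (h2.trans h1) (by positivity) (by norm_num)
    nlinarith
  have hg1 : ‖g‖ ≤ 1 := by
    have h1 : δ * (2 * greenBound * rollBound ^ 2 * a) ≤ 1 / 4 * a := by
      have : 0 ≤ δ * greenBound := by positivity
      nlinarith
    have h2 := mul_le_mul_of_nonneg_left hGn hδ.le
    have := (le_abs_self a).trans (ha4 1)
    rw [hg, norm_smul, Real.norm_of_nonneg hδ.le]
    linarith
  have hamp : (1 - Ω ^ 2) * a = cosC 1 (WB ^ 3 : ℝ →ᵇ ℝ) := by
    -- On the first harmonic the symbol is (1 - ω²)² = δ²Ω², so δ² cancels and the amplitude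
    -- equation remains.
    have h := hcc 1
    have h2 : cosC 1 (fun x => W x - W x ^ 3) = a - cosC 1 (WB ^ 3 : ℝ →ᵇ ℝ) := by
      rw [← hFx, hF, cosC_sub]; rfl
    rw [h2, hωd, wavenumber_sq hδ hδ1 hΩ] at h
    have h3 : δ ^ 2 * (Ω ^ 2 * a) = δ ^ 2 * (a - cosC 1 (WB ^ 3 : ℝ →ᵇ ℝ)) := by
      rw [← h]; push_cast; ring
    have := mul_left_cancel₀ (pow_ne_zero 2 hδ.ne') h3
    linarith
  have hest : |cosC 1 (WB ^ 3 : ℝ →ᵇ ℝ) - 3 / 4 * a ^ 3| ≤ a ^ 3 / 100 := by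
    rw [← cosC_one_cube]
    refine (abs_cosC_sub_le _ _ 1).trans ?_
    have : ‖WB ^ 3 - (a • cosB 1) ^ 3‖ ≤ a ^ 3 / 200 := by
      refine norm_le_of_pointwise fun x => ?_
      have e2 : (WB ^ 3 - (a • cosB 1) ^ 3 : ℝ →ᵇ ℝ) x = W x ^ 3 - (a * cos x) ^ 3 := by
        simp only [BoundedContinuousFunction.sub_apply, BoundedContinuousFunction.coe_pow,
          Pi.pow_apply, BoundedContinuousFunction.smul_apply, cosB_apply, smul_eq_mul,
          Nat.cast_one, one_mul, hWB]
      have h1 : |W x| ≤ 11 / 10 * a := by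
        have := (abs_apply_le WB x).trans hWa
        rw [hWB] at this
        linarith
      have h2 : |a * cos x| ≤ 11 / 10 * a := by
        rw [abs_mul, abs_of_pos ha0]
        have := mul_le_of_le_one_right ha0.le (abs_cos_le_one x)
        linarith
      have h3 : |W x - a * cos x| ≤ a / 4000 := by
        have : W x - a * cos x = δ ^ 2 * G x := by rw [hWG x]; ring
        rw [this, abs_mul, abs_of_nonneg (sq_nonneg δ)]
        exact (mul_le_mul_of_nonneg_left (abs_apply_le G x) (sq_nonneg δ)).trans hκ
      rw [e2]
      refine (abs_cube_sub_cube_le h1 h2).trans ?_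
      have : 3 * (11 / 10 * a) ^ 2 * |W x - a * cos x| ≤ 3 * (11 / 10 * a) ^ 2 * (a / 4000) := by
        gcongr
      have ha3 : 0 < a ^ 3 := by positivity
      nlinarith
    linarith
  have hO : Ω ^ 2 ≤ 1 / 9 := by nlinarith [hΩ.1, hΩ.2]
  have hO' : 0 ≤ Ω ^ 2 := sq_nonneg _
  clear hsum4 hckb' hck hcc hF8 ha4 hckb hWB hWG hGk hκ hGn hWa
  rw [← hamp] at hest
  obtain ⟨t1, t2⟩ := abs_le.mp hest
  obtain ⟨r1, r2⟩ := amplitude_range ha0 hO' hO t1 t2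
  refine ⟨(a, g), mem_rollRegion.mpr ⟨?_, ?_, hg1⟩, ?_, ?_⟩
  · exact r1
  · exact r2
  · rw [rollMap_fixed_iff, hWg]
    exact ⟨hamp, by rw [hg, hG]⟩
  · rw [hWg]; ext x; exact hUW x

end

noncomputable section

open BoundedContinuousFunction

/-! ### Derivatives of the rolls -/

/-- Instead of differentiating the series termwise, the coefficients of the second derivative are
computed by Green's identity; they are summable, so `hasSum_cosC` applies to the derivative itself.
-/
theorem iteratedDeriv_two_green {ω : ℝ} (hω : |ω ^ 2 - 1| ≤ 1 / 10) (f : ℝ →ᵇ ℝ) (x : ℝ) :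
    iteratedDeriv 2 (green ω f) x
      = ∑' k : ℕ, -(k : ℝ) ^ 2 * (wt ω k * cosC k f) * cos (k * x) := by
  have h2 := contDiff_two_green hω f
  have hp := green_periodic hω f
  have hco : ∀ k : ℕ, cosC k (iteratedDeriv 2 (green ω f)) = -(k : ℝ) ^ 2 * (wt ω k * cosC k f) :=
    fun k => by rw [cosC_iteratedDeriv_two h2 hp, cosC_green hω]
  have hs : Summable fun k => cosC k (iteratedDeriv 2 (green ω f)) := by
    refine Summable.of_norm_bounded (summable_majorant.mul_right ‖f‖) fun k => ?_
    rw [hco, Real.norm_eq_abs]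
    refine le_trans ?_ (sq_mul_wt_mul_le hω k (abs_cosC_le (abs_apply_le f) k))
    rw [abs_mul, abs_mul (1 + (k : ℝ) ^ 2), abs_neg, abs_of_nonneg (sq_nonneg (k : ℝ)),
      abs_of_pos (by positivity : 0 < 1 + (k : ℝ) ^ 2)]
    gcongr
    linarith
  have h := hasSum_cosC (h2.continuous_iteratedDeriv 2 le_rfl) (periodic_iteratedDeriv hp 2)
    (even_iteratedDeriv_two (green_even hω f)) hs x
  simp only [hco] at h
  exact h.tsum_eq.symm

theorem norm_greenD_term_le {ω : ℝ} (hω : |ω ^ 2 - 1| ≤ 1 / 10) (f : ℝ →ᵇ ℝ) (x : ℝ) (k : ℕ) :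
    ‖-(k : ℝ) ^ 2 * (wt ω k * cosC k f) * cos (k * x)‖ ≤ majorant k * ‖f‖ := by
  rw [norm_mul]
  refine (mul_le_of_le_one_right (norm_nonneg _) (abs_cos_le_one _)).trans ?_
  refine le_trans ?_ (sq_mul_wt_mul_le hω k (abs_cosC_le (abs_apply_le f) k))
  rw [Real.norm_eq_abs, abs_mul, abs_mul (1 + (k : ℝ) ^ 2), abs_neg,
    abs_of_nonneg (sq_nonneg (k : ℝ)), abs_of_pos (by positivity : 0 < 1 + (k : ℝ) ^ 2)]
  gcongr
  linarith

theorem abs_iteratedDeriv_two_green_le {ω : ℝ} (hω : |ω ^ 2 - 1| ≤ 1 / 10) (f : ℝ →ᵇ ℝ) (x : ℝ) :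
    |iteratedDeriv 2 (green ω f) x| ≤ greenBound * ‖f‖ := by
  rw [iteratedDeriv_two_green hω]
  have h := tsum_of_norm_bounded (summable_majorant.mul_right ‖f‖).hasSum
    (norm_greenD_term_le hω f x)
  rwa [tsum_mul_right] at h

theorem tendsto_iteratedDeriv_two_green {ι : Type*} {l : Filter ι} {ω : ι → ℝ} {ω₀ : ℝ}
    (hω₀ : |ω₀ ^ 2 - 1| ≤ 1 / 10) (hω : ∀ᶠ i in l, |ω i ^ 2 - 1| ≤ 1 / 10)
    (h : Tendsto ω l (𝓝 ω₀)) {f : ι → ℝ →ᵇ ℝ} {f₀ : ℝ →ᵇ ℝ} (hf : Tendsto f l (𝓝 f₀))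
    {x : ι → ℝ} {x₀ : ℝ} (hx : Tendsto x l (𝓝 x₀)) :
    Tendsto (fun i => iteratedDeriv 2 (green (ω i) (f i)) (x i)) l
      (𝓝 (iteratedDeriv 2 (green ω₀ f₀) x₀)) := by
  have hb : ∀ᶠ i in l, ‖f i‖ ≤ ‖f₀‖ + 1 := by
    filter_upwards [hf.norm.eventually (gt_mem_nhds (lt_add_one ‖f₀‖))] with i hi using hi.le
  rw [iteratedDeriv_two_green hω₀]
  have key : Tendsto (fun i => ∑' k : ℕ, -(k : ℝ) ^ 2 * (wt (ω i) k * cosC k (f i)) * cos (k * x i)) l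
      (𝓝 (∑' k : ℕ, -(k : ℝ) ^ 2 * (wt ω₀ k * cosC k f₀) * cos (k * x₀))) := by
    refine tendsto_tsum_of_dominated_convergence
      (bound := fun k => majorant k * (‖f₀‖ + 1)) (summable_majorant.mul_right _) (fun k => ?_) ?_
    · have h1 : Tendsto (fun i => cosC k (f i)) l (𝓝 (cosC k f₀)) :=
        ((cosCL k).continuous.tendsto f₀).comp hf
      exact (((tendsto_wt hω₀ h k).mul h1).const_mul _).mul
        ((Real.continuous_cos.tendsto _).comp (hx.const_mul _))
    · filter_upwards [hω, hb] with i hi hi' k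
      exact (norm_greenD_term_le hi _ _ k).trans
        (mul_le_mul_of_nonneg_left hi' (majorant_nonneg k))
  refine key.congr' ?_
  filter_upwards [hω] with i hi
  rw [iteratedDeriv_two_green hi]

/-- A range of `δ` for which the rolls exist and are unique. -/
def rollThreshold : ℝ := 1 / (8000 * (1 + greenBound) * (1 + rollBound ^ 2))

theorem rollThreshold_pos : 0 < rollThreshold := by
  have := greenBound_nonneg
  unfold rollThreshold; positivity

theorem rollThreshold_spec {δ : ℝ} (h0 : 0 < δ) (h : δ < rollThreshold) :
    δ ≤ 1 / 1000 ∧ 28 * (δ * greenBound) ≤ 1 ∧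
      8000 * (δ * (greenBound * (1 + rollBound ^ 2))) ≤ 1 := by
  have hg := greenBound_nonneg
  have hr : 0 ≤ rollBound ^ 2 := sq_nonneg _
  have hp : 0 < 8000 * (1 + greenBound) * (1 + rollBound ^ 2) := by positivity
  have h1 : δ * (8000 * (1 + greenBound) * (1 + rollBound ^ 2)) < 1 := by
    rwa [rollThreshold, lt_div_iff₀ hp] at h
  have a1 : 0 ≤ δ * greenBound := by positivity
  have a2 : 0 ≤ δ * rollBound ^ 2 := by positivity
  have a3 : 0 ≤ δ * greenBound * rollBound ^ 2 := by positivity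
  refine ⟨by nlinarith, by nlinarith, by nlinarith⟩

/-- The set of parameters `(δ, Ω)` with rolls. -/
def rollSet : Set (ℝ × ℝ) := Ioo 0 rollThreshold ×ˢ Ioo (-1 / 3 : ℝ) (1 / 3)

open Classical in
/-- The fixed point that represents the roll. -/
def rollPair (q : ℝ × ℝ) : ℝ × (ℝ →ᵇ ℝ) :=
  if h : ∃ p ∈ rollRegion, rollMap q.1 q.2 p = p then h.choose else 0

theorem rollPair_spec {q : ℝ × ℝ} (hq : q ∈ rollSet) :
    rollPair q ∈ rollRegion ∧ rollMap q.1 q.2 (rollPair q) = rollPair q := by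
  obtain ⟨h1, h2, -⟩ := rollThreshold_spec hq.1.1 hq.1.2
  have h : ∃ p ∈ rollRegion, rollMap q.1 q.2 p = p := exists_rollMap_fixed hq.1.1 h1 h2 hq.2
  rw [rollPair, dif_pos h]
  exact h.choose_spec

/-- The chosen solution is some fixed point in `rollRegion` by the a priori estimate, and there is
only one; so the choice agrees with the constructed roll and inherits its quantitative description.
-/
theorem rollProfile_spec {q : ℝ × ℝ} (hq : q ∈ rollSet) :
    IsRollProfile q.1 (wavenumber q.1 q.2) (rollProfile q.1 (wavenumber q.1 q.2)) ∧
    rollProfile q.1 (wavenumber q.1 q.2) = (fun x => q.1 * profileB q.1 (rollPair q) x) ∧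
    amp q.1 q.2 = q.1 * (rollPair q).1 := by
  obtain ⟨h1, h2, h3⟩ := rollThreshold_spec hq.1.1 hq.1.2
  obtain ⟨s1, s2⟩ := rollPair_spec hq
  obtain ⟨t1, t2⟩ := isRollProfile_of_fixed hq.1.1 h1 hq.2 s1 s2
  have hex : ∃ U, IsRollProfile q.1 (wavenumber q.1 q.2) U := ⟨_, t1⟩
  have hr : IsRollProfile q.1 (wavenumber q.1 q.2) (rollProfile q.1 (wavenumber q.1 q.2)) := by
    rw [rollProfile, dif_pos hex]; exact hex.choose_spec
  obtain ⟨p, hp, hpf, hpU⟩ := exists_fixed_of_isRollProfile hq.1.1 h1 h3 hq.2 hr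
  have hpp := rollMap_fixed_unique hq.1.1 h1 h2 hq.2 hp s1 hpf s2
  subst hpp
  exact ⟨hr, hpU, by rw [amp, hpU, t2]⟩

/-- The nonlinearity `W - W³` at the rescaled roll. -/
def rollForce (q : ℝ × ℝ) : ℝ →ᵇ ℝ :=
  profileB q.1 (rollPair q) - profileB q.1 (rollPair q) ^ 3

/-- The remainder `(u - ε cos) / δ³` of the roll. -/
def rollRem (q : ℝ × ℝ) : ℝ →ᵇ ℝ := green (wavenumber q.1 q.2) (rollForce q)

theorem rollSet_wavenumber {q : ℝ × ℝ} (hq : q ∈ rollSet) :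
    |wavenumber q.1 q.2 ^ 2 - 1| ≤ 1 / 10 :=
  abs_wavenumber_sq_sub_one hq.1.1 (rollThreshold_spec hq.1.1 hq.1.2).1 hq.2

theorem profileB_rollPair {q : ℝ × ℝ} (hq : q ∈ rollSet) (x : ℝ) :
    profileB q.1 (rollPair q) x = (rollPair q).1 * cos x + q.1 ^ 2 * rollRem q x := by
  have h := (rollMap_fixed_iff.mp (rollPair_spec hq).2).2
  have : (rollPair q).2 x = q.1 * rollRem q x := by
    conv_lhs => rw [h]
    rfl
  rw [profileB_apply, this]; ring

theorem rollProfile_eq {q : ℝ × ℝ} (hq : q ∈ rollSet) (x : ℝ) :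
    rollProfile q.1 (wavenumber q.1 q.2) x = amp q.1 q.2 * cos x + q.1 ^ 3 * rollRem q x := by
  obtain ⟨-, h2, h3⟩ := rollProfile_spec hq
  rw [h2, h3]
  simp only [profileB_rollPair hq]; ring

theorem amp_mem {q : ℝ × ℝ} (hq : q ∈ rollSet) :
    q.1 ≤ amp q.1 q.2 ∧ amp q.1 q.2 ≤ 6 / 5 * q.1 := by
  obtain ⟨h1, h2, -⟩ := mem_rollRegion.mp (rollPair_spec hq).1
  have := hq.1.1
  rw [(rollProfile_spec hq).2.2]
  constructor <;> nlinarith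

theorem norm_rollForce_le {q : ℝ × ℝ} (hq : q ∈ rollSet) : ‖rollForce q‖ ≤ 8 := by
  have hW := norm_profileB_le hq.1.1 (rollThreshold_spec hq.1.1 hq.1.2).1 (rollPair_spec hq).1
  refine norm_le_of_pointwise fun x => ?_
  have h := abs_cube_sub_cube_le (hW x) (y := 0) (by norm_num)
  have e : rollForce q x = profileB q.1 (rollPair q) x - profileB q.1 (rollPair q) x ^ 3 := rfl
  rw [e]
  refine (abs_sub _ _).trans ?_
  have := hW x
  norm_num at h
  rw [abs_pow] at *
  nlinarith [abs_nonneg (profileB q.1 (rollPair q) x)]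

theorem rollForce_regular {q : ℝ × ℝ} (hq : q ∈ rollSet) :
    ContDiff ℝ 2 (rollForce q) ∧ Function.Periodic (rollForce q) (2 * π) ∧
      ∀ x, rollForce q (-x) = rollForce q x := by
  have hω := rollSet_wavenumber hq
  have h2 := contDiff_two_green hω (rollForce q)
  have e : (rollForce q : ℝ → ℝ) = fun x =>
      ((rollPair q).1 * cos x + q.1 ^ 2 * rollRem q x)
        - ((rollPair q).1 * cos x + q.1 ^ 2 * rollRem q x) ^ 3 := by
    ext x
    rw [← profileB_rollPair hq]; rfl
  have h2' : ContDiff ℝ 2 (rollRem q) := h2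
  refine ⟨by rw [e]; fun_prop, fun x => ?_, fun x => ?_⟩
  · simp only [e, cos_add_two_pi, rollRem, green_periodic hω _ x]
  · simp only [e, cos_neg, rollRem, green_even hω]

theorem contDiff_rollRem {q : ℝ × ℝ} (hq : q ∈ rollSet) : ContDiff ℝ 4 (rollRem q) :=
  contDiff_four_green (rollSet_wavenumber hq) _ (rollForce_regular hq).1 (rollForce_regular hq).2.1

theorem periodic_rollRem {q : ℝ × ℝ} (hq : q ∈ rollSet) : Function.Periodic (rollRem q) (2 * π) :=
  green_periodic (rollSet_wavenumber hq) _

/-- The differential equation is solved for its top derivative, so bounds and continuity of the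
fourth derivative follow from those of lower even order, where the series still converges. -/
theorem iteratedDeriv_four_rollRem {q : ℝ × ℝ} (hq : q ∈ rollSet) (x : ℝ) :
    iteratedDeriv 4 (rollRem q) x = (rollForce q x - q.2 ^ 2 * (rollPair q).1 * cos x - rollRem q x
      - 2 * wavenumber q.1 q.2 ^ 2 * iteratedDeriv 2 (rollRem q) x) / wavenumber q.1 q.2 ^ 4 := by
  have hω := rollSet_wavenumber hq
  obtain ⟨r1, r2, r3⟩ := rollForce_regular hq
  have h := shOp_green hω (rollForce q) r1 r2 r3 x
  have h1 := (rollMap_fixed_iff.mp (rollPair_spec hq).2).1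
  have hc1 : cosC 1 (profileB q.1 (rollPair q)) = (rollPair q).1 := by
    have h : cosC 1 (fun x => cos x) = 1 := by simpa using cosC_cos_self 1
    have e : (profileB q.1 (rollPair q) : ℝ → ℝ)
        = fun x => (rollPair q).1 * cos x + q.1 ^ 2 * rollRem q x := funext (profileB_rollPair hq)
    have hc := (rollRem q).continuous
    rw [e, cosC_add (by fun_prop) (by fun_prop), cosC_const_mul, cosC_const_mul, h, rollRem,
      cosC_green hω]
    simp [wt]
  have hcF : cosC 1 (rollForce q) = q.2 ^ 2 * (rollPair q).1 := by
    rw [rollForce, cosC_sub, ← h1, hc1]; ring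
  rw [hcF] at h
  have hw4 : wavenumber q.1 q.2 ^ 4 ≠ 0 := by
    have := (abs_le.mp hω).1
    have h2 : 0 < wavenumber q.1 q.2 ^ 2 := by linarith
    have : wavenumber q.1 q.2 ^ 4 = (wavenumber q.1 q.2 ^ 2) ^ 2 := by ring
    rw [this]; positivity
  rw [eq_div_iff hw4, ← h, shOp, rollRem]; ring

theorem odd_deriv_zero {f : ℝ → ℝ} (he : ∀ x, f (-x) = f x) : deriv f 0 = 0 := by
  have h := deriv_comp_neg f 0
  have h2 : (fun x => f (-x)) = f := funext he
  rw [h2, neg_zero] at h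
  linarith

/-- The derivative of an even function vanishes at 0. Odd-order derivatives are thus controlled by
even-order ones. -/
theorem deriv_eq_integral {f : ℝ → ℝ} (hf : ContDiff ℝ 2 f) (he : ∀ x, f (-x) = f x) (x : ℝ) :
    deriv f x = ∫ t in (0 : ℝ)..x, iteratedDeriv 2 f t := by
  have hf1 : ContDiff ℝ 1 (deriv f) := hf.deriv' (n := 1)
  have e : iteratedDeriv 2 f = deriv (deriv f) := by rw [iteratedDeriv_succ, iteratedDeriv_one]
  rw [e, intervalIntegral.integral_deriv_eq_sub
    (fun x _ => hf1.differentiable (by norm_num) x)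
    ((hf1.continuous_deriv le_rfl).intervalIntegrable _ _), odd_deriv_zero he, sub_zero]

theorem abs_deriv_le_of_periodic_even {f : ℝ → ℝ} (hf : ContDiff ℝ 2 f) (he : ∀ x, f (-x) = f x)
    (hp : Function.Periodic f (2 * π)) {M : ℝ} (hM : ∀ x, |iteratedDeriv 2 f x| ≤ M) (x : ℝ) :
    |deriv f x| ≤ M * (2 * π) := by
  obtain ⟨y, hy, hxy⟩ := (periodic_deriv hp).exists_mem_Ico₀ (by positivity) x
  have hM0 : 0 ≤ M := (abs_nonneg _).trans (hM 0)
  rw [hxy, deriv_eq_integral hf he]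
  refine (intervalIntegral.norm_integral_le_of_norm_le_const (f := iteratedDeriv 2 f)
    fun t _ => hM t).trans ?_
  rw [sub_zero, abs_of_nonneg hy.1]
  exact mul_le_mul_of_nonneg_left hy.2.le hM0

theorem even_rollRem {q : ℝ × ℝ} (hq : q ∈ rollSet) (x : ℝ) : rollRem q (-x) = rollRem q x :=
  green_even (rollSet_wavenumber hq) _ x

theorem iteratedDeriv_three (f : ℝ → ℝ) : iteratedDeriv 3 f = deriv (iteratedDeriv 2 f) :=
  iteratedDeriv_succ

/-- Orders 0 and 2 come from the series and order 4 from the equation; orders 1 and 3 follow by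
integrating over at most one period. All constants are uniform over `rollSet`. -/
theorem exists_bound_rollRem : ∃ C : ℝ, 0 ≤ C ∧ ∀ q ∈ rollSet, ∀ x, |rollRem q x| ≤ C ∧
    |deriv (rollRem q) x| ≤ C ∧ |iteratedDeriv 2 (rollRem q) x| ≤ C ∧
    |iteratedDeriv 3 (rollRem q) x| ≤ C := by
  have hg := greenBound_nonneg
  set A := greenBound * 8 with hA
  -- The factor 2 bounds ω⁻⁴; 10 covers the force (at most 8) and the resonant term, and 4A the
  -- remaining two terms of the equation.
  set B := 2 * (10 + 4 * A) with hB
  have hA0 : 0 ≤ A := by positivity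
  have hB0 : 0 ≤ B := by positivity
  refine ⟨(A + B) * (2 * π), by positivity, fun q hq x => ?_⟩
  have hω := rollSet_wavenumber hq
  have hF := norm_rollForce_le hq
  have h2π : 1 ≤ 2 * π := by linarith [pi_gt_three]
  have h0 : ∀ x, |rollRem q x| ≤ A := fun x =>
    (abs_apply_le _ x).trans ((norm_green_le hω _).trans (mul_le_mul_of_nonneg_left hF hg))
  have h2 : ∀ x, |iteratedDeriv 2 (rollRem q) x| ≤ A := fun x =>
    (abs_iteratedDeriv_two_green_le hω _ x).trans (mul_le_mul_of_nonneg_left hF hg)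
  have h4 : ∀ x, |iteratedDeriv 2 (iteratedDeriv 2 (rollRem q)) x| ≤ B := by
    intro x
    rw [← iteratedDeriv_four, iteratedDeriv_four_rollRem hq, abs_div]
    obtain ⟨w1, w2⟩ := abs_le.mp hω
    set w := wavenumber q.1 q.2 ^ 2 with hw
    have e : wavenumber q.1 q.2 ^ 4 = w ^ 2 := by rw [hw]; ring
    have hw2 : 1 / 2 ≤ w ^ 2 := by nlinarith
    rw [e, abs_of_nonneg (sq_nonneg w), div_le_iff₀ (by linarith)]
    obtain ⟨p1, p2, -⟩ := mem_rollRegion.mp (rollPair_spec hq).1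
    have hO : q.2 ^ 2 ≤ 1 / 9 := by nlinarith [hq.2.1, hq.2.2]
    have b1 : |q.2 ^ 2 * (rollPair q).1 * cos x| ≤ 1 / 9 * (6 / 5) * 1 :=
      abs_mul_le_of (abs_mul_le_of (by rwa [abs_of_nonneg (sq_nonneg _)])
        (abs_le.mpr ⟨by linarith, p2⟩)) (abs_cos_le_one x)
    have b2 : |2 * w * iteratedDeriv 2 (rollRem q) x| ≤ (22 / 10) * A :=
      abs_mul_le_of (abs_le.mpr ⟨by linarith, by linarith⟩) (h2 x)
    have b3 := (abs_apply_le (rollForce q) x).trans hF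
    have b0 := h0 x
    have t1 := abs_sub (rollForce q x - q.2 ^ 2 * (rollPair q).1 * cos x - rollRem q x)
      (2 * w * iteratedDeriv 2 (rollRem q) x)
    have t2 := abs_sub (rollForce q x - q.2 ^ 2 * (rollPair q).1 * cos x) (rollRem q x)
    have t3 := abs_sub (rollForce q x) (q.2 ^ 2 * (rollPair q).1 * cos x)
    have : B * (1 / 2) ≤ B * w ^ 2 := mul_le_mul_of_nonneg_left hw2 hB0
    linarith
  have hC := contDiff_rollRem hq
  have hp := periodic_rollRem hq
  have he := even_rollRem hq
  have h1 := abs_deriv_le_of_periodic_even (hC.of_le (by norm_num)) he hp h2 x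
  have h3 := abs_deriv_le_of_periodic_even (ContDiff.iteratedDeriv_two (n := 2) hC)
    (even_iteratedDeriv_two he) (periodic_iteratedDeriv hp 2) h4 x
  rw [← iteratedDeriv_three] at h3
  have hA' : A ≤ (A + B) * (2 * π) := by nlinarith
  refine ⟨(h0 x).trans hA', h1.trans (by gcongr; linarith), (h2 x).trans hA',
    h3.trans (by gcongr; linarith)⟩

theorem continuous_wavenumber : Continuous fun q : ℝ × ℝ => wavenumber q.1 q.2 := by
  unfold wavenumber; fun_prop

/-- With contraction rate 1/2, the distance from the fixed point at q to the one at q₀ is at most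
twice the displacement of the latter under the map at q. Continuity of the map in q at a single
point therefore suffices. -/
theorem continuous_rollPair : Continuous fun q : rollSet => rollPair q := by
  rw [continuous_iff_continuousAt]
  intro q₀
  have hmap : Tendsto (fun q : rollSet => rollMap q.1.1 q.1.2 (rollPair q₀)) (𝓝 q₀)
      (𝓝 (rollMap q₀.1.1 q₀.1.2 (rollPair q₀))) := by
    have hW : Tendsto (fun q : rollSet => profileB q.1.1 (rollPair q₀)) (𝓝 q₀)
        (𝓝 (profileB q₀.1.1 (rollPair q₀))) := by
      have : Continuous fun q : rollSet => profileB q.1.1 (rollPair q₀) := by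
        unfold profileB; fun_prop
      exact this.tendsto q₀
    have h1 : Tendsto (fun q : rollSet => q.1.1) (𝓝 q₀) (𝓝 q₀.1.1) :=
      Continuous.tendsto (by fun_prop) q₀
    have h2 : Tendsto (fun q : rollSet => q.1.2) (𝓝 q₀) (𝓝 q₀.1.2) :=
      Continuous.tendsto (by fun_prop) q₀
    have hw : Tendsto (fun q : rollSet => wavenumber q.1.1 q.1.2) (𝓝 q₀)
        (𝓝 (wavenumber q₀.1.1 q₀.1.2)) :=
      (continuous_wavenumber.comp continuous_subtype_val).tendsto q₀
    refine Tendsto.prodMk_nhds ?_ ?_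
    · refine tendsto_const_nhds.add (Tendsto.div_const (Tendsto.sub ?_ ?_) 2)
      · exact (tendsto_const_nhds.sub (h2.pow 2)).mul_const _
      · exact ((cosCL 1).continuous.tendsto _).comp (hW.pow 3)
    · exact h1.smul (tendsto_green (rollSet_wavenumber q₀.2)
        (Eventually.of_forall fun q => rollSet_wavenumber q.2) hw (hW.sub (hW.pow 3)))
  rw [ContinuousAt, tendsto_iff_dist_tendsto_zero]
  have h0 := tendsto_iff_dist_tendsto_zero.mp hmap
  have h0' := h0.const_mul 2
  rw [mul_zero] at h0'
  refine squeeze_zero (fun _ => dist_nonneg) (fun q => ?_) h0'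
  obtain ⟨t1, t2, -⟩ := rollThreshold_spec q.2.1.1 q.2.1.2
  obtain ⟨s1, s2⟩ := rollPair_spec q.2
  obtain ⟨r1, r2⟩ := rollPair_spec q₀.2
  have hl := rollMap_lipschitz q.2.1.1 t1 t2 q.2.2 _ s1 _ r1
  rw [s2] at hl
  have := dist_triangle (rollPair q) (rollMap q.1.1 q.1.2 (rollPair q₀)) (rollPair q₀)
  rw [r2]
  linarith

theorem continuous_rollForce : Continuous fun q : rollSet => rollForce q := by
  have h := continuous_rollPair
  unfold rollForce profileB
  fun_prop

theorem continuous_amp : Continuous fun q : rollSet => amp q.1.1 q.1.2 := by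
  have h : (fun q : rollSet => amp q.1.1 q.1.2) = fun q : rollSet => q.1.1 * (rollPair q).1 :=
    funext fun q => (rollProfile_spec q.2).2.2
  rw [h]
  have := continuous_rollPair
  fun_prop

theorem continuous_rollRem : Continuous fun q : rollSet => rollRem q := by
  rw [continuous_iff_continuousAt]
  intro q₀
  exact tendsto_green (rollSet_wavenumber q₀.2)
    (Eventually.of_forall fun q => rollSet_wavenumber q.2)
    ((continuous_wavenumber.comp continuous_subtype_val).tendsto q₀)
    (continuous_rollForce.tendsto q₀)

theorem continuous_eval_of {f : rollSet → ℝ →ᵇ ℝ} (hf : Continuous f) :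
    Continuous fun z : rollSet × ℝ => f z.1 z.2 := by
  have : Continuous fun z : rollSet × ℝ => (f z.1, z.2) := by fun_prop
  fun_prop

/-- Joint continuity for even orders comes from the series or the equation, and for odd orders from
a parametric integral starting at 0. -/
theorem continuous_rollRem_derivs :
    (Continuous fun z : rollSet × ℝ => rollRem z.1 z.2) ∧
    (Continuous fun z : rollSet × ℝ => deriv (rollRem z.1) z.2) ∧
    (Continuous fun z : rollSet × ℝ => iteratedDeriv 2 (rollRem z.1) z.2) ∧
    (Continuous fun z : rollSet × ℝ => iteratedDeriv 3 (rollRem z.1) z.2) := by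
  have h0 := continuous_eval_of continuous_rollRem
  have hF := continuous_eval_of continuous_rollForce
  have h2 : Continuous fun z : rollSet × ℝ => iteratedDeriv 2 (rollRem z.1) z.2 := by
    rw [continuous_iff_continuousAt]
    intro z₀
    exact tendsto_iteratedDeriv_two_green (rollSet_wavenumber z₀.1.2)
      (Eventually.of_forall fun z : rollSet × ℝ => rollSet_wavenumber z.1.2)
      (((continuous_wavenumber.comp continuous_subtype_val).comp continuous_fst).tendsto z₀)
      ((continuous_rollForce.comp continuous_fst).tendsto z₀) (continuous_snd.tendsto z₀)
  have h4 : Continuous fun z : rollSet × ℝ => iteratedDeriv 4 (rollRem z.1) z.2 := by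
    have e : (fun z : rollSet × ℝ => iteratedDeriv 4 (rollRem z.1) z.2) = fun z : rollSet × ℝ =>
        (rollForce z.1 z.2 - z.1.1.2 ^ 2 * (rollPair z.1).1 * cos z.2 - rollRem z.1 z.2
        - 2 * wavenumber z.1.1.1 z.1.1.2 ^ 2 * iteratedDeriv 2 (rollRem z.1) z.2)
          / wavenumber z.1.1.1 z.1.1.2 ^ 4 := funext fun z => iteratedDeriv_four_rollRem z.1.2 z.2
    rw [e]
    have hw : Continuous fun z : rollSet × ℝ => wavenumber z.1.1.1 z.1.1.2 :=
      (continuous_wavenumber.comp continuous_subtype_val).comp continuous_fst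
    have hp : Continuous fun z : rollSet × ℝ => rollPair z.1 :=
      continuous_rollPair.comp continuous_fst
    refine Continuous.div (by fun_prop) (by fun_prop) fun z => ?_
    have := (abs_le.mp (rollSet_wavenumber z.1.2)).1
    have h2 : wavenumber z.1.1.1 z.1.1.2 ^ 2 ≠ 0 := by linarith
    exact pow_ne_zero 4 fun h => h2 (by rw [h]; norm_num)
  have key : ∀ f : rollSet → ℝ → ℝ, (∀ q, ContDiff ℝ 2 (f q)) → (∀ q x, f q (-x) = f q x) →
      (Continuous fun z : rollSet × ℝ => iteratedDeriv 2 (f z.1) z.2) →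
      Continuous fun z : rollSet × ℝ => deriv (f z.1) z.2 := by
    intro f hf he hc
    have e : (fun z : rollSet × ℝ => deriv (f z.1) z.2)
        = fun z : rollSet × ℝ => ∫ t in (0 : ℝ)..z.2, iteratedDeriv 2 (f z.1) t :=
      funext fun z => deriv_eq_integral (hf z.1) (he z.1) z.2
    rw [e]
    exact intervalIntegral.continuous_parametric_intervalIntegral_of_continuous
      (f := fun (z : rollSet × ℝ) t => iteratedDeriv 2 (f z.1) t)
      (hc.comp (by fun_prop : Continuous fun y : (rollSet × ℝ) × ℝ => (y.1.1, y.2))) continuous_snd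
  refine ⟨h0, key (fun q => rollRem q) (fun q => (contDiff_rollRem q.2).of_le (by norm_num))
    (fun q => even_rollRem q.2) h2, h2, ?_⟩
  simp only [iteratedDeriv_three]
  refine key (fun q => iteratedDeriv 2 (rollRem q))
    (fun q => ContDiff.iteratedDeriv_two (n := 2) (contDiff_rollRem q.2))
    (fun q => even_iteratedDeriv_two (even_rollRem q.2)) ?_
  simp only [← iteratedDeriv_four]
  exact h4

end

noncomputable section

open scoped SchwartzMap _root_.ContDiff ComplexConjugate

/-! ### The `L²` Fourier transform as an integral -/

/-- A real test function, as a complex Schwartz function. -/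
def testSchwartz {g : ℝ → ℝ} (hg : ContDiff ℝ ∞ g) (hc : HasCompactSupport g) : 𝓢(ℝ, ℂ) :=
  (hc.comp_left (g := Complex.ofRealCLM) rfl : HasCompactSupport (Complex.ofRealCLM ∘ g)).toSchwartzMap
    (by fun_prop : ContDiff ℝ ∞ (Complex.ofRealCLM ∘ g))

theorem testSchwartz_apply {g : ℝ → ℝ} (hg : ContDiff ℝ ∞ g) (hc : HasCompactSupport g) (x : ℝ) :
    testSchwartz hg hc x = (g x : ℂ) := by
  simp [testSchwartz]

/-- The L² transform agrees with the distributional one, which moves it to the test function. The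
identities below are proved by testing against smooth compactly supported functions. -/
theorem integral_smul_fourier (f : L2) (G : 𝓢(ℝ, ℂ)) :
    ∫ x, G x • (𝓕 f : L2) x = ∫ x, (𝓕 (G : ℝ → ℂ)) x • f x := by
  have h := Lp.fourier_toTemperedDistribution_eq f
  have h2 := congrArg (fun T : 𝓢'(ℝ, ℂ) => T G) h
  simp only [TemperedDistribution.fourier_apply, Lp.toTemperedDistribution_apply] at h2
  rw [← h2, SchwartzMap.fourier_coe]

theorem integral_smul_fourierInv (f : L2) (G : 𝓢(ℝ, ℂ)) :
    ∫ x, G x • (𝓕⁻ f : L2) x = ∫ x, (𝓕⁻ (G : ℝ → ℂ)) x • f x := by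
  have h := Lp.fourierInv_toTemperedDistribution_eq f
  have h2 := congrArg (fun T : 𝓢'(ℝ, ℂ) => T G) h
  simp only [TemperedDistribution.fourierInv_apply, Lp.toTemperedDistribution_apply] at h2
  rw [← h2, SchwartzMap.fourierInv_coe]

theorem locallyIntegrable_L2 (f : L2) : LocallyIntegrable f volume :=
  (Lp.memLp f).locallyIntegrable (by norm_num)

/-- Both transforms satisfy the same duality with test functions, one by the distributional
definition and the other by Fubini. -/
theorem fourier_ae_eq_integral (f : L2) (hf : Integrable f) :
    (𝓕 f : L2) =ᵐ[volume] 𝓕 (f : ℝ → ℂ) := by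
  have hc : Continuous (𝓕 (f : ℝ → ℂ)) :=
    VectorFourier.fourierIntegral_continuous Real.continuous_fourierChar
      (L := innerₗ ℝ) continuous_inner hf
  refine ae_eq_of_integral_contDiff_smul_eq (locallyIntegrable_L2 _) hc.locallyIntegrable
    fun g hg hgc => ?_
  have h1 := integral_smul_fourier f (testSchwartz hg hgc)
  have h2 := VectorFourier.integral_fourierIntegral_smul_eq_flip (L := innerₗ ℝ) (μ := volume)
    (ν := volume) Real.continuous_fourierChar continuous_inner (testSchwartz hg hgc).integrable hf
  simp only [testSchwartz_apply] at h1
  have e1 : ∀ z : ℝ → ℂ, ∫ x, g x • z x = ∫ x, ((g x : ℝ) : ℂ) • z x := fun z => by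
    simp
  rw [e1, e1, h1]
  refine h2.trans ?_
  simp only [testSchwartz_apply]
  rw [flip_innerₗ]
  rfl

theorem fourierInv_ae_eq (f : L2) : (𝓕⁻ f : L2) =ᵐ[volume] fun x => (𝓕 f : L2) (-x) := by
  have hneg : LocallyIntegrable (fun x => (𝓕 f : L2) (-x)) volume := by
    have : MemLp (fun x => (𝓕 f : L2) (-x)) 2 volume :=
      (Lp.memLp (𝓕 f : L2)).comp_measurePreserving (Measure.measurePreserving_neg volume)
    exact this.locallyIntegrable (by norm_num)
  refine ae_eq_of_integral_contDiff_smul_eq (locallyIntegrable_L2 _) hneg fun g hg hgc => ?_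
  have hg' : ContDiff ℝ ∞ fun x => g (-x) := by fun_prop
  have hgc' : HasCompactSupport fun x => g (-x) :=
    hgc.comp_homeomorph (Homeomorph.neg ℝ)
  have h1 := integral_smul_fourierInv f (testSchwartz hg hgc)
  have h2 := integral_smul_fourier f (testSchwartz hg' hgc')
  have e1 : ∀ (g : ℝ → ℝ) (z : ℝ → ℂ), ∫ x, g x • z x = ∫ x, ((g x : ℝ) : ℂ) • z x := fun g z => by
    simp
  have e2 : (testSchwartz hg' hgc' : ℝ → ℂ) = fun x => testSchwartz hg hgc (-x) := by
    ext x; simp [testSchwartz_apply]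
  rw [e2, ← fourierInv_eq_fourier_comp_neg, ← h1] at h2
  simp only [testSchwartz_apply] at h2
  rw [e1, ← h2, e1, ← integral_neg_eq_self]
  simp

theorem fourier_star (f : L2) :
    (𝓕 (star f) : L2) =ᵐ[volume] fun x => conj ((𝓕 f : L2) (-x)) := by
  have hinv := fourierInv_ae_eq f
  suffices h : (𝓕 (star f) : L2) =ᵐ[volume] fun x => conj ((𝓕⁻ f : L2) x) by
    filter_upwards [h, hinv] with x h1 h2
    rw [h1, h2]
  have hs : (star (𝓕⁻ f : L2) : L2) =ᵐ[volume] fun x => conj ((𝓕⁻ f : L2) x) := Lp.coeFn_star _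
  refine EventuallyEq.trans ?_ hs
  refine ae_eq_of_integral_contDiff_smul_eq (locallyIntegrable_L2 _) (locallyIntegrable_L2 _)
    fun g hg hgc => ?_
  have h1 := integral_smul_fourierInv f (testSchwartz hg hgc)
  have h2 := integral_smul_fourier (star f) (testSchwartz hg hgc)
  have e1 : ∀ (g : ℝ → ℝ) (z : ℝ → ℂ), ∫ x, g x • z x = ∫ x, ((g x : ℝ) : ℂ) • z x := fun g z => by
    simp
  simp only [testSchwartz_apply] at h1 h2
  rw [e1, e1, h2]
  have h3 := congrArg conj h1
  rw [← integral_conj, ← integral_conj] at h3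
  have h4 : ∫ x, ((g x : ℝ) : ℂ) • (star (𝓕⁻ f : L2) : L2) x
      = ∫ x, conj (((g x : ℝ) : ℂ) • (𝓕⁻ f : L2) x) := by
    refine integral_congr_ae ?_
    filter_upwards [hs] with x hx
    rw [hx]; simp
  rw [h4, h3]
  refine integral_congr_ae ?_
  filter_upwards [Lp.coeFn_star f] with x hx
  -- For a real test function, conjugation exchanges the transform and its inverse.
  have hF : 𝓕 (testSchwartz hg hgc : ℝ → ℂ) x = conj (𝓕⁻ (testSchwartz hg hgc : ℝ → ℂ) x) := by
    rw [Real.fourier_eq', Real.fourierInv_eq', ← integral_conj]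
    refine integral_congr_ae (Eventually.of_forall fun y => ?_)
    simp only [testSchwartz_apply, smul_eq_mul, map_mul, Complex.conj_ofReal, ← Complex.exp_conj,
      Complex.conj_I]
    congr 2
    push_cast; ring
  rw [hx, hF]
  simp

theorem fourierInv_ae_eq_integral (f : L2) (hf : Integrable f) :
    (𝓕⁻ f : L2) =ᵐ[volume] 𝓕⁻ (f : ℝ → ℂ) := by
  have h1 := fourierInv_ae_eq f
  have h2 := (Measure.measurePreserving_neg (volume : Measure ℝ)).quasiMeasurePreserving.ae_eq_comp
    (fourier_ae_eq_integral f hf)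
  filter_upwards [h1, h2] with x a b
  rw [a, fourierInv_eq_fourier_neg]
  exact b

theorem hat_eq_integral (f : L2) (hf : Integrable f) :
    ∀ᵐ κ : ℝ, hat f κ = ∫ x, f x * Complex.exp (-(κ * x : ℝ) * Complex.I) := by
  filter_upwards [quasi_scale.ae_eq_comp (fourier_ae_eq_integral f hf)] with κ hκ
  have h : hat f κ = 𝓕 (f : ℝ → ℂ) (κ / (2 * π)) := hκ
  rw [h, Real.fourier_eq']
  refine integral_congr_ae (Eventually.of_forall fun x => ?_)
  simp only [smul_eq_mul]
  rw [mul_comm]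
  congr 2
  have : -2 * π * inner ℝ x (κ / (2 * π)) = -(κ * x) := by
    simp; field_simp
  rw [this]; push_cast; ring

theorem hat_star (f : L2) : ∀ᵐ κ : ℝ, hat (star f) κ = conj (hat f (-κ)) := by
  filter_upwards [quasi_scale.ae_eq_comp (fourier_star f)] with κ hκ
  have h : hat (star f) κ = conj ((𝓕 f : L2) (-(κ / (2 * π)))) := hκ
  rw [h, hat, neg_div]

end

noncomputable section

open scoped ComplexConjugate

/-! ### Norms on `L²` and `H⁴` -/

theorem L2_norm_sq (F : L2) : ‖F‖ ^ 2 = ∫ x, ‖F x‖ ^ 2 := by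
  have h := MeasureTheory.L2.inner_def (𝕜 := ℂ) F F
  have h1 : (inner ℂ F F : ℂ) = ((‖F‖ ^ 2 : ℝ) : ℂ) := by
    rw [inner_self_eq_norm_sq_to_K]; norm_cast
  have h2 : ∫ x, inner ℂ (F x) (F x) = ((∫ x, ‖F x‖ ^ 2 : ℝ) : ℂ) := by
    refine Eq.trans ?_ (integral_ofReal (𝕜 := ℂ))
    refine integral_congr_ae (Eventually.of_forall fun x => ?_)
    simp only [inner_self_eq_norm_sq_to_K]; norm_cast
  rw [h1, h2] at h
  exact_mod_cast h

theorem norm_toLp_sq {f : ℝ → ℂ} (h : MemLp f 2 volume) : ‖h.toLp f‖ ^ 2 = ∫ x, ‖f x‖ ^ 2 := by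
  rw [L2_norm_sq]
  refine integral_congr_ae ?_
  filter_upwards [h.coeFn_toLp] with x hx
  rw [hx]

theorem integrable_norm_sq {f : ℝ → ℂ} (h : MemLp f 2 volume) : Integrable fun x => ‖f x‖ ^ 2 :=
  (memLp_two_iff_integrable_sq_norm h.1).mp h

theorem norm_toLp_le {f : ℝ → ℂ} (h : MemLp f 2 volume) {C : ℝ} (hC : 0 ≤ C)
    (hf : ∫ x, ‖f x‖ ^ 2 ≤ C ^ 2) : ‖h.toLp f‖ ≤ C := by
  rw [← norm_toLp_sq h] at hf
  exact (sq_le_sq₀ (norm_nonneg _) hC).mp hf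

theorem norm_toLp_le_mul {f : ℝ → ℂ} (h : MemLp f 2 volume) {g : L2} {C : ℝ} (hC : 0 ≤ C)
    (hf : ∀ᵐ x, ‖f x‖ ≤ C * ‖g x‖) : ‖h.toLp f‖ ≤ C * ‖g‖ := by
  refine norm_toLp_le h (by positivity) ?_
  rw [mul_pow, L2_norm_sq, ← integral_const_mul]
  refine integral_mono_ae (integrable_norm_sq h) ((integrable_norm_sq (Lp.memLp g)).const_mul _) ?_
  filter_upwards [hf] with x hx
  rw [← mul_pow]
  exact pow_le_pow_left₀ (norm_nonneg _) hx 2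

theorem memLp_of_le_mul {f : ℝ → ℂ} (hf : AEStronglyMeasurable f volume) {g : ℝ → ℂ}
    (hg : MemLp g 2 volume) {C : ℝ} (h : ∀ᵐ x, ‖f x‖ ≤ C * ‖g x‖) : MemLp f 2 volume :=
  hg.of_le_mul hf h

theorem memLp_comp_mul {f : ℝ → ℂ} (hf : MemLp f 2 volume) {c : ℝ} (hc : c ≠ 0) :
    MemLp (fun x => f (x * c)) 2 volume := by
  refine MemLp.comp_of_map (f := fun x : ℝ => x * c) (g := f) ?_ (by fun_prop)
  rw [Real.map_volume_mul_right hc]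
  exact hf.smul_measure ENNReal.ofReal_ne_top

theorem memLp_hat (f : L2) : MemLp (hat f) 2 volume := by
  have h := memLp_comp_mul (Lp.memLp (𝓕 f : L2)) (c := (2 * π)⁻¹) (by positivity)
  exact h

theorem integral_hat_sq (f : L2) : ∫ κ, ‖hat f κ‖ ^ 2 = 2 * π * ‖f‖ ^ 2 := by
  rw [← Lp.norm_fourier_eq f, L2_norm_sq]
  have h := Measure.integral_comp_div (fun x => ‖(𝓕 f : L2) x‖ ^ 2) (2 * π)
  rw [abs_of_pos (by positivity)] at h
  exact h

theorem hat_sub (f g : L2) : hat (f - g) =ᵐ[volume] fun κ => hat f κ - hat g κ := by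
  have h1 := hat_add f ((-1 : ℂ) • g)
  have h2 := hat_smul (-1) g
  have e : f - g = f + (-1 : ℂ) • g := by rw [neg_one_smul, sub_eq_add_neg]
  rw [e]
  filter_upwards [h1, h2] with κ a b
  rw [a, b]; ring

namespace H4

theorem toL2_add (v w : H4) : (v + w).toL2 = v.toL2 + w.toL2 := rfl

theorem toL2_sub (v w : H4) : (v - w).toL2 = v.toL2 - w.toL2 := rfl

theorem norm_eq_weightMap (v : H4) : ‖v‖ = ‖weightMap v‖ := rfl

theorem weightMap_coe (v : H4) : (weightMap v : ℝ → ℂ) =ᵐ[volume] weighted v.toL2 :=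
  v.mem.coeFn_toLp

theorem norm_sq (v : H4) : ‖v‖ ^ 2 = ∫ κ, ‖weighted v.toL2 κ‖ ^ 2 := norm_toLp_sq v.mem

theorem norm_weighted (f : L2) (κ : ℝ) : ‖weighted f κ‖ = (1 + κ ^ 2) ^ 2 * ‖hat f κ‖ := by
  rw [weighted, norm_mul, Complex.norm_real, Real.norm_of_nonneg (by positivity)]

theorem norm_toL2_le (v : H4) : ‖v.toL2‖ ≤ ‖v‖ := by
  have h1 := integral_hat_sq v.toL2
  have h2 : ∫ κ, ‖hat v.toL2 κ‖ ^ 2 ≤ ‖v‖ ^ 2 := by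
    rw [norm_sq]
    refine integral_mono (integrable_norm_sq (memLp_hat _)) (integrable_norm_sq v.mem) fun κ => ?_
    refine pow_le_pow_left₀ (norm_nonneg _) ?_ 2
    rw [norm_weighted]
    have : 1 ≤ (1 + κ ^ 2) ^ 2 := one_le_pow₀ (by linarith [sq_nonneg κ])
    exact le_mul_of_one_le_left (norm_nonneg _) this
  have h3 : 1 ≤ 2 * π := by linarith [pi_gt_three]
  refine (sq_le_sq₀ (norm_nonneg _) (norm_nonneg _)).mp ?_
  nlinarith [sq_nonneg ‖v.toL2‖]

/-- A pointwise Cauchy–Schwarz inequality: with p = 1 + κ² and t = |v̂(κ)|, t ≤ N/(2p) + p t²/(2N),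
and p ≤ p⁴ turns the last term into the H⁴ density. Integration gives Nπ/2 + N/2. -/
theorem hat_integrable_and_le (v : H4) {N : ℝ} (hN : 0 < N) (hv : ‖v‖ ≤ N) :
    Integrable (hat v.toL2) ∧ ∫ κ, ‖hat v.toL2 κ‖ ≤ N * (π + 1) / 2 := by
  have hb : ∀ κ, ‖hat v.toL2 κ‖
      ≤ N / 2 * (1 + κ ^ 2)⁻¹ + 1 / (2 * N) * ‖weighted v.toL2 κ‖ ^ 2 := by
    intro κ
    rw [norm_weighted]
    set t := ‖hat v.toL2 κ‖
    have hp : 1 ≤ 1 + κ ^ 2 := by linarith [sq_nonneg κ]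
    set p := 1 + κ ^ 2
    have ht : 0 ≤ t := norm_nonneg _
    have e : N / 2 * p⁻¹ + 1 / (2 * N) * (p ^ 2 * t) ^ 2 - t
        = ((N - p * t) ^ 2 + (p ^ 5 - p ^ 2) * t ^ 2) / (2 * N * p) := by
      field_simp; ring
    have h5 : p ^ 2 ≤ p ^ 5 := pow_le_pow_right₀ hp (by norm_num)
    have h6 : 0 ≤ (p ^ 5 - p ^ 2) * t ^ 2 := mul_nonneg (by linarith) (sq_nonneg t)
    have : 0 ≤ ((N - p * t) ^ 2 + (p ^ 5 - p ^ 2) * t ^ 2) / (2 * N * p) := by positivity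
    linarith
  have hi : Integrable fun κ : ℝ =>
      N / 2 * (1 + κ ^ 2)⁻¹ + 1 / (2 * N) * ‖weighted v.toL2 κ‖ ^ 2 :=
    (integrable_inv_one_add_sq.const_mul _).add ((integrable_norm_sq v.mem).const_mul _)
  have hI : Integrable (hat v.toL2) := hi.mono' (memLp_hat _).1 (Eventually.of_forall hb)
  refine ⟨hI, ?_⟩
  refine (integral_mono hI.norm hi hb).trans ?_
  rw [integral_add (integrable_inv_one_add_sq.const_mul _) ((integrable_norm_sq v.mem).const_mul _),
    integral_const_mul, integral_const_mul, integral_univ_inv_one_add_sq, ← norm_sq]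
  have : 1 / (2 * N) * ‖v‖ ^ 2 ≤ 1 / (2 * N) * N ^ 2 := by gcongr
  have e : 1 / (2 * N) * N ^ 2 = N / 2 := by field_simp
  linarith

/-- The Sobolev embedding. -/
theorem norm_apply_le (v : H4) : ∀ᵐ x, ‖v.toL2 x‖ ≤ ‖v‖ := by
  rcases eq_or_ne v 0 with rfl | hv
  · filter_upwards [Lp.coeFn_zero ℂ 2 (volume : Measure ℝ)] with x hx
    have : (0 : H4).toL2 x = 0 := hx
    simp [this]
  have hN : 0 < ‖v‖ := norm_pos_iff.mpr hv
  obtain ⟨hI, hle⟩ := v.hat_integrable_and_le hN le_rfl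
  have hIF : Integrable (𝓕 v.toL2 : L2) := by
    have h := hI.comp_mul_right' (R := 2 * π) (by positivity)
    refine h.congr (Eventually.of_forall fun x => ?_)
    simp only [hat]; congr 1; field_simp
  have hF := fourierInv_ae_eq_integral (𝓕 v.toL2) hIF
  rw [FourierTransform.fourierInv_fourier_eq] at hF
  filter_upwards [hF] with x hx
  rw [hx, Real.fourierInv_eq']
  refine (norm_integral_le_integral_norm _).trans ?_
  have e1 : ∀ y : ℝ, ‖Complex.exp ((2 * π * inner ℝ y x : ℝ) * Complex.I) • (𝓕 v.toL2 : L2) y‖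
      = ‖(𝓕 v.toL2 : L2) y‖ := fun y => by
    rw [norm_smul, Complex.norm_exp_ofReal_mul_I, one_mul]
  simp_rw [e1]
  have e2 : ∫ κ, ‖hat v.toL2 κ‖ = 2 * π * ∫ y, ‖(𝓕 v.toL2 : L2) y‖ := by
    have h := Measure.integral_comp_div (fun x => ‖(𝓕 v.toL2 : L2) x‖) (2 * π)
    rw [abs_of_pos (by positivity)] at h
    exact h
  rw [e2] at hle
  -- The embedding constant obtained is (π + 1)/(4π), which is below 1.
  have hpi := pi_gt_three
  have hp0 : 0 ≤ ∫ y, ‖(𝓕 v.toL2 : L2) y‖ := integral_nonneg fun _ => norm_nonneg _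
  nlinarith

/-- The inverse weight is at most 1, so dividing by it stays in L². Thus `weightMap` is an isometric
bijection onto L², the source of completeness of H⁴. -/
theorem exists_mk (g : L2) : ∃ v : H4, weightMap v = g := by
  have hm : MemLp (fun κ : ℝ => (((1 + κ ^ 2) ^ 2 : ℝ) : ℂ)⁻¹ * g κ) 2 volume := by
    refine (Lp.memLp g).of_le_mul (c := 1) ?_ (Eventually.of_forall fun κ => ?_)
    · exact (Measurable.aestronglyMeasurable (by fun_prop)).mul (Lp.memLp g).1
    · rw [norm_mul, norm_inv, Complex.norm_real, Real.norm_of_nonneg (by positivity)]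
      have : 1 ≤ (1 + κ ^ 2) ^ 2 := one_le_pow₀ (by linarith [sq_nonneg κ])
      exact mul_le_mul_of_nonneg_right (inv_le_one_of_one_le₀ this) (norm_nonneg _)
  have hm2 := memLp_comp_mul hm (c := 2 * π) (by positivity)
  set F : L2 := hm2.toLp _ with hF
  have hhat : hat (𝓕⁻ F) =ᵐ[volume] fun κ : ℝ => (((1 + κ ^ 2) ^ 2 : ℝ) : ℂ)⁻¹ * g κ := by
    have h := quasi_scale.ae_eq_comp hm2.coeFn_toLp
    filter_upwards [h] with κ hκ
    rw [hat, FourierTransform.fourier_fourierInv_eq]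
    refine hκ.trans ?_
    simp only [Function.comp]
    have : κ / (2 * π) * (2 * π) = κ := by field_simp
    rw [this]
  have hw : weighted (𝓕⁻ F) =ᵐ[volume] g := by
    filter_upwards [hhat] with κ hκ
    have hne : (((1 + κ ^ 2) ^ 2 : ℝ) : ℂ) ≠ 0 := by
      exact_mod_cast (by positivity : ((1 + κ ^ 2) ^ 2 : ℝ) ≠ 0)
    rw [weighted, hκ, mul_inv_cancel_left₀ hne]
  have hmem : (𝓕⁻ F : L2) ∈ sobolev4 := (memLp_congr_ae hw).mpr (Lp.memLp g)
  refine ⟨(⟨𝓕⁻ F, hmem⟩ : sobolev4), Lp.ext ?_⟩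
  exact (weightMap_coe _).trans hw

/-- The element of `H⁴` with given weighted Fourier transform. -/
def mk (g : L2) : H4 := (exists_mk g).choose

theorem weightMap_mk (g : L2) : weightMap (mk g) = g := (exists_mk g).choose_spec

theorem dist_eq_weightMap (v w : H4) : dist v w = dist (weightMap v) (weightMap w) := rfl

theorem dist_mk (g h : L2) : dist (mk g) (mk h) = dist g h := by
  rw [dist_eq_weightMap, weightMap_mk, weightMap_mk]

theorem norm_mk (g : L2) : ‖mk g‖ = ‖g‖ := by
  rw [norm_eq_weightMap, weightMap_mk]

instance : CompleteSpace H4 := by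
  refine Metric.complete_of_cauchySeq_tendsto fun u hu => ?_
  have hu' : CauchySeq fun n => weightMap (u n) := by
    rw [Metric.cauchySeq_iff] at hu ⊢
    exact hu
  obtain ⟨g, hg⟩ := cauchySeq_tendsto_of_complete hu'
  refine ⟨mk g, ?_⟩
  rw [tendsto_iff_dist_tendsto_zero] at hg ⊢
  simpa [dist_eq_weightMap, weightMap_mk] using hg

theorem ext_weighted {v w : H4} (h : weighted v.toL2 =ᵐ[volume] weighted w.toL2) : v = w :=
  weightMap_injective (Lp.ext ((weightMap_coe v).trans (h.trans (weightMap_coe w).symm)))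

/-- Conjugation reflects and conjugates the transform; the Sobolev weight is even, so the norm is
unchanged. -/
theorem exists_conj (v : H4) : ∃ w : H4, w.toL2 = star v.toL2 ∧ ‖w‖ = ‖v‖ ∧
    ∀ᵐ κ : ℝ, weighted w.toL2 κ = conj (weighted v.toL2 (-κ)) := by
  have hw : weighted (star v.toL2) =ᵐ[volume] fun κ => conj (weighted v.toL2 (-κ)) := by
    filter_upwards [hat_star v.toL2] with κ hκ
    simp only [weighted, hκ, map_mul, Complex.conj_ofReal, neg_sq]
  have hneg : MemLp (fun κ => weighted v.toL2 (-κ)) 2 volume :=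
    v.mem.comp_measurePreserving (Measure.measurePreserving_neg volume)
  have hmem : star v.toL2 ∈ sobolev4 := (memLp_congr_ae hw).mpr hneg.star
  refine ⟨(⟨_, hmem⟩ : sobolev4), rfl, ?_, hw⟩
  have h : ‖(show H4 from (⟨_, hmem⟩ : sobolev4))‖ ^ 2 = ‖v‖ ^ 2 := by
    rw [norm_sq, norm_sq]
    have e : ∫ κ, ‖weighted v.toL2 κ‖ ^ 2 = ∫ κ, ‖weighted v.toL2 (-κ)‖ ^ 2 :=
      (integral_neg_eq_self (fun κ => ‖weighted v.toL2 κ‖ ^ 2) volume).symm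
    rw [e]
    refine integral_congr_ae ?_
    filter_upwards [hw] with κ hκ
    have : weighted (H4.toL2 (⟨star v.toL2, hmem⟩ : sobolev4)) κ = conj (weighted v.toL2 (-κ)) := hκ
    rw [this, RCLike.norm_conj]
  exact (sq_eq_sq₀ (norm_nonneg _) (norm_nonneg _)).mp h

end H4

/-! ### Fourier multipliers from `L²` to `H⁴` -/

theorem memLp_mul_hat {a : ℝ → ℝ} (ha : Measurable a) {A : ℝ} (hA : ∀ κ, |a κ| ≤ A) (F : L2) :
    MemLp (fun κ => (a κ : ℂ) * hat F κ) 2 volume := by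
  refine (memLp_hat F).of_le_mul (c := A) ?_ (Eventually.of_forall fun κ => ?_)
  · exact (Measurable.aestronglyMeasurable (by fun_prop)).mul (memLp_hat F).1
  · rw [norm_mul, Complex.norm_real]
    exact mul_le_mul_of_nonneg_right (hA κ) (norm_nonneg _)

open Classical in
/-- The element `v` of `H⁴` with `(1 + κ²)² v̂ = a F̂`. -/
def multH4 (a : ℝ → ℝ) (F : L2) : H4 :=
  if h : MemLp (fun κ => (a κ : ℂ) * hat F κ) 2 volume then H4.mk (h.toLp _) else 0

section Mult

variable {a : ℝ → ℝ} (ha : Measurable a) {A : ℝ} (hA : ∀ κ, |a κ| ≤ A)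
include ha hA

theorem multH4_eq (F : L2) : multH4 a F = H4.mk ((memLp_mul_hat ha hA F).toLp _) := by
  rw [multH4, dif_pos]

theorem weighted_multH4 (F : L2) :
    weighted (multH4 a F).toL2 =ᵐ[volume] fun κ => (a κ : ℂ) * hat F κ := by
  rw [multH4_eq ha hA]
  refine (H4.weightMap_coe _).symm.trans ?_
  rw [H4.weightMap_mk]
  exact MemLp.coeFn_toLp _

theorem multH4_sub (F G : L2) : multH4 a F - multH4 a G = multH4 a (F - G) := by
  refine H4.ext_weighted ?_
  have h1 := weighted_multH4 ha hA F
  have h2 := weighted_multH4 ha hA G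
  have h3 := weighted_multH4 ha hA (F - G)
  filter_upwards [h1, h2, h3, hat_sub F G, hat_sub (multH4 a F).toL2 (multH4 a G).toL2]
    with κ a1 a2 a3 a4 a5
  rw [a3, a4, mul_sub, ← a1, ← a2, H4.toL2_sub]
  simp only [weighted, a5]; ring

theorem norm_multH4_sq (F : L2) : ‖multH4 a F‖ ^ 2 = ∫ κ, ‖(a κ : ℂ) * hat F κ‖ ^ 2 := by
  rw [multH4_eq ha hA, H4.norm_mk, norm_toLp_sq]

/-- The constant 3 absorbs √(2π) from Plancherel in the angular frequency κ. -/
theorem norm_multH4_le (F : L2) : ‖multH4 a F‖ ≤ 3 * A * ‖F‖ := by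
  have hA0 : 0 ≤ A := (abs_nonneg _).trans (hA 0)
  refine (sq_le_sq₀ (norm_nonneg _) (by positivity)).mp ?_
  rw [norm_multH4_sq ha hA]
  have h : ∫ κ, ‖(a κ : ℂ) * hat F κ‖ ^ 2 ≤ ∫ κ, A ^ 2 * ‖hat F κ‖ ^ 2 := by
    refine integral_mono (integrable_norm_sq (memLp_mul_hat ha hA F))
      ((integrable_norm_sq (memLp_hat F)).const_mul _) fun κ => ?_
    simp only
    rw [norm_mul, mul_pow, Complex.norm_real]
    exact mul_le_mul_of_nonneg_right (pow_le_pow_left₀ (abs_nonneg _) (hA κ) 2) (sq_nonneg _)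
  rw [integral_const_mul, integral_hat_sq] at h
  have := pi_lt_d2
  have h2 : 0 ≤ A ^ 2 * ‖F‖ ^ 2 := by positivity
  nlinarith

/-- Multipliers on functions whose Fourier transform concentrates at a frequency `k`, near which
the multiplier is better bounded. -/
theorem norm_multH4_sq_le_of_mode (F : L2) {k η V A₁ : ℝ} (hη : 0 < η)
    (hA₁ : ∀ κ, |κ - k| < η → |a κ| ≤ A₁) (hV : ∀ᵐ κ : ℝ, |κ - k| * ‖hat F κ‖ ≤ V) :
    ‖multH4 a F‖ ^ 2 ≤ 7 * A₁ ^ 2 * ‖F‖ ^ 2 + 7 * A ^ 2 * V ^ 2 / η := by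
  have hA0 : 0 ≤ A := (abs_nonneg _).trans (hA 0)
  have hA10 : 0 ≤ A₁ := (abs_nonneg _).trans (hA₁ k (by simpa using hη))
  rw [norm_multH4_sq ha hA]
  -- At distance s ≥ η from k one has V²/s² ≤ 2V²/(η² + s²). This Lorentzian is defined on the whole
  -- line and has integral 2πV²/η, which together with 2π < 7 explains the constants.
  have hint : Integrable fun κ : ℝ => (1 + ((κ - k) / η) ^ 2)⁻¹ :=
    (integrable_inv_one_add_sq.comp_div hη.ne').comp_sub_right k
  have hval : ∫ κ : ℝ, (1 + ((κ - k) / η) ^ 2)⁻¹ = η * π := by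
    have h1 := integral_sub_right_eq_self (μ := volume) (fun κ : ℝ => (1 + (κ / η) ^ 2)⁻¹) k
    have h2 := Measure.integral_comp_div (fun κ : ℝ => (1 + κ ^ 2)⁻¹) η
    rw [h1, h2, integral_univ_inv_one_add_sq, abs_of_pos hη, smul_eq_mul]
  have h : ∫ κ, ‖(a κ : ℂ) * hat F κ‖ ^ 2 ≤ ∫ κ, (A₁ ^ 2 * ‖hat F κ‖ ^ 2
      + 2 * A ^ 2 * V ^ 2 / η ^ 2 * (1 + ((κ - k) / η) ^ 2)⁻¹) := by
    refine integral_mono_ae (integrable_norm_sq (memLp_mul_hat ha hA F))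
      (((integrable_norm_sq (memLp_hat F)).const_mul _).add (hint.const_mul _)) ?_
    filter_upwards [hV] with κ hκ
    rw [norm_mul, mul_pow, Complex.norm_real, Real.norm_eq_abs]
    rcases lt_or_ge |κ - k| η with hlt | hge
    · have h1 : |a κ| ^ 2 ≤ A₁ ^ 2 := pow_le_pow_left₀ (abs_nonneg _) (hA₁ κ hlt) 2
      have h2 : 0 ≤ 2 * A ^ 2 * V ^ 2 / η ^ 2 * (1 + ((κ - k) / η) ^ 2)⁻¹ := by positivity
      have := mul_le_mul_of_nonneg_right h1 (sq_nonneg ‖hat F κ‖)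
      linarith
    · have h1 : |a κ| ^ 2 ≤ A ^ 2 := pow_le_pow_left₀ (abs_nonneg _) (hA κ) 2
      set s := |κ - k| with hs
      have hs0 : 0 < s := hη.trans_le hge
      have h2 : (s * ‖hat F κ‖) ^ 2 ≤ V ^ 2 := pow_le_pow_left₀ (by positivity) hκ 2
      have h3 : ((κ - k) / η) ^ 2 = s ^ 2 / η ^ 2 := by rw [div_pow, hs, sq_abs]
      have h4 : ‖hat F κ‖ ^ 2 ≤ 2 * V ^ 2 / η ^ 2 * (1 + ((κ - k) / η) ^ 2)⁻¹ := by
        rw [h3]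
        have e : 2 * V ^ 2 / η ^ 2 * (1 + s ^ 2 / η ^ 2)⁻¹ = 2 * V ^ 2 / (η ^ 2 + s ^ 2) := by
          field_simp
        rw [e, le_div_iff₀ (by positivity)]
        have h5 : η ^ 2 ≤ s ^ 2 := pow_le_pow_left₀ hη.le hge 2
        have h6 := mul_le_mul_of_nonneg_left h5 (sq_nonneg ‖hat F κ‖)
        nlinarith
      have h7 := mul_le_mul h1 h4 (sq_nonneg _) (sq_nonneg _)
      have h8 : 0 ≤ A₁ ^ 2 * ‖hat F κ‖ ^ 2 := by positivity
      have e : A ^ 2 * (2 * V ^ 2 / η ^ 2 * (1 + ((κ - k) / η) ^ 2)⁻¹)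
          = 2 * A ^ 2 * V ^ 2 / η ^ 2 * (1 + ((κ - k) / η) ^ 2)⁻¹ := by ring
      linarith
  rw [integral_add ((integrable_norm_sq (memLp_hat F)).const_mul _) (hint.const_mul _),
    integral_const_mul, integral_const_mul, integral_hat_sq, hval] at h
  have hpi := pi_lt_d2
  have e : 2 * A ^ 2 * V ^ 2 / η ^ 2 * (η * π) = 2 * π * (A ^ 2 * V ^ 2 / η) := by field_simp
  have h9 : 0 ≤ A ^ 2 * V ^ 2 / η := by positivity
  have h10 : 0 ≤ A₁ ^ 2 * ‖F‖ ^ 2 := by positivity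
  have e2 : 7 * A ^ 2 * V ^ 2 / η = 7 * (A ^ 2 * V ^ 2 / η) := by ring
  rw [e] at h
  rw [e2]
  nlinarith

end Mult

/-! ### Dominated convergence in `L²` -/

theorem tendsto_toLp_of_dominated {ι : Type*} {l : Filter ι} [l.IsCountablyGenerated]
    {F : ι → ℝ → ℂ} {F₀ : ℝ → ℂ} (h : ∀ i, MemLp (F i) 2 volume) (h₀ : MemLp F₀ 2 volume)
    {G : ℝ → ℝ} (hG : MemLp G 2 volume) (hb : ∀ᶠ i in l, ∀ᵐ x, ‖F i x‖ ≤ G x)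
    (ht : ∀ᵐ x, Tendsto (fun i => F i x) l (𝓝 (F₀ x))) :
    Tendsto (fun i => (h i).toLp (F i)) l (𝓝 (h₀.toLp F₀)) := by
  rw [tendsto_iff_norm_sub_tendsto_zero]
  have e : ∀ i, ‖(h i).toLp (F i) - h₀.toLp F₀‖ = √(∫ x, ‖F i x - F₀ x‖ ^ 2) := by
    intro i
    rw [← MemLp.toLp_sub, ← Real.sqrt_sq (norm_nonneg _), norm_toLp_sq]
    rfl
  simp_rw [e]
  rw [← Real.sqrt_zero]
  refine (Real.continuous_sqrt.tendsto 0).comp ?_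
  have hz : (0 : ℝ) = ∫ x : ℝ, (0 : ℝ) := by simp
  rw [hz]
  have hsq : Integrable fun x => (G x + ‖F₀ x‖) ^ 2 := (hG.add h₀.norm).integrable_sq
  refine tendsto_integral_filter_of_dominated_convergence (fun x => (G x + ‖F₀ x‖) ^ 2)
    (Eventually.of_forall fun i => ((((h i).1.sub h₀.1).norm).pow 2)) ?_ hsq ?_
  · filter_upwards [hb] with i hi
    filter_upwards [hi] with x hx
    rw [Real.norm_of_nonneg (sq_nonneg _)]
    refine pow_le_pow_left₀ (norm_nonneg _) ((norm_sub_le _ _).trans ?_) 2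
    linarith
  · filter_upwards [ht] with x hx
    have : Tendsto (fun i => ‖F i x - F₀ x‖ ^ 2) l (𝓝 (‖F₀ x - F₀ x‖ ^ 2)) :=
      ((hx.sub_const _).norm).pow 2
    simpa using this

/-- Only strong convergence is asserted, for a fixed function: the far cutoff has moving jumps, so
the multipliers need not converge uniformly. -/
theorem tendsto_multH4 {ι : Type*} {l : Filter ι} [l.IsCountablyGenerated] {a : ι → ℝ → ℝ}
    {a₀ : ℝ → ℝ} (ha : ∀ i, Measurable (a i)) (ha₀ : Measurable a₀) {A : ι → ℝ}
    (hA : ∀ i κ, |a i κ| ≤ A i) {A₀ : ℝ} (hA₀ : ∀ κ, |a₀ κ| ≤ A₀) {B : ℝ}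
    (hB : ∀ᶠ i in l, A i ≤ B)
    (ht : ∀ᵐ κ, Tendsto (fun i => a i κ) l (𝓝 (a₀ κ))) (F : L2) :
    Tendsto (fun i => multH4 (a i) F) l (𝓝 (multH4 a₀ F)) := by
  have h := tendsto_toLp_of_dominated (l := l) (fun i => memLp_mul_hat (ha i) (hA i) F)
    (memLp_mul_hat ha₀ hA₀ F) (G := fun κ => B * ‖hat F κ‖) ((memLp_hat F).norm.const_mul B) ?_ ?_
  · rw [tendsto_iff_dist_tendsto_zero] at h ⊢
    refine h.congr fun i => ?_
    rw [multH4_eq (ha i) (hA i), multH4_eq ha₀ hA₀, H4.dist_mk]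
  · filter_upwards [hB] with i hi
    refine Eventually.of_forall fun κ => ?_
    rw [norm_mul, Complex.norm_real]
    exact mul_le_mul_of_nonneg_right ((hA i κ).trans hi) (norm_nonneg _)
  · filter_upwards [ht] with κ hκ
    exact ((Complex.continuous_ofReal.tendsto _).comp hκ).mul_const _

end

noncomputable section

/-! ### The far multiplier -/

open Classical in
/-- The multiplier `(1 + κ²)² / m(κ)` on the far frequencies. -/
def farWeight (τ : ℝ) (q : ℝ × ℝ) (κ : ℝ) : ℝ :=
  if κ ∈ nearFreq (amp q.1 q.2 ^ τ) then 0 else (1 + κ ^ 2) ^ 2 / symbol q.1 q.2 κ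

theorem mem_nearFreq {η κ : ℝ} : κ ∈ nearFreq η ↔ |κ + 1| ≤ η ∨ |κ - 1| ≤ η := by
  simp [nearFreq, Metric.mem_closedBall, Real.dist_eq]

theorem measurableSet_nearFreq (η : ℝ) : MeasurableSet (nearFreq η) :=
  Metric.isClosed_closedBall.measurableSet.union Metric.isClosed_closedBall.measurableSet

theorem measurable_farWeight (τ : ℝ) (q : ℝ × ℝ) : Measurable (farWeight τ q) := by
  unfold farWeight symbol
  exact Measurable.ite (measurableSet_nearFreq _) (by fun_prop) (by fun_prop)

theorem farWeight_neg (τ : ℝ) (q : ℝ × ℝ) (κ : ℝ) : farWeight τ q (-κ) = farWeight τ q κ := by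
  have h : -κ ∈ nearFreq (amp q.1 q.2 ^ τ) ↔ κ ∈ nearFreq (amp q.1 q.2 ^ τ) := by
    have e1 : |-κ + 1| = |κ - 1| := by rw [← abs_neg]; ring_nf
    have e2 : |-κ - 1| = |κ + 1| := by rw [← abs_neg]; ring_nf
    rw [mem_nearFreq, mem_nearFreq, e1, e2, or_comm]
  unfold farWeight
  by_cases hm : κ ∈ nearFreq (amp q.1 q.2 ^ τ)
  · rw [if_pos (h.mpr hm), if_pos hm]
  · rw [if_neg fun hh => hm (h.mp hh), if_neg hm, symbol, symbol, neg_sq]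

/-- By symmetry κ ≥ 0, where 1 - κ² factors into the distance to 1 and a factor at least 1. The
weight 1 + κ² is harmless near 1, and for large κ the ratio tends to 1, which is why η ≤ 1 is
needed. -/
theorem one_sub_sq_ge {κ η : ℝ} (hη : 0 ≤ η) (hη1 : η ≤ 1) (h1 : η ≤ |κ + 1|) (h2 : η ≤ |κ - 1|) :
    2 / 5 * η * (1 + κ ^ 2) ≤ |1 - κ ^ 2| := by
  wlog hκ : 0 ≤ κ generalizing κ
  · have e1 : |-κ + 1| = |κ - 1| := by rw [← abs_neg]; ring_nf
    have e2 : |-κ - 1| = |κ + 1| := by rw [← abs_neg]; ring_nf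
    have := this (κ := -κ) (by rw [e1]; exact h2) (by rw [e2]; exact h1) (by linarith)
    simpa using this
  rcases le_total κ 1 with h | h
  · rw [abs_of_nonpos (by linarith)] at h2
    rw [abs_of_nonneg (by nlinarith)]
    nlinarith [mul_nonneg hη hκ]
  · rw [abs_of_nonneg (by linarith)] at h2
    rw [abs_of_nonpos (by nlinarith)]
    nlinarith [mul_nonneg hη hκ, mul_nonneg hη (sub_nonneg.mpr h),
      mul_nonneg (sub_nonneg.mpr hη1) (sq_nonneg (κ - 1))]

/-- Replacing ω² by 1 costs |δΩ|κ² ≤ (δ/3)κ² ≤ c(1 + κ²), half of the assumed lower bound. -/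
theorem symbol_lower {q : ℝ × ℝ} (hq : q ∈ rollSet) {κ c : ℝ} (hc : q.1 / 3 ≤ c)
    (h : 2 * c * (1 + κ ^ 2) ≤ |1 - κ ^ 2|) :
    c ^ 2 * (1 + κ ^ 2) ^ 2 ≤ (1 - wavenumber q.1 q.2 ^ 2 * κ ^ 2) ^ 2 := by
  have hδ := hq.1.1
  rw [wavenumber_sq hδ (rollThreshold_spec hδ hq.1.2).1 hq.2]
  have h1 : |q.1 * q.2 * κ ^ 2| ≤ c * (1 + κ ^ 2) := by
    have hO : |q.2| ≤ 1 / 3 := abs_le.mpr ⟨by linarith [hq.2.1], by linarith [hq.2.2]⟩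
    rw [abs_mul, abs_mul, abs_of_pos hδ, abs_of_nonneg (sq_nonneg κ)]
    have h3 : q.1 * |q.2| ≤ c := by nlinarith
    have : 0 ≤ c := by linarith
    nlinarith [sq_nonneg κ]
  have h2 : |1 - κ ^ 2| ≤ |1 - (1 + q.1 * q.2) * κ ^ 2| + |q.1 * q.2 * κ ^ 2| := by
    have e : 1 - κ ^ 2 = (1 - (1 + q.1 * q.2) * κ ^ 2) + q.1 * q.2 * κ ^ 2 := by ring
    conv_lhs => rw [e]
    exact abs_add_le _ _
  have h4 : c * (1 + κ ^ 2) ≤ |1 - (1 + q.1 * q.2) * κ ^ 2| := by linarith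
  have hc0 : 0 ≤ c := by linarith
  rw [← mul_pow, ← sq_abs (1 - (1 + q.1 * q.2) * κ ^ 2)]
  exact pow_le_pow_left₀ (by positivity) h4 2

theorem weight_le {q : ℝ × ℝ} (hq : q ∈ rollSet) {κ c : ℝ} (hc0 : 0 < c) (hc : q.1 / 3 ≤ c)
    (h : 2 * c * (1 + κ ^ 2) ≤ |1 - κ ^ 2|) :
    |(1 + κ ^ 2) ^ 2 / symbol q.1 q.2 κ| ≤ 1 / c ^ 2 := by
  have hl := symbol_lower hq hc h
  have hp : 0 < c ^ 2 * (1 + κ ^ 2) ^ 2 := by positivity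
  rw [symbol, abs_div, abs_neg, abs_of_nonneg (by positivity), abs_of_nonneg (by positivity),
    div_le_div_iff₀ (hp.trans_le hl) (by positivity)]
  linarith

/-- The smallness conditions on the parameters under which the far multiplier is controlled. -/
structure Admissible (τ : ℝ) (q : ℝ × ℝ) : Prop where
  mem : q ∈ rollSet
  radius_le : amp q.1 q.2 ^ τ ≤ 1 / 2
  small : 5 * q.1 ≤ 3 * amp q.1 q.2 ^ τ

theorem amp_pos {q : ℝ × ℝ} (hq : q ∈ rollSet) : 0 < amp q.1 q.2 := hq.1.1.trans_le (amp_mem hq).1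

theorem Admissible.radius_pos {τ : ℝ} {q : ℝ × ℝ} (hq : Admissible τ q) : 0 < amp q.1 q.2 ^ τ :=
  Real.rpow_pos_of_pos (amp_pos hq.mem) τ

theorem Admissible.one_sub_sq_ge {τ : ℝ} {q : ℝ × ℝ} (hq : Admissible τ q) {κ : ℝ}
    (hκ : κ ∉ nearFreq (amp q.1 q.2 ^ τ)) :
    2 * (amp q.1 q.2 ^ τ / 5) * (1 + κ ^ 2) ≤ |1 - κ ^ 2| := by
  rw [mem_nearFreq, not_or, not_le, not_le] at hκ
  have := QuenchedSH.one_sub_sq_ge hq.radius_pos.le (by linarith [hq.radius_le]) hκ.1.le hκ.2.le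
  linarith

/-- Take c = η/5 with η the radius: the condition `small` says δ/3 ≤ η/5. The quadratic zero of the
symbol costs η⁻². -/
theorem Admissible.farWeight_le {τ : ℝ} {q : ℝ × ℝ} (hq : Admissible τ q) (κ : ℝ) :
    |farWeight τ q κ| ≤ 25 / (amp q.1 q.2 ^ τ) ^ 2 := by
  have hη := hq.radius_pos
  unfold farWeight
  split_ifs with hκ
  · rw [abs_zero]; positivity
  · have h := weight_le hq.mem (by positivity) (by linarith [hq.small]) (hq.one_sub_sq_ge hκ)
    refine h.trans (le_of_eq ?_)
    field_simp; norm_num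

/-- Within the radius of ±1 the cutoff is active. Every other integer has distance at least 1 from
±1, so κ stays 1/2 away from both; this allows c = 1/10, hence the bound 100. -/
theorem Admissible.farWeight_le_of_near_int {τ : ℝ} {q : ℝ × ℝ} (hq : Admissible τ q) (k : ℤ)
    (κ : ℝ) (h : |κ - k| < amp q.1 q.2 ^ τ) : |farWeight τ q κ| ≤ 100 := by
  have hη := hq.radius_pos
  have hη2 := hq.radius_le
  unfold farWeight
  split_ifs with hκ
  · norm_num
  · have hk1 : k ≠ -1 := by
      rintro rfl
      exact hκ (mem_nearFreq.mpr (Or.inl (by push_cast at h; simpa using h.le)))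
    have hk2 : k ≠ 1 := by
      rintro rfl
      exact hκ (mem_nearFreq.mpr (Or.inr (by push_cast at h; exact h.le)))
    have a1 : (1 : ℝ) ≤ |(k : ℝ) + 1| := by
      have : (1 : ℤ) ≤ |k + 1| := Int.one_le_abs (by omega)
      exact_mod_cast this
    have a2 : (1 : ℝ) ≤ |(k : ℝ) - 1| := by
      have : (1 : ℤ) ≤ |k - 1| := Int.one_le_abs (by omega)
      exact_mod_cast this
    have b1 : 1 / 2 ≤ |κ + 1| := by
      have e : (k : ℝ) + 1 = (κ + 1) - (κ - k) := by ring
      rw [e] at a1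
      linarith [abs_sub (κ + 1) (κ - k)]
    have b2 : 1 / 2 ≤ |κ - 1| := by
      have e : (k : ℝ) - 1 = (κ - 1) - (κ - k) := by ring
      rw [e] at a2
      linarith [abs_sub (κ - 1) (κ - k)]
    have h1 := QuenchedSH.one_sub_sq_ge (κ := κ) (by norm_num) (by norm_num) b1 b2
    have := weight_le hq.mem (κ := κ) (c := 1 / 10) (by norm_num)
      (by linarith [hq.small, hq.radius_le]) (by linarith)
    norm_num at this
    exact this

/-- Convergence can fail only at the four endpoints of the limiting near intervals, a null set.
Elsewhere κ stays on its side of the cutoff, and the limiting symbol does not vanish outside. -/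
theorem tendsto_farWeight {ι : Type*} {l : Filter ι} {τ : ℝ} {q : ι → rollSet} {q₀ : rollSet}
    (hq₀ : Admissible τ q₀) (h : Tendsto q l (𝓝 q₀)) :
    ∀ᵐ κ : ℝ, Tendsto (fun i => farWeight τ (q i) κ) l (𝓝 (farWeight τ q₀ κ)) := by
  set η₀ := amp q₀.1.1 q₀.1.2 ^ τ with hη₀
  have hη : Tendsto (fun i => amp (q i).1.1 (q i).1.2 ^ τ) l (𝓝 η₀) :=
    ((continuous_amp.tendsto q₀).comp h).rpow_const (Or.inl (amp_pos q₀.2).ne')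
  have hw : Tendsto (fun i => wavenumber (q i).1.1 (q i).1.2) l
      (𝓝 (wavenumber q₀.1.1 q₀.1.2)) :=
    ((continuous_wavenumber.comp continuous_subtype_val).tendsto q₀).comp h
  have hfin : ({-1 + η₀, -1 - η₀, 1 + η₀, 1 - η₀} : Set ℝ).Finite := by simp
  filter_upwards [compl_mem_ae_iff.mpr (hfin.measure_zero volume)] with κ hκ
  simp only [mem_compl_iff, mem_insert_iff, mem_singleton_iff, not_or] at hκ
  have n1 : |κ + 1| ≠ η₀ := by
    intro hh
    rcases abs_cases (κ + 1) with ⟨c, -⟩ | ⟨c, -⟩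
    · exact hκ.1 (by linarith)
    · exact hκ.2.1 (by linarith)
  have n2 : |κ - 1| ≠ η₀ := by
    intro hh
    rcases abs_cases (κ - 1) with ⟨c, -⟩ | ⟨c, -⟩
    · exact hκ.2.2.1 (by linarith)
    · exact hκ.2.2.2 (by linarith)
  by_cases hmem : κ ∈ nearFreq η₀
  · have hev : ∀ᶠ i in l, κ ∈ nearFreq (amp (q i).1.1 (q i).1.2 ^ τ) := by
      rcases mem_nearFreq.mp hmem with hh | hh
      · filter_upwards [hη.eventually (lt_mem_nhds (lt_of_le_of_ne hh n1))] with i hi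
        exact mem_nearFreq.mpr (Or.inl hi.le)
      · filter_upwards [hη.eventually (lt_mem_nhds (lt_of_le_of_ne hh n2))] with i hi
        exact mem_nearFreq.mpr (Or.inr hi.le)
    have e : farWeight τ q₀ κ = 0 := if_pos hmem
    rw [e]
    refine tendsto_const_nhds.congr' ?_
    filter_upwards [hev] with i hi
    exact (if_pos hi).symm
  · have hh := hmem
    rw [mem_nearFreq, not_or, not_le, not_le] at hh
    have hev : ∀ᶠ i in l, κ ∉ nearFreq (amp (q i).1.1 (q i).1.2 ^ τ) := by
      filter_upwards [hη.eventually (gt_mem_nhds hh.1), hη.eventually (gt_mem_nhds hh.2)]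
        with i h1 h2
      rw [mem_nearFreq, not_or, not_le, not_le]
      exact ⟨h1, h2⟩
    have e : farWeight τ q₀ κ = (1 + κ ^ 2) ^ 2 / symbol q₀.1.1 q₀.1.2 κ := if_neg hmem
    rw [e]
    have hne : symbol q₀.1.1 q₀.1.2 κ ≠ 0 := by
      have hl := symbol_lower q₀.2 (by linarith [hq₀.small]) (hq₀.one_sub_sq_ge hmem)
      have hp : 0 < (amp q₀.1.1 q₀.1.2 ^ τ / 5) ^ 2 * (1 + κ ^ 2) ^ 2 := by
        have := hq₀.radius_pos
        positivity
      rw [symbol]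
      linarith
    have hs : Tendsto (fun i => (1 + κ ^ 2) ^ 2 / symbol (q i).1.1 (q i).1.2 κ) l
        (𝓝 ((1 + κ ^ 2) ^ 2 / symbol q₀.1.1 q₀.1.2 κ)) := by
      refine tendsto_const_nhds.div ?_ hne
      unfold symbol
      exact ((tendsto_const_nhds.sub ((hw.pow 2).mul_const _)).pow 2).neg
    refine hs.congr' ?_
    filter_upwards [hev] with i hi
    exact (if_neg hi).symm

end

noncomputable section

/-! ### Decay of the partition function -/

theorem exists_bound_exp {f : ℝ → ℝ} (hf : Continuous f) {c S K : ℝ} (s : Set ℝ)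
    (h : ∀ x ∈ s, S < |x| → |f x| ≤ K * exp (-c * |x|)) :
    ∃ K' ≥ 0, ∀ x ∈ s, |f x| ≤ K' * exp (-c * |x|) := by
  obtain ⟨M, hM⟩ := (isCompact_Icc (a := -S) (b := S)).exists_bound_of_continuousOn
    (f := fun x => f x * exp (c * |x|)) (by fun_prop)
  refine ⟨max (max M K) 0, le_max_right _ _, fun x hx => ?_⟩
  rcases lt_or_ge S |x| with hS | hS
  · exact (h x hx hS).trans (mul_le_mul_of_nonneg_right
      ((le_max_right M K).trans (le_max_left _ _)) (exp_pos _).le)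
  · have h1 := hM x (abs_le.mp hS)
    rw [Real.norm_eq_abs, abs_mul, abs_of_pos (exp_pos _)] at h1
    have h2 : |f x| * exp (c * |x|) ≤ max (max M K) 0 :=
      h1.trans ((le_max_left M K).trans (le_max_left _ _))
    have h3 := mul_le_mul_of_nonneg_right h2 (exp_pos (-c * |x|)).le
    rwa [mul_assoc, ← Real.exp_add, show c * |x| + -c * |x| = 0 by ring, Real.exp_zero,
      mul_one] at h3

/-- Global form of the decay of a partition function. -/
structure PartitionBound (χ : ℝ → ℝ) (c K : ℝ) : Prop where
  rate_pos : 0 < c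
  one_le : 1 ≤ K
  right : ∀ x, 0 ≤ x → |χ x| ≤ K * exp (-c * |x|)
  left : ∀ x, x ≤ 0 → |χ x - 1| ≤ K * exp (-c * |x|)
  deriv_le : ∀ j, 1 ≤ j → j ≤ 4 → ∀ x, |iteratedDeriv j χ x| ≤ K * exp (-c * |x|)

theorem iteratedDeriv_sub_const {j : ℕ} (hj : 1 ≤ j) (f : ℝ → ℝ) (a : ℝ) :
    iteratedDeriv j (fun y => f y - a) = iteratedDeriv j f := by
  obtain ⟨k, rfl⟩ := Nat.exists_eq_add_of_le hj
  rw [add_comm, iteratedDeriv_succ', iteratedDeriv_succ']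
  congr 1
  ext x
  rw [deriv_sub_const]

theorem IsPartition.continuous_iteratedDeriv {χ : ℝ → ℝ} (hχ : IsPartition χ) (j : ℕ) :
    Continuous (iteratedDeriv j χ) :=
  hχ.smooth.continuous_iteratedDeriv j (by exact_mod_cast le_top)

theorem IsPartition.exists_bound {χ : ℝ → ℝ} (hχ : IsPartition χ) :
    ∃ c K, PartitionBound χ c K := by
  obtain ⟨c, hc, S, hS, K, h⟩ := hχ.decay
  have hcont := hχ.smooth.continuous
  obtain ⟨Ka, hKa, ha⟩ := exists_bound_exp hcont (c := c) (S := S) (K := K) (Ici 0)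
    (fun x hx hx2 => by
      have := (h 0 (by norm_num)).2 x (by rwa [abs_of_nonneg hx] at hx2)
      simpa using this)
  obtain ⟨Kb, hKb, hb⟩ := exists_bound_exp (hcont.sub continuous_const) (f := fun x => χ x - 1)
    (c := c) (S := S) (K := K) (Iic 0)
    (fun x hx hx2 => by
      have := (h 0 (by norm_num)).1 x (by
        rw [abs_of_nonpos hx] at hx2; linarith)
      simpa using this)
  have hd : ∀ j, ∃ K' ≥ 0, 1 ≤ j → j ≤ 4 → ∀ x, |iteratedDeriv j χ x| ≤ K' * exp (-c * |x|) := by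
    intro j
    by_cases hj : 1 ≤ j ∧ j ≤ 4
    · obtain ⟨K', h0, h'⟩ := exists_bound_exp (hχ.continuous_iteratedDeriv j) (c := c) (S := S)
        (K := K) univ (fun x _ hx2 => by
          rcases le_total 0 x with h0 | h0
          · exact (h j hj.2).2 x (by rwa [abs_of_nonneg h0] at hx2)
          · have := (h j hj.2).1 x (by rw [abs_of_nonpos h0] at hx2; linarith)
            rwa [iteratedDeriv_sub_const hj.1] at this)
      exact ⟨K', h0, fun _ _ x => h' x trivial⟩
    · exact ⟨0, le_rfl, fun h1 h2 => absurd ⟨h1, h2⟩ hj⟩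
  choose Kd hKd hd using hd
  set K' := 1 + Ka + Kb + Kd 1 + Kd 2 + Kd 3 + Kd 4
  have k1 := hKd 1
  have k2 := hKd 2
  have k3 := hKd 3
  have k4 := hKd 4
  refine ⟨c, K', hc, by linarith, fun x hx => (ha x hx).trans ?_, fun x hx => (hb x hx).trans ?_,
    fun j h1 h4 x => (hd j h1 h4 x).trans ?_⟩
  · exact mul_le_mul_of_nonneg_right (by linarith) (exp_pos _).le
  · exact mul_le_mul_of_nonneg_right (by linarith) (exp_pos _).le
  · refine mul_le_mul_of_nonneg_right ?_ (exp_pos _).le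
    interval_cases j <;> linarith

/-! ### Exponentially decaying functions -/

theorem integral_exp_neg_mul_abs {b : ℝ} (hb : 0 < b) : ∫ x : ℝ, exp (-b * |x|) = 2 / b := by
  rw [integral_comp_abs (f := fun x => exp (-b * x)), integral_exp_mul_Ioi (by linarith)]
  simp; ring

theorem integrable_exp_neg_mul_abs {b : ℝ} (hb : 0 < b) :
    Integrable fun x : ℝ => exp (-b * |x|) := by
  -- A non-integrable function has integral 0 by convention, whereas the value computed above is
  -- positive.
  by_contra h
  have := integral_exp_neg_mul_abs hb
  rw [integral_undef h] at this
  have : 0 < 2 / b := by positivity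
  linarith

theorem exp_neg_mul_abs_sq (b x : ℝ) : exp (-b * |x|) ^ 2 = exp (-(2 * b) * |x|) := by
  rw [← Real.exp_nat_mul]; congr 1; push_cast; ring

theorem memLp_exp_neg_mul_abs {b : ℝ} (hb : 0 < b) :
    MemLp (fun x : ℝ => exp (-b * |x|)) 2 volume := by
  rw [memLp_two_iff_integrable_sq (Continuous.aestronglyMeasurable (by fun_prop))]
  simp_rw [exp_neg_mul_abs_sq]
  exact integrable_exp_neg_mul_abs (by positivity)

theorem memLp_of_exp_bound {f : ℝ → ℂ} (hf : AEStronglyMeasurable f volume) {b K : ℝ} (hb : 0 < b)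
    (h : ∀ x, ‖f x‖ ≤ K * exp (-b * |x|)) : MemLp f 2 volume := by
  refine (memLp_exp_neg_mul_abs hb).of_le_mul (c := K) hf (Eventually.of_forall fun x => ?_)
  rw [Real.norm_of_nonneg (exp_pos _).le]
  exact h x

theorem integrable_of_exp_bound {f : ℝ → ℂ} (hf : AEStronglyMeasurable f volume) {b K : ℝ}
    (hb : 0 < b) (h : ∀ x, ‖f x‖ ≤ K * exp (-b * |x|)) : Integrable f :=
  ((integrable_exp_neg_mul_abs hb).const_mul K).mono' hf (Eventually.of_forall h)

theorem norm_toLp_sq_le_of_exp_bound {f : ℝ → ℂ} (hf : MemLp f 2 volume) {b K : ℝ} (hb : 0 < b)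
    (h : ∀ x, ‖f x‖ ≤ K * exp (-b * |x|)) : ‖hf.toLp f‖ ^ 2 ≤ K ^ 2 / b := by
  have e : K ^ 2 / b = ∫ x : ℝ, K ^ 2 * exp (-(2 * b) * |x|) := by
    rw [integral_const_mul, integral_exp_neg_mul_abs (by positivity)]
    field_simp
  rw [norm_toLp_sq, e]
  refine integral_mono (integrable_norm_sq hf)
    ((integrable_exp_neg_mul_abs (by positivity)).const_mul _) fun x => ?_
  rw [← exp_neg_mul_abs_sq, ← mul_pow]
  exact pow_le_pow_left₀ (norm_nonneg _) (h x) 2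

/-! ### Modulated profiles -/

/-- One integration by parts: iθ times the integral is minus the boundary value at 0 minus the
integral with G(ex) differentiated. The factor e from the chain rule cancels the length 1/e of the
profile, so the bound is uniform in e, and a jump at 0 is allowed. -/
theorem abs_mul_norm_integral_Ioi_le {G G' : ℝ → ℝ} (hG : ∀ x, HasDerivAt G (G' x) x)
    (hG' : Continuous G') {c K : ℝ} (hc : 0 < c) (hb : ∀ x, 0 ≤ x → |G x| ≤ K * exp (-c * |x|))
    (hb' : ∀ x, 0 ≤ x → |G' x| ≤ K * exp (-c * |x|)) {e : ℝ} (he : 0 < e) (θ : ℝ) :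
    |θ| * ‖∫ x in Ioi (0 : ℝ), (G (e * x) : ℂ) * Complex.exp ((θ * x : ℝ) * Complex.I)‖
      ≤ K + K / c := by
  have hGc : Continuous G := continuous_iff_continuousAt.mpr fun x => (hG x).continuousAt
  set f : ℝ → ℂ := fun x => (G (e * x) : ℂ) * Complex.exp ((θ * x : ℝ) * Complex.I) with hf
  set g : ℝ → ℂ := fun x => (e * G' (e * x) : ℝ) * Complex.exp ((θ * x : ℝ) * Complex.I) with hg
  have hexp : ∀ x : ℝ, ‖Complex.exp ((θ * x : ℝ) * Complex.I)‖ = 1 := fun x =>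
    Complex.norm_exp_ofReal_mul_I _
  have hce : -(c * e) < 0 := by nlinarith
  have hi := integrableOn_exp_mul_Ioi hce 0
  have hfb : ∀ x, 0 ≤ x → ‖f x‖ ≤ K * exp (-(c * e) * x) := by
    intro x hx
    simp only [hf]
    rw [norm_mul, hexp, mul_one, Complex.norm_real]
    refine (hb _ (by positivity)).trans (le_of_eq ?_)
    rw [abs_of_nonneg (by positivity)]; ring_nf
  have hgb : ∀ x, 0 ≤ x → ‖g x‖ ≤ e * K * exp (-(c * e) * x) := by
    intro x hx
    simp only [hg]
    rw [norm_mul, hexp, mul_one, Complex.norm_real, norm_mul, Real.norm_of_nonneg he.le, mul_assoc]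
    refine mul_le_mul_of_nonneg_left ?_ he.le
    refine (hb' _ (by positivity)).trans (le_of_eq ?_)
    rw [abs_of_nonneg (by positivity)]; ring_nf
  have hfi : IntegrableOn f (Ioi 0) := by
    refine (hi.const_mul K).mono' (Continuous.aestronglyMeasurable (by fun_prop)) ?_
    filter_upwards [ae_restrict_mem measurableSet_Ioi] with x hx
    exact hfb x (le_of_lt hx)
  have hgi : IntegrableOn g (Ioi 0) := by
    refine (hi.const_mul (e * K)).mono' (Continuous.aestronglyMeasurable (by fun_prop)) ?_
    filter_upwards [ae_restrict_mem measurableSet_Ioi] with x hx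
    exact hgb x (le_of_lt hx)
  have hd : ∀ x, HasDerivAt f (g x + (θ * Complex.I) * f x) x := by
    intro x
    have h1 : HasDerivAt (fun x : ℝ => G (e * x)) (e * G' (e * x)) x := by
      exact HasDerivAt.congr_deriv ((hG (e * x)).comp x ((hasDerivAt_id x).const_mul e))
        (by rw [mul_one, mul_comm])
    have h2 : HasDerivAt (fun x : ℝ => Complex.exp ((θ * x : ℝ) * Complex.I))
        (Complex.exp ((θ * x : ℝ) * Complex.I) * (θ * Complex.I)) x := by
      have h3 : HasDerivAt (fun x : ℝ => ((θ * x : ℝ) : ℂ)) (θ : ℂ) x := by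
        have := ((hasDerivAt_id x).const_mul θ).ofReal_comp
        simpa using this
      exact (h3.mul_const Complex.I).cexp
    refine (h1.ofReal_comp.mul h2).congr_deriv ?_
    simp only [hf, hg]; push_cast; ring
  have ht : Tendsto f atTop (𝓝 0) := by
    refine squeeze_zero_norm' (a := fun x => K * exp (-(c * e) * x)) ?_ ?_
    · filter_upwards [eventually_ge_atTop 0] with x hx using hfb x hx
    · have : Tendsto (fun x : ℝ => exp (-(c * e) * x)) atTop (𝓝 0) :=
        Real.tendsto_exp_atBot.comp (tendsto_id.const_mul_atTop_of_neg hce)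
      simpa using this.const_mul K
  have hI := integral_Ioi_of_hasDerivAt_of_tendsto' (fun x _ => hd x)
    (hgi.add (hfi.const_mul _)) ht
  rw [integral_add hgi (hfi.const_mul _), integral_const_mul] at hI
  have hgI : ‖∫ x in Ioi (0 : ℝ), g x‖ ≤ K / c := by
    have h1 := norm_integral_le_of_norm_le (hi.const_mul (e * K)) (f := g) (by
      filter_upwards [ae_restrict_mem measurableSet_Ioi] with x hx
      exact hgb x (le_of_lt hx))
    refine h1.trans (le_of_eq ?_)
    rw [integral_const_mul, integral_exp_mul_Ioi hce]
    simp only [mul_zero, Real.exp_zero]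
    field_simp
  have hf0 : ‖f 0‖ ≤ K := by simpa using hfb 0 le_rfl
  have heq : (θ * Complex.I) * ∫ x in Ioi (0 : ℝ), f x = -f 0 - ∫ x in Ioi (0 : ℝ), g x := by
    rw [zero_sub] at hI
    rw [← hI]; ring
  have hn : |θ| * ‖∫ x in Ioi (0 : ℝ), f x‖ = ‖-f 0 - ∫ x in Ioi (0 : ℝ), g x‖ := by
    rw [← heq, norm_mul, norm_mul, Complex.norm_I, mul_one, Complex.norm_real, Real.norm_eq_abs]
  rw [hn]
  refine (norm_sub_le _ _).trans ?_
  rw [norm_neg]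
  linarith

theorem abs_mul_norm_integral_Iic_le {G G' : ℝ → ℝ} (hG : ∀ x, HasDerivAt G (G' x) x)
    (hG' : Continuous G') {c K : ℝ} (hc : 0 < c) (hb : ∀ x, x ≤ 0 → |G x| ≤ K * exp (-c * |x|))
    (hb' : ∀ x, x ≤ 0 → |G' x| ≤ K * exp (-c * |x|)) {e : ℝ} (he : 0 < e) (θ : ℝ) :
    |θ| * ‖∫ x in Iic (0 : ℝ), (G (e * x) : ℂ) * Complex.exp ((θ * x : ℝ) * Complex.I)‖
      ≤ K + K / c := by
  have h := abs_mul_norm_integral_Ioi_le (G := fun x => G (-x)) (G' := fun x => -G' (-x))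
    (fun x => by
      exact HasDerivAt.congr_deriv ((hG (-x)).comp x (hasDerivAt_neg x)) (by ring)) (by fun_prop) hc
    (fun x hx => by simpa using hb (-x) (by linarith))
    (fun x hx => by simpa using hb' (-x) (by linarith)) he (-θ)
  have e1 := integral_comp_neg_Ioi 0
    (fun x : ℝ => (G (e * x) : ℂ) * Complex.exp ((θ * x : ℝ) * Complex.I))
  rw [neg_zero] at e1
  rw [← e1, ← abs_neg θ]
  refine le_trans (le_of_eq ?_) h
  congr 3
  ext x
  rw [show e * -x = -(e * x) by ring, show θ * -x = -θ * x by ring]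

end

noncomputable section

/-! ### Square integrable functions with controlled image under a multiplier -/

/-- `f` is square integrable and its image under the multiplier `a` has norm at most `B`. -/
def MultBound (a : ℝ → ℝ) (f : ℝ → ℂ) (B : ℝ) : Prop :=
  ∃ h : MemLp f 2 volume, ‖multH4 a (h.toLp f)‖ ≤ B

section MultBound

variable {a : ℝ → ℝ} (ha : Measurable a) {A : ℝ} (hA : ∀ κ, |a κ| ≤ A)
include ha hA

theorem multH4_add (F G : L2) : multH4 a (F + G) = multH4 a F + multH4 a G := by
  have h := multH4_sub ha hA (F + G) G
  rw [add_sub_cancel_right] at h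
  rw [← h, sub_add_cancel]

theorem multH4_smul (c : ℂ) (F : L2) : multH4 a (c • F) = c • multH4 a F := by
  refine H4.ext_weighted ?_
  have h1 := weighted_multH4 ha hA F
  have h2 := weighted_multH4 ha hA (c • F)
  have h3 : weighted (c • multH4 a F).toL2 =ᵐ[volume] c • weighted (multH4 a F).toL2 :=
    weighted_smul c _
  filter_upwards [h1, h2, h3, hat_smul c F] with κ a1 a2 a3 a4
  rw [a2, a3, a4, Pi.smul_apply, a1, smul_eq_mul]; ring

theorem norm_multH4_smul (c : ℂ) (F : L2) : ‖multH4 a (c • F)‖ = ‖c‖ * ‖multH4 a F‖ := by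
  rw [multH4_smul ha hA, H4.norm_eq_weightMap, H4.norm_eq_weightMap, map_smul, norm_smul]

theorem MultBound.add {f g : ℝ → ℂ} {B B' : ℝ} (hf : MultBound a f B) (hg : MultBound a g B') :
    MultBound a (fun x => f x + g x) (B + B') := by
  obtain ⟨h1, h2⟩ := hf
  obtain ⟨h3, h4⟩ := hg
  refine ⟨h1.add h3, ?_⟩
  have : (h1.add h3).toLp (fun x => f x + g x) = h1.toLp f + h3.toLp g := MemLp.toLp_add h1 h3
  rw [this, multH4_add ha hA]
  exact (norm_add_le _ _).trans (add_le_add h2 h4)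

theorem MultBound.const_mul {f : ℝ → ℂ} {B : ℝ} (hf : MultBound a f B) (c : ℂ) :
    MultBound a (fun x => c * f x) (‖c‖ * B) := by
  obtain ⟨h1, h2⟩ := hf
  refine ⟨h1.const_mul c, ?_⟩
  have : (h1.const_mul c).toLp (fun x => c * f x) = c • h1.toLp f := MemLp.toLp_const_smul c h1
  rw [this, norm_multH4_smul ha hA]
  exact mul_le_mul_of_nonneg_left h2 (norm_nonneg _)

omit ha hA in
theorem MultBound.mono {f : ℝ → ℂ} {B B' : ℝ} (hf : MultBound a f B) (h : B ≤ B') :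
    MultBound a f B' := ⟨hf.1, hf.2.trans h⟩

theorem multBound_of_exp_bound {f : ℝ → ℂ} (hf : AEStronglyMeasurable f volume) {b K : ℝ}
    (hb : 0 < b) (hK : 0 ≤ K) (h : ∀ x, ‖f x‖ ≤ K * exp (-b * |x|)) :
    MultBound a f (3 * A * (K / √b)) := by
  have hm := memLp_of_exp_bound hf hb h
  refine ⟨hm, (norm_multH4_le ha hA _).trans ?_⟩
  have hA0 : 0 ≤ A := (abs_nonneg _).trans (hA 0)
  refine mul_le_mul_of_nonneg_left ?_ (by positivity)
  refine (sq_le_sq₀ (norm_nonneg _) (by positivity)).mp ?_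
  refine (norm_toLp_sq_le_of_exp_bound hm hb h).trans (le_of_eq ?_)
  rw [div_pow, Real.sq_sqrt hb.le]

theorem multBound_of_mode {f : ℝ → ℂ} (hf : AEStronglyMeasurable f volume) {b K k η V A₁ B : ℝ}
    (hb : 0 < b) (h : ∀ x, ‖f x‖ ≤ K * exp (-b * |x|)) (hη : 0 < η)
    (hA₁ : ∀ κ, |κ - k| < η → |a κ| ≤ A₁)
    (hV : ∀ κ : ℝ, |κ - k| * ‖∫ x, f x * Complex.exp (-(κ * x : ℝ) * Complex.I)‖ ≤ V)
    (hB : 0 ≤ B) (hle : 7 * A₁ ^ 2 * (K ^ 2 / b) + 7 * A ^ 2 * V ^ 2 / η ≤ B ^ 2) :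
    MultBound a f B := by
  have hm := memLp_of_exp_bound hf hb h
  refine ⟨hm, (sq_le_sq₀ (norm_nonneg _) hB).mp (le_trans ?_ hle)⟩
  have hi : Integrable (hm.toLp f) :=
    (integrable_of_exp_bound hf hb h).congr hm.coeFn_toLp.symm
  have hhat : ∀ᵐ κ : ℝ, |κ - k| * ‖hat (hm.toLp f) κ‖ ≤ V := by
    filter_upwards [hat_eq_integral (hm.toLp f) hi] with κ hκ
    rw [hκ]
    refine le_trans (le_of_eq ?_) (hV κ)
    congr 2
    refine integral_congr_ae ?_
    filter_upwards [hm.coeFn_toLp] with x hx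
    rw [hx]
  refine (norm_multH4_sq_le_of_mode ha hA _ hη hA₁ hhat).trans ?_
  have := norm_toLp_sq_le_of_exp_bound hm hb h
  gcongr

end MultBound

/-! ### Oscillating profiles on half lines -/

/-- A smooth function decaying exponentially, together with its derivative, on `s`. -/
structure IsProfile (s : Set ℝ) (c K : ℝ) (G : ℝ → ℝ) : Prop where
  contDiff : ContDiff ℝ 1 G
  bound : ∀ x ∈ s, |G x| ≤ K * exp (-c * |x|)
  deriv_bound : ∀ x ∈ s, |deriv G x| ≤ K * exp (-c * |x|)

theorem IsProfile.hasDerivAt {s : Set ℝ} {c K : ℝ} {G : ℝ → ℝ} (h : IsProfile s c K G) (x : ℝ) :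
    HasDerivAt G (deriv G x) x := (h.contDiff.differentiable (by norm_num)).differentiableAt.hasDerivAt

theorem IsProfile.continuous_deriv {s : Set ℝ} {c K : ℝ} {G : ℝ → ℝ} (h : IsProfile s c K G) :
    Continuous (deriv G) := h.contDiff.continuous_deriv (by norm_num)

/-- The constant in the bound for oscillating profiles. -/
def profileConst (c K : ℝ) : ℝ := √(70000 * (K ^ 2 / c) + 4375 * (K + K / c) ^ 2)

/-- The profile at frequency k has squared norm of order 1/e with e = ε^β, seen by the multiplier
only through its O(1) size near an integer. The tail off the window uses the multiplier of size
25/η² and the transform bound 1/|κ - k|, costing η⁻⁵. -/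
theorem Admissible.multBound_indicator {τ β c K : ℝ} {q : ℝ × ℝ} (hq : Admissible τ q)
    (hτ : 5 * τ ≤ β) (hc : 0 < c) {s : Set ℝ} {G : ℝ → ℝ} (hG : Continuous G)
    (hs : MeasurableSet s) (hse : ∀ x ∈ s, amp q.1 q.2 ^ β * x ∈ s)
    (hb : ∀ x ∈ s, |G x| ≤ K * exp (-c * |x|))
    (hI : ∀ θ : ℝ, |θ| * ‖∫ x in s, (G (amp q.1 q.2 ^ β * x) : ℂ)
      * Complex.exp ((θ * x : ℝ) * Complex.I)‖ ≤ K + K / c) (k : ℤ) :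
    MultBound (farWeight τ q) (s.indicator fun x => (G (amp q.1 q.2 ^ β * x) : ℂ)
      * Complex.exp ((k * x : ℝ) * Complex.I)) (profileConst c K / √(amp q.1 q.2 ^ β)) := by
  have hε := amp_pos hq.mem
  have hε1 : amp q.1 q.2 ≤ 1 := by
    have h1 := (amp_mem hq.mem).2
    have h2 := (rollThreshold_spec hq.mem.1.1 hq.mem.1.2).1
    linarith
  set e := amp q.1 q.2 ^ β with he
  have he0 : 0 < e := Real.rpow_pos_of_pos hε β
  have hη := hq.radius_pos
  -- No sign of K is assumed and the function vanishes off s, so the nonnegative constant max K 0 is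
  -- used for the global bound.
  refine multBound_of_mode (measurable_farWeight τ q) hq.farWeight_le (b := c * e) (K := max K 0)
    (k := k) (η := amp q.1 q.2 ^ τ) (V := K + K / c) (A₁ := 100) ?_ (by positivity) ?_ hη
    (fun κ hκ => hq.farWeight_le_of_near_int k κ hκ) ?_ ?_ ?_
  · exact (Continuous.aestronglyMeasurable (by fun_prop)).indicator hs
  · intro x
    by_cases hx : x ∈ s
    · rw [indicator_of_mem hx, norm_mul, Complex.norm_exp_ofReal_mul_I, mul_one, Complex.norm_real]
      refine (hb _ (hse x hx)).trans ?_
      rw [abs_mul, abs_of_pos he0, show -c * (e * |x|) = -(c * e) * |x| by ring]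
      exact mul_le_mul_of_nonneg_right (le_max_left _ _) (exp_pos _).le
    · rw [indicator_of_notMem hx, norm_zero]
      have := le_max_right K 0
      positivity
  · intro κ
    have h := hI (k - κ)
    rw [abs_sub_comm] at h
    refine le_trans (le_of_eq ?_) h
    congr 2
    rw [← integral_indicator hs]
    refine integral_congr_ae (Eventually.of_forall fun x => ?_)
    by_cases hx : x ∈ s
    · simp only [indicator_of_mem hx]
      rw [mul_assoc, ← Complex.exp_add]
      congr 2; push_cast; ring
    · simp only [indicator_of_notMem hx, zero_mul]
  · unfold profileConst; positivity
  · have hK : (max K 0) ^ 2 ≤ K ^ 2 := by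
      rcases le_total K 0 with h | h
      · rw [max_eq_right h, zero_pow two_ne_zero]; exact sq_nonneg K
      · rw [max_eq_left h]
    unfold profileConst
    rw [div_pow (√_) (√_), Real.sq_sqrt (by positivity), Real.sq_sqrt he0.le]
    -- This is where 5τ ≤ β enters: the tail 1/η⁵ is dominated by the mass 1/e. The numbers in
    -- `profileConst` are 70000 = 7·100² and 4375 = 7·25².
    have h5 : e ≤ (amp q.1 q.2 ^ τ) ^ 5 := by
      rw [he, ← Real.rpow_natCast, ← Real.rpow_mul hε.le]
      exact Real.rpow_le_rpow_of_exponent_ge hε hε1 (by push_cast; linarith)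
    set η := amp q.1 q.2 ^ τ
    have e1 : 7 * (25 / η ^ 2) ^ 2 * (K + K / c) ^ 2 / η = 4375 * (K + K / c) ^ 2 / η ^ 5 := by
      field_simp; ring
    have e2 : 7 * (100 : ℝ) ^ 2 * ((max K 0) ^ 2 / (c * e)) = 70000 * ((max K 0) ^ 2 / c) / e := by
      field_simp; ring
    rw [e1, e2, add_div]
    gcongr

theorem Admissible.multBound_Ioi {τ β c K : ℝ} {q : ℝ × ℝ} (hq : Admissible τ q) (hτ : 5 * τ ≤ β)
    (hc : 0 < c) {G : ℝ → ℝ} (hG : IsProfile (Ici 0) c K G) (k : ℤ) :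
    MultBound (farWeight τ q) ((Ioi 0).indicator fun x => (G (amp q.1 q.2 ^ β * x) : ℂ)
      * Complex.exp ((k * x : ℝ) * Complex.I)) (profileConst c K / √(amp q.1 q.2 ^ β)) := by
  have he0 : 0 < amp q.1 q.2 ^ β := Real.rpow_pos_of_pos (amp_pos hq.mem) β
  refine hq.multBound_indicator hτ hc hG.contDiff.continuous measurableSet_Ioi
    (fun x hx => mul_pos he0 hx) (fun x hx => hG.bound x (mem_Ici.mpr (le_of_lt hx))) (fun θ => ?_) k
  exact abs_mul_norm_integral_Ioi_le hG.hasDerivAt hG.continuous_deriv hc hG.bound hG.deriv_bound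
    he0 θ

theorem Admissible.multBound_Iic {τ β c K : ℝ} {q : ℝ × ℝ} (hq : Admissible τ q) (hτ : 5 * τ ≤ β)
    (hc : 0 < c) {G : ℝ → ℝ} (hG : IsProfile (Iic 0) c K G) (k : ℤ) :
    MultBound (farWeight τ q) ((Iic 0).indicator fun x => (G (amp q.1 q.2 ^ β * x) : ℂ)
      * Complex.exp ((k * x : ℝ) * Complex.I)) (profileConst c K / √(amp q.1 q.2 ^ β)) := by
  have he0 : 0 < amp q.1 q.2 ^ β := Real.rpow_pos_of_pos (amp_pos hq.mem) β
  refine hq.multBound_indicator hτ hc hG.contDiff.continuous measurableSet_Iic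
    (fun x hx => mul_nonpos_of_nonneg_of_nonpos he0.le hx) hG.bound (fun θ => ?_) k
  exact abs_mul_norm_integral_Iic_le hG.hasDerivAt hG.continuous_deriv hc hG.bound hG.deriv_bound
    he0 θ

/-- A profile with decay on both half lines. -/
theorem Admissible.multBound_line {τ β c K : ℝ} {q : ℝ × ℝ} (hq : Admissible τ q) (hτ : 5 * τ ≤ β)
    (hc : 0 < c) {G : ℝ → ℝ} (hG : IsProfile univ c K G) (k : ℤ) :
    MultBound (farWeight τ q) (fun x => (G (amp q.1 q.2 ^ β * x) : ℂ)
      * Complex.exp ((k * x : ℝ) * Complex.I)) (2 * profileConst c K / √(amp q.1 q.2 ^ β)) := by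
  have h1 := hq.multBound_Ioi hτ hc (G := G) ⟨hG.contDiff, fun x _ => hG.bound x trivial,
    fun x _ => hG.deriv_bound x trivial⟩ k
  have h2 := hq.multBound_Iic hτ hc (G := G) ⟨hG.contDiff, fun x _ => hG.bound x trivial,
    fun x _ => hG.deriv_bound x trivial⟩ k
  have h3 := h1.add (measurable_farWeight τ q) hq.farWeight_le h2
  rw [← add_div, ← two_mul] at h3
  convert h3 using 2 with x
  rcases le_or_gt x 0 with hx | hx
  · rw [indicator_of_notMem (by simpa using hx), indicator_of_mem (by exact hx), zero_add]
  · rw [indicator_of_mem (by exact hx), indicator_of_notMem (by simpa using hx), add_zero]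

/-! ### The three phases that occur in the nonlinearity -/

/-- The phase γ enters only through the unimodular constants e^{±ikγ}, so the bound is uniform in γ.
-/
theorem multBound_mul_cos {a : ℝ → ℝ} (ha : Measurable a) {A : ℝ} (hA : ∀ κ, |a κ| ≤ A)
    {g : ℝ → ℝ} {B : ℝ}
    (h : ∀ k : ℤ, MultBound a (fun x => (g x : ℂ) * Complex.exp ((k * x : ℝ) * Complex.I)) B)
    (γ : ℝ) (k : ℤ) : MultBound a (fun x => ((g x * cos (k * (x + γ)) : ℝ) : ℂ)) B := by
  have h1 := (h k).const_mul ha hA (Complex.exp ((k * γ : ℝ) * Complex.I) / 2)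
  have h2 := (h (-k)).const_mul ha hA (Complex.exp ((-(k * γ) : ℝ) * Complex.I) / 2)
  have h3 := h1.add ha hA h2
  have e : ∀ θ : ℝ, ‖Complex.exp ((θ : ℝ) * Complex.I) / 2‖ = 1 / 2 := fun θ => by
    rw [norm_div, Complex.norm_exp_ofReal_mul_I]; norm_num
  rw [e, e, show 1 / 2 * B + 1 / 2 * B = B by ring] at h3
  convert h3 using 2 with x
  push_cast
  rw [Complex.cos]
  rw [show (k : ℂ) * (x + γ) * Complex.I = (k * γ) * Complex.I + (k * x) * Complex.I by ring,
    show -((k : ℂ) * (x + γ)) * Complex.I = -(k * γ) * Complex.I + (-k * x) * Complex.I by ring,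
    Complex.exp_add, Complex.exp_add]
  ring

theorem multBound_mul_cos_one {a : ℝ → ℝ} (ha : Measurable a) {A : ℝ} (hA : ∀ κ, |a κ| ≤ A)
    {g : ℝ → ℝ} {B : ℝ}
    (h : ∀ k : ℤ, MultBound a (fun x => (g x : ℂ) * Complex.exp ((k * x : ℝ) * Complex.I)) B)
    (γ : ℝ) : MultBound a (fun x => ((g x * cos (x + γ) : ℝ) : ℂ)) B := by
  simpa using multBound_mul_cos ha hA h γ 1

theorem multBound_mul_sin {a : ℝ → ℝ} (ha : Measurable a) {A : ℝ} (hA : ∀ κ, |a κ| ≤ A)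
    {g : ℝ → ℝ} {B : ℝ}
    (h : ∀ k : ℤ, MultBound a (fun x => (g x : ℂ) * Complex.exp ((k * x : ℝ) * Complex.I)) B)
    (γ : ℝ) : MultBound a (fun x => ((g x * sin (x + γ) : ℝ) : ℂ)) B := by
  convert multBound_mul_cos_one ha hA h (γ - π / 2) using 4 with x
  rw [← add_sub_assoc, Real.cos_sub_pi_div_two]

theorem multBound_mul_cos_cube {a : ℝ → ℝ} (ha : Measurable a) {A : ℝ} (hA : ∀ κ, |a κ| ≤ A)
    {g : ℝ → ℝ} {B : ℝ}
    (h : ∀ k : ℤ, MultBound a (fun x => (g x : ℂ) * Complex.exp ((k * x : ℝ) * Complex.I)) B)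
    (γ : ℝ) : MultBound a (fun x => ((g x * cos (x + γ) ^ 3 : ℝ) : ℂ)) B := by
  have h1 := (multBound_mul_cos ha hA h γ 3).const_mul ha hA (1 / 4)
  have h2 := (multBound_mul_cos_one ha hA h γ).const_mul ha hA (3 / 4)
  have h3 := h1.add ha hA h2
  have e : ‖(1 / 4 : ℂ)‖ * B + ‖(3 / 4 : ℂ)‖ * B = B := by norm_num; ring
  rw [e] at h3
  convert h3 using 2 with x
  push_cast
  rw [Complex.cos_three_mul]
  ring

end

noncomputable section

/-! ### The residual of the far field -/

/-- Leibniz' rule: terms with E undifferentiated cancel, so every term carries a derivative of the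
slow envelope, and u is differentiated at most three times. -/
theorem shOp_mul_sub {E u : ℝ → ℝ} (hE : ContDiff ℝ 4 E) (hu : ContDiff ℝ 4 u) (ω x : ℝ) :
    shOp ω (fun y => E y * u y) x - E x * shOp ω u x =
      2 * ω ^ 2 * (2 * iteratedDeriv 1 E x * iteratedDeriv 1 u x + iteratedDeriv 2 E x * u x)
      + ω ^ 4 * (4 * iteratedDeriv 1 E x * iteratedDeriv 3 u x
        + 6 * iteratedDeriv 2 E x * iteratedDeriv 2 u x
        + 4 * iteratedDeriv 3 E x * iteratedDeriv 1 u x + iteratedDeriv 4 E x * u x) := by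
  have h2 := iteratedDeriv_mul (n := 2) (x := x) (f := E) (g := u)
    (hE.of_le (by norm_num)).contDiffAt (hu.of_le (by norm_num)).contDiffAt
  have h4 := iteratedDeriv_mul (n := 4) (x := x) (f := E) (g := u)
    hE.contDiffAt hu.contDiffAt
  have e : (fun y => E y * u y) = E * u := rfl
  rw [shOp, shOp, e, h2, h4]
  simp [Finset.sum_range_succ, Nat.choose]
  ring

theorem iteratedDeriv_cos_add {r : ℝ → ℝ} (hr : ContDiff ℝ 4 r) (a b x : ℝ) :
    iteratedDeriv 1 (fun y => a * cos y + b * r y) x = -a * sin x + b * deriv r x ∧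
    iteratedDeriv 2 (fun y => a * cos y + b * r y) x = -a * cos x + b * iteratedDeriv 2 r x ∧
    iteratedDeriv 3 (fun y => a * cos y + b * r y) x = a * sin x + b * iteratedDeriv 3 r x := by
  have h : ∀ n : ℕ, n ≤ 4 → iteratedDeriv n (fun y => a * cos y + b * r y) x
      = a * iteratedDeriv n cos x + b * iteratedDeriv n r x := by
    intro n hn
    have hr' : ContDiff ℝ n r := hr.of_le (by exact_mod_cast hn)
    have e : (fun y => a * cos y + b * r y) = (fun y => a * cos y) + fun y => b * r y := rfl
    rw [e, iteratedDeriv_add (contDiff_const.mul Real.contDiff_cos).contDiffAt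
      (contDiff_const.mul hr').contDiffAt, iteratedDeriv_const_mul_field, iteratedDeriv_const_mul_field]
  have c1 : iteratedDeriv 1 cos = fun x => -sin x := by ext; simp
  have c2 : iteratedDeriv 2 cos = fun x => -cos x := by
    rw [iteratedDeriv_succ, c1]; ext; simp
  have c3 : iteratedDeriv 3 cos = sin := by
    rw [iteratedDeriv_succ, c2]; ext; simp
  refine ⟨?_, ?_, ?_⟩
  · rw [h 1 (by norm_num), c1, iteratedDeriv_one]; ring
  · rw [h 2 (by norm_num), c2]; ring
  · rw [h 3 (by norm_num), c3]

theorem rollProfile_eq_fun {q : ℝ × ℝ} (hq : q ∈ rollSet) :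
    rollProfile q.1 (wavenumber q.1 q.2)
      = fun x => amp q.1 q.2 * cos x + q.1 ^ 3 * rollRem q x := funext (rollProfile_eq hq)

/-- A formula without iterated derivatives of products or of the roll. Measurability, continuity in
the parameters and the splitting of the residual are all read off from it. -/
theorem N4_eq {χ : ℝ → ℝ} (hχ : IsPartition χ) {q : ℝ × ℝ} (hq : q ∈ rollSet) {β γ x ε e ω u : ℝ}
    (hε : ε = amp q.1 q.2) (he : e = amp q.1 q.2 ^ β) (hω : ω = wavenumber q.1 q.2)
    (hu : u = ε * cos (x + γ) + q.1 ^ 3 * rollRem q (x + γ)) :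
    N4 χ β q.1 q.2 γ x = (χ (e * x) ^ 3 - χ (e * x)) * u ^ 3
      + (2 * ω ^ 2 * (2 * (e * iteratedDeriv 1 χ (e * x))
          * (-ε * sin (x + γ) + q.1 ^ 3 * deriv (rollRem q) (x + γ))
          + (e ^ 2 * iteratedDeriv 2 χ (e * x)) * u)
        + ω ^ 4 * (4 * (e * iteratedDeriv 1 χ (e * x))
            * (ε * sin (x + γ) + q.1 ^ 3 * iteratedDeriv 3 (rollRem q) (x + γ))
          + 6 * (e ^ 2 * iteratedDeriv 2 χ (e * x))
            * (-ε * cos (x + γ) + q.1 ^ 3 * iteratedDeriv 2 (rollRem q) (x + γ))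
          + 4 * (e ^ 3 * iteratedDeriv 3 χ (e * x))
            * (-ε * sin (x + γ) + q.1 ^ 3 * deriv (rollRem q) (x + γ))
          + (e ^ 4 * iteratedDeriv 4 χ (e * x)) * u))
      - q.1 ^ 2 * χ (e * x) * (mu x - 1) * u := by
  have hr := contDiff_rollRem hq
  have hχn : ∀ n : ℕ, ContDiff ℝ n χ := fun n => hχ.smooth.of_le (by exact_mod_cast le_top)
  have hχ4 : ContDiff ℝ 4 χ := by exact_mod_cast hχn 4
  have hE : ContDiff ℝ 4 (envelope χ β q.1 q.2) := by
    unfold envelope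
    exact hχ4.comp (contDiff_const.mul contDiff_id)
  have hroll : roll q.1 (wavenumber q.1 q.2) γ = fun x =>
      (fun y => amp q.1 q.2 * cos y + q.1 ^ 3 * rollRem q y) (x + γ) := by
    ext x; rw [roll, rollProfile_eq_fun hq]
  have hU : ContDiff ℝ 4 (fun y => amp q.1 q.2 * cos y + q.1 ^ 3 * rollRem q y) :=
    (contDiff_const.mul Real.contDiff_cos).add (contDiff_const.mul hr)
  have hR : ContDiff ℝ 4 (roll q.1 (wavenumber q.1 q.2) γ) := by
    rw [hroll]
    exact hU.comp (contDiff_id.add contDiff_const)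
  obtain ⟨d1, d2, d3⟩ := iteratedDeriv_cos_add hr (amp q.1 q.2) (q.1 ^ 3) (x + γ)
  have dE : ∀ n : ℕ, iteratedDeriv n (envelope χ β q.1 q.2) x
      = e ^ n * iteratedDeriv n χ (e * x) := fun n => by
    have := congrFun (iteratedDeriv_comp_const_mul (hχn n) (amp q.1 q.2 ^ β)) x
    rw [he]
    exact this
  have dR : ∀ n : ℕ, iteratedDeriv n (roll q.1 (wavenumber q.1 q.2) γ) x
      = iteratedDeriv n (fun y => amp q.1 q.2 * cos y + q.1 ^ 3 * rollRem q y) (x + γ) := fun n => by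
    rw [hroll]
    exact congrFun (iteratedDeriv_comp_add_const n
      (fun y => amp q.1 q.2 * cos y + q.1 ^ 3 * rollRem q y) γ) x
  have r0 : roll q.1 (wavenumber q.1 q.2) γ x = u := by rw [hroll, hu, hε]
  have E0 : envelope χ β q.1 q.2 x = χ (e * x) := by rw [he]; rfl
  have hff : farField χ β q.1 q.2 γ = fun y => envelope χ β q.1 q.2 y
      * roll q.1 (wavenumber q.1 q.2) γ y := rfl
  rw [N4, hff, shOp_mul_sub hE hR, dE, dE, dE, dE, dR, dR, dR, d1, d2, d3, r0, E0, ← hω, ← hε,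
    pow_one]
  ring

theorem measurable_mu : Measurable mu := by
  unfold mu
  exact Measurable.ite measurableSet_Iic measurable_const measurable_const

theorem continuous_rollRem_deriv_fixed {q : ℝ × ℝ} (hq : q ∈ rollSet) :
    Continuous (rollRem q) ∧ Continuous (deriv (rollRem q)) ∧
    Continuous (iteratedDeriv 2 (rollRem q)) ∧ Continuous (iteratedDeriv 3 (rollRem q)) := by
  have hr := contDiff_rollRem hq
  exact ⟨hr.continuous, hr.continuous_deriv (by norm_num),
    hr.continuous_iteratedDeriv 2 (by norm_num), hr.continuous_iteratedDeriv 3 (by norm_num)⟩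

theorem measurable_N4 {χ : ℝ → ℝ} (hχ : IsPartition χ) {q : ℝ × ℝ} (hq : q ∈ rollSet) (β γ : ℝ) :
    Measurable (N4 χ β q.1 q.2 γ) := by
  have h : N4 χ β q.1 q.2 γ = fun x => _ := funext fun x => N4_eq hχ hq rfl rfl rfl rfl
  rw [h]
  obtain ⟨h0, h1, h2, h3⟩ := continuous_rollRem_deriv_fixed hq
  have m0 := h0.measurable
  have m1 := h1.measurable
  have m2 := h2.measurable
  have m3 := h3.measurable
  have c0 := hχ.smooth.continuous.measurable
  have c1 := (hχ.continuous_iteratedDeriv 1).measurable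
  have c2 := (hχ.continuous_iteratedDeriv 2).measurable
  have c3 := (hχ.continuous_iteratedDeriv 3).measurable
  have c4 := (hχ.continuous_iteratedDeriv 4).measurable
  have mm := measurable_mu
  fun_prop

theorem continuous_N4_param {χ : ℝ → ℝ} (hχ : IsPartition χ) (β x : ℝ) :
    Continuous fun z : rollSet × ℝ => N4 χ β z.1.1.1 z.1.1.2 z.2 x := by
  have h : (fun z : rollSet × ℝ => N4 χ β z.1.1.1 z.1.1.2 z.2 x) = fun z => _ :=
    funext fun z => N4_eq hχ z.1.2 rfl rfl rfl rfl
  rw [h]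
  obtain ⟨h0, h1, h2, h3⟩ := continuous_rollRem_derivs
  have hs : Continuous fun z : rollSet × ℝ => (z.1, x + z.2) := by fun_prop
  have m0 := h0.comp hs
  have m1 := h1.comp hs
  have m2 := h2.comp hs
  have m3 := h3.comp hs
  simp only [Function.comp_def] at m0 m1 m2 m3
  have ca : Continuous fun z : rollSet × ℝ => amp z.1.1.1 z.1.1.2 :=
    continuous_amp.comp continuous_fst
  have ce : Continuous fun z : rollSet × ℝ => amp z.1.1.1 z.1.1.2 ^ β :=
    ca.rpow_const fun z => Or.inl (amp_pos z.1.2).ne'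
  have cw : Continuous fun z : rollSet × ℝ => wavenumber z.1.1.1 z.1.1.2 :=
    (continuous_wavenumber.comp continuous_subtype_val).comp continuous_fst
  have c0 := hχ.smooth.continuous
  have c1 := hχ.continuous_iteratedDeriv 1
  have c2 := hχ.continuous_iteratedDeriv 2
  have c3 := hχ.continuous_iteratedDeriv 3
  have c4 := hχ.continuous_iteratedDeriv 4
  fun_prop

/-! ### Leading part and remainder of the residual -/

/-- The leading part of the residual, a combination of slowly modulated harmonics. -/
def mainN4 (χ : ℝ → ℝ) (β : ℝ) (q : ℝ × ℝ) (γ x : ℝ) : ℝ :=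
  amp q.1 q.2 ^ 3 * ((χ (amp q.1 q.2 ^ β * x) ^ 3 - χ (amp q.1 q.2 ^ β * x)) * cos (x + γ) ^ 3)
  + (-4 * wavenumber q.1 q.2 ^ 2 * (1 - wavenumber q.1 q.2 ^ 2) * amp q.1 q.2 * amp q.1 q.2 ^ β)
    * (iteratedDeriv 1 χ (amp q.1 q.2 ^ β * x) * sin (x + γ))
  + ((2 * wavenumber q.1 q.2 ^ 2 - 6 * wavenumber q.1 q.2 ^ 4) * amp q.1 q.2
      * (amp q.1 q.2 ^ β) ^ 2) * (iteratedDeriv 2 χ (amp q.1 q.2 ^ β * x) * cos (x + γ))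
  + (2 * q.1 ^ 2 * amp q.1 q.2)
    * ((Ioi (0 : ℝ)).indicator (fun x => χ (amp q.1 q.2 ^ β * x)) x * cos (x + γ))

theorem PartitionBound.abs_apply_le {χ : ℝ → ℝ} {c K : ℝ} (h : PartitionBound χ c K) (x : ℝ) :
    |χ x| ≤ 1 + K := by
  have hexp : exp (-c * |x|) ≤ 1 := Real.exp_le_one_iff.mpr (by
    have := h.rate_pos; have := abs_nonneg x; nlinarith)
  have hK := h.one_le
  have hKe : K * exp (-c * |x|) ≤ K := mul_le_of_le_one_right (by linarith) hexp
  rcases le_total 0 x with hx | hx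
  · linarith [h.right x hx]
  · have := h.left x hx
    have e : χ x = (χ x - 1) + 1 := by ring
    rw [e]
    refine (abs_add_le _ _).trans ?_
    rw [abs_one]; linarith

/-- The decay constant of `χ³ - χ`. -/
def cubicConst (K : ℝ) : ℝ := (3 * (1 + K) ^ 2 + 1) * K

/-- The cubic vanishes at both limits of the partition function: the factor χ decays on the right
and χ - 1 on the left. -/
theorem PartitionBound.abs_cubic_le {χ : ℝ → ℝ} {c K : ℝ} (h : PartitionBound χ c K) (x : ℝ) :
    |χ x ^ 3 - χ x| ≤ cubicConst K * exp (-c * |x|) := by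
  have hK := h.one_le
  have ha := h.abs_apply_le x
  have he := exp_pos (-c * |x|)
  rcases le_total 0 x with hx | hx
  · have e : χ x ^ 3 - χ x = (χ x ^ 2 - 1) * χ x := by ring
    rw [e, abs_mul, cubicConst, mul_assoc]
    refine mul_le_mul ?_ (h.right x hx) (abs_nonneg _) (by positivity)
    have h2 : χ x ^ 2 ≤ (1 + K) ^ 2 := by rw [← sq_abs]; exact pow_le_pow_left₀ (abs_nonneg _) ha 2
    rw [abs_le]; constructor <;> nlinarith [sq_nonneg (χ x)]
  · have e : χ x ^ 3 - χ x = (χ x ^ 2 + χ x) * (χ x - 1) := by ring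
    rw [e, abs_mul, cubicConst, mul_assoc]
    refine mul_le_mul ?_ (h.left x hx) (abs_nonneg _) (by positivity)
    have h2 : χ x ^ 2 ≤ (1 + K) ^ 2 := by rw [← sq_abs]; exact pow_le_pow_left₀ (abs_nonneg _) ha 2
    have h3 := abs_le.mp ha
    rw [abs_le]; constructor <;> nlinarith [sq_nonneg (χ x)]

theorem PartitionBound.isProfile_cubic {χ : ℝ → ℝ} (hχ : IsPartition χ) {c K : ℝ}
    (h : PartitionBound χ c K) :
    IsProfile univ c (cubicConst K) fun x => χ x ^ 3 - χ x := by
  have hs : ContDiff ℝ 1 χ := hχ.smooth.of_le (by exact_mod_cast le_top)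
  refine ⟨(hs.pow 3).sub hs, fun x _ => h.abs_cubic_le x, fun x _ => ?_⟩
  have hd : HasDerivAt χ (deriv χ x) x :=
    (hs.differentiable (by norm_num)).differentiableAt.hasDerivAt
  have hdd : HasDerivAt (fun x => χ x ^ 3 - χ x) _ x := (hd.pow 3).sub hd
  rw [hdd.deriv]
  have e : ((3 : ℕ) : ℝ) * χ x ^ (3 - 1) * deriv χ x - deriv χ x
      = (3 * χ x ^ 2 - 1) * deriv χ x := by norm_num; ring
  have h1 := h.deriv_le 1 le_rfl (by norm_num) x
  rw [iteratedDeriv_one] at h1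
  have hK := h.one_le
  have ha := h.abs_apply_le x
  rw [e, abs_mul, cubicConst, mul_assoc]
  refine mul_le_mul ?_ h1 (abs_nonneg _) (by positivity)
  have h2 : χ x ^ 2 ≤ (1 + K) ^ 2 := by rw [← sq_abs]; exact pow_le_pow_left₀ (abs_nonneg _) ha 2
  rw [abs_le]; constructor <;> nlinarith [sq_nonneg (χ x)]

theorem PartitionBound.isProfile_iteratedDeriv {χ : ℝ → ℝ} (hχ : IsPartition χ) {c K : ℝ}
    (h : PartitionBound χ c K) {j : ℕ} (h1 : 1 ≤ j) (h3 : j ≤ 3) :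
    IsProfile univ c K (iteratedDeriv j χ) := by
  refine ⟨?_, fun x _ => h.deriv_le j h1 (by omega) x, fun x _ => ?_⟩
  · have hs : ContDiff ℝ (1 + j : ℕ) χ := hχ.smooth.of_le (by exact_mod_cast le_top)
    rw [iteratedDeriv_eq_iterate]
    exact ContDiff.iterate_deriv' 1 j (by exact_mod_cast hs)
  · rw [← iteratedDeriv_succ]
    exact h.deriv_le (j + 1) (by omega) (by omega) x

theorem PartitionBound.isProfile_right {χ : ℝ → ℝ} (hχ : IsPartition χ) {c K : ℝ}
    (h : PartitionBound χ c K) : IsProfile (Ici 0) c K χ := by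
  have hs : ContDiff ℝ 1 χ := hχ.smooth.of_le (by exact_mod_cast le_top)
  refine ⟨hs, h.right, fun x _ => ?_⟩
  rw [← iteratedDeriv_one]
  exact h.deriv_le 1 le_rfl (by norm_num) x

end

/-! ### Size of the residual: leading part and remainder. -/

noncomputable section

theorem amp_le_one {q : ℝ × ℝ} (hq : q ∈ rollSet) : amp q.1 q.2 ≤ 1 := by
  have h1 := (amp_mem hq).2
  have h2 := (rollThreshold_spec hq.1.1 hq.1.2).1
  linarith

theorem abs_wavenumber_sq_sub_one_le {q : ℝ × ℝ} (hq : q ∈ rollSet) :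
    |wavenumber q.1 q.2 ^ 2 - 1| ≤ amp q.1 q.2 / 3 := by
  have hδ := hq.1.1
  rw [wavenumber_sq hδ (rollThreshold_spec hδ hq.1.2).1 hq.2, add_sub_cancel_left, abs_mul,
    abs_of_pos hδ]
  have hO : |q.2| ≤ 1 / 3 := abs_le.mpr ⟨by linarith [hq.2.1], by linarith [hq.2.2]⟩
  have := (amp_mem hq).1
  nlinarith

theorem wavenumber_sq_le {q : ℝ × ℝ} (hq : q ∈ rollSet) : wavenumber q.1 q.2 ^ 2 ≤ 4 / 3 := by
  have h := abs_le.mp (abs_wavenumber_sq_sub_one_le hq)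
  have := amp_le_one hq
  linarith

/-- The terms with one derivative on the envelope and three or one on ε cos x combine to 4ω⁴ - 4ω²,
which vanishes at ω = 1. The cancellation gains a factor ε, as needed for the exponent 2 + β/2. -/
theorem abs_slope_coeff_le {q : ℝ × ℝ} (hq : q ∈ rollSet) :
    |-4 * wavenumber q.1 q.2 ^ 2 * (1 - wavenumber q.1 q.2 ^ 2)| ≤ 2 * amp q.1 q.2 := by
  have h := abs_wavenumber_sq_sub_one_le hq
  have h2 := wavenumber_sq_le hq
  have h1 : |-4 * wavenumber q.1 q.2 ^ 2| ≤ 16 / 3 := by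
    rw [abs_mul, abs_of_nonneg (sq_nonneg (wavenumber _ _))]; norm_num; linarith
  rw [abs_sub_comm] at h
  have := abs_mul_le_of h1 h
  have hε := amp_pos hq
  linarith

theorem abs_curvature_coeff_le {q : ℝ × ℝ} (hq : q ∈ rollSet) :
    |2 * wavenumber q.1 q.2 ^ 2 - 6 * wavenumber q.1 q.2 ^ 4| ≤ 10 := by
  have h2 := wavenumber_sq_le hq
  have h0 := sq_nonneg (wavenumber q.1 q.2)
  have e : wavenumber q.1 q.2 ^ 4 = (wavenumber q.1 q.2 ^ 2) ^ 2 := by ring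
  rw [e, abs_le]
  constructor <;> nlinarith

/-- The size of the residual. -/
def residualSize (β : ℝ) (q : ℝ × ℝ) : ℝ :=
  amp q.1 q.2 ^ 3 + amp q.1 q.2 * (amp q.1 q.2 ^ β) ^ 2 + amp q.1 q.2 ^ 2 * amp q.1 q.2 ^ β

/-- Three terms have profiles decaying on the whole line. The term from μ lives on x > 0, where μ -
1 = -2, and uses the half-line estimate, since χ itself decays only there. -/
theorem multBound_mainN4 {χ : ℝ → ℝ} (hχ : IsPartition χ) {c K : ℝ} (hK : PartitionBound χ c K)
    {τ β : ℝ} {q : ℝ × ℝ} (hq : Admissible τ q) (hτ : 5 * τ ≤ β) (γ : ℝ) :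
    MultBound (farWeight τ q) (fun x => (mainN4 χ β q γ x : ℂ))
      (20 * (profileConst c (cubicConst K) + profileConst c K) / √(amp q.1 q.2 ^ β)
        * residualSize β q) := by
  have hm := measurable_farWeight τ q
  have hA := hq.farWeight_le
  have hε := amp_pos hq.mem
  have hε1 := amp_le_one hq.mem
  have t1 := (multBound_mul_cos_cube hm hA (hq.multBound_line hτ hK.rate_pos
    (hK.isProfile_cubic hχ)) γ).const_mul hm hA ((amp q.1 q.2 ^ 3 : ℝ) : ℂ)
  have t2 := (multBound_mul_sin hm hA (hq.multBound_line hτ hK.rate_pos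
    (hK.isProfile_iteratedDeriv hχ le_rfl (by norm_num))) γ).const_mul hm hA
    ((-4 * wavenumber q.1 q.2 ^ 2 * (1 - wavenumber q.1 q.2 ^ 2) * amp q.1 q.2
      * amp q.1 q.2 ^ β : ℝ) : ℂ)
  have t3 := (multBound_mul_cos_one hm hA (hq.multBound_line hτ hK.rate_pos
    (hK.isProfile_iteratedDeriv hχ (j := 2) (by norm_num) (by norm_num))) γ).const_mul hm hA
    (((2 * wavenumber q.1 q.2 ^ 2 - 6 * wavenumber q.1 q.2 ^ 4) * amp q.1 q.2
      * (amp q.1 q.2 ^ β) ^ 2 : ℝ) : ℂ)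
  have t4 := (multBound_mul_cos_one hm hA
    (g := (Ioi (0 : ℝ)).indicator (fun x => χ (amp q.1 q.2 ^ β * x)))
    (B := profileConst c K / √(amp q.1 q.2 ^ β)) (fun k => by
      convert hq.multBound_Ioi hτ hK.rate_pos (hK.isProfile_right hχ) k using 2 with x
      by_cases hx : x ∈ Ioi (0 : ℝ)
      · simp only [indicator_of_mem hx]
      · simp only [indicator_of_notMem hx]; simp) γ).const_mul hm hA
    ((2 * q.1 ^ 2 * amp q.1 q.2 : ℝ) : ℂ)
  have h := ((t1.add hm hA t2).add hm hA t3).add hm hA t4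
  refine (congrArg (fun f => MultBound _ f _) (funext fun x => ?_)).mpr (h.mono ?_)
  · simp only [mainN4, Complex.ofReal_add, Complex.ofReal_mul]
  have he0 : 0 < amp q.1 q.2 ^ β := Real.rpow_pos_of_pos hε β
  have hn : ∀ r : ℝ, ‖(r : ℂ)‖ = |r| := fun r => by rw [Complex.norm_real, Real.norm_eq_abs]
  simp only [hn]
  have hδ := hq.mem.1.1
  have hδε := (amp_mem hq.mem).1
  have s1 := abs_slope_coeff_le hq.mem
  have s2 := abs_curvature_coeff_le hq.mem
  rw [residualSize]
  set ε := amp q.1 q.2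
  set e := ε ^ β
  have c1 : |ε ^ 3| = ε ^ 3 := abs_of_pos (by positivity)
  have c2 : |-4 * wavenumber q.1 q.2 ^ 2 * (1 - wavenumber q.1 q.2 ^ 2) * ε * e|
      ≤ 2 * (ε ^ 2 * e) := by
    rw [abs_mul, abs_mul, abs_of_pos hε, abs_of_pos he0]
    have := mul_le_mul_of_nonneg_right s1 (mul_pos hε he0).le
    nlinarith
  have c3 : |(2 * wavenumber q.1 q.2 ^ 2 - 6 * wavenumber q.1 q.2 ^ 4) * ε * e ^ 2|
      ≤ 10 * (ε * e ^ 2) := by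
    rw [abs_mul, abs_mul, abs_of_pos hε, abs_of_pos (pow_pos he0 2), mul_assoc]
    exact mul_le_mul_of_nonneg_right s2 (by positivity)
  have c4 : |2 * q.1 ^ 2 * ε| ≤ 2 * ε ^ 3 := by
    rw [abs_of_pos (by positivity)]
    have : q.1 ^ 2 ≤ ε ^ 2 := pow_le_pow_left₀ hδ.le hδε 2
    nlinarith
  have P1 : 0 ≤ profileConst c (cubicConst K) / √e := by unfold profileConst; positivity
  have P2 : 0 ≤ profileConst c K / √e := by unfold profileConst; positivity
  set p1 := profileConst c (cubicConst K) / √e with hp1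
  set p2 := profileConst c K / √e with hp2
  have r1 : 2 * profileConst c (cubicConst K) / √e = 2 * p1 := by rw [hp1]; ring
  have r2 : 2 * profileConst c K / √e = 2 * p2 := by rw [hp2]; ring
  have r3 : 20 * (profileConst c (cubicConst K) + profileConst c K) / √e = 20 * (p1 + p2) := by
    rw [hp1, hp2]; ring
  rw [r1, r2, r3, c1]
  have q2 := mul_le_mul_of_nonneg_right c2 (by positivity : 0 ≤ 2 * p2)
  have q3 := mul_le_mul_of_nonneg_right c3 (by positivity : 0 ≤ 2 * p2)
  have q4 := mul_le_mul_of_nonneg_right c4 P2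
  have z1 : 0 ≤ p1 * ε ^ 3 := by positivity
  have z2 : 0 ≤ p1 * (ε * e ^ 2) := by positivity
  have z3 : 0 ≤ p1 * (ε ^ 2 * e) := by positivity
  have z4 : 0 ≤ p2 * ε ^ 3 := by positivity
  have z5 : 0 ≤ p2 * (ε * e ^ 2) := by positivity
  have z6 : 0 ≤ p2 * (ε ^ 2 * e) := by positivity
  nlinarith

/-- The size of the remainder of the residual. -/
def restSize (β : ℝ) (q : ℝ × ℝ) : ℝ :=
  amp q.1 q.2 ^ 5 + amp q.1 q.2 ^ 3 * amp q.1 q.2 ^ β + amp q.1 q.2 * (amp q.1 q.2 ^ β) ^ 3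

-- What is left contains either δ³ `rollRem` or at least three derivatives of the envelope: the
-- cubic and μ terms give ε⁵, the commutator with `rollRem` gives ε³ε^β, and the third and fourth
-- envelope derivatives give ε·ε^{3β}.
set_option maxHeartbeats 1000000 in
theorem exists_bound_rest {χ : ℝ → ℝ} (hχ : IsPartition χ) {c K : ℝ} (hK : PartitionBound χ c K)
    {β : ℝ} (hβ : 0 ≤ β) : ∃ M ≥ 0, ∀ q ∈ rollSet, ∀ γ x, |N4 χ β q.1 q.2 γ x - mainN4 χ β q γ x|
      ≤ M * restSize β q * exp (-(c * amp q.1 q.2 ^ β) * |x|) := by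
  obtain ⟨C, hC, hrem⟩ := exists_bound_rollRem
  have hK1 := hK.one_le
  have hcc : 0 ≤ cubicConst K := by unfold cubicConst; positivity
  -- The four summands cover, in order, the cubic term, the μ term, the commutator terms with
  -- `rollRem`, and those with third or fourth derivatives of the envelope.
  refine ⟨cubicConst K * (3 * (1 + C) ^ 2 * C) + 2 * K * C + 40 * K * C + 10 * K * (1 + C),
    by positivity, fun q hq γ x => ?_⟩
  have hε := amp_pos hq
  have hε1 := amp_le_one hq
  have hδ := hq.1.1
  have hδε := (amp_mem hq).1
  have hw := wavenumber_sq_le hq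
  have e4 : wavenumber q.1 q.2 ^ 4 = (wavenumber q.1 q.2 ^ 2) ^ 2 := by ring
  rw [N4_eq hχ hq rfl rfl rfl rfl, mainN4, restSize, e4]
  obtain ⟨r0, r1, r2, r3⟩ := hrem q hq (x + γ)
  have he0 : 0 < amp q.1 q.2 ^ β := Real.rpow_pos_of_pos hε β
  have he1 : amp q.1 q.2 ^ β ≤ 1 := Real.rpow_le_one hε.le hε1 hβ
  set ε := amp q.1 q.2
  set e := ε ^ β
  have hX : exp (-c * |e * x|) = exp (-(c * e) * |x|) := by
    rw [abs_mul, abs_of_pos he0]; congr 1; ring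
  have b0 := hK.abs_cubic_le (e * x)
  have b1 := hK.deriv_le 1 (by norm_num) (by norm_num) (e * x)
  have b2 := hK.deriv_le 2 (by norm_num) (by norm_num) (e * x)
  have b3 := hK.deriv_le 3 (by norm_num) (by norm_num) (e * x)
  have b4 := hK.deriv_le 4 (by norm_num) (by norm_num) (e * x)
  rw [hX] at b0 b1 b2 b3 b4
  have bμ : |χ (e * x) * (mu x - 1)| ≤ 2 * K * exp (-(c * e) * |x|) := by
    rw [mu]
    split_ifs with h0
    · simp; positivity
    · have := hK.right (e * x) (by have := not_le.mp h0; positivity)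
      rw [hX] at this
      rw [abs_mul, show |(-1 : ℝ) - 1| = 2 by norm_num]; linarith
  have hind : (Ioi (0 : ℝ)).indicator (fun x => χ (e * x)) x
      = -(χ (e * x) * (mu x - 1)) / 2 := by
    rw [mu]
    split_ifs with h0
    · rw [indicator_of_notMem (by simpa using h0)]; simp
    · rw [indicator_of_mem (by simpa using h0)]; ring
  rw [hind]
  set X := exp (-(c * e) * |x|)
  have hX0 : 0 < X := exp_pos _
  set ω2 := wavenumber q.1 q.2 ^ 2
  have hω0 : 0 ≤ ω2 := sq_nonneg _
  set ρ0 := rollRem q (x + γ)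
  set ρ1 := deriv (rollRem q) (x + γ)
  set ρ2 := iteratedDeriv 2 (rollRem q) (x + γ)
  set ρ3 := iteratedDeriv 3 (rollRem q) (x + γ)
  set χ0 := χ (e * x)
  set χ1 := iteratedDeriv 1 χ (e * x)
  set χ2 := iteratedDeriv 2 χ (e * x)
  set χ3 := iteratedDeriv 3 χ (e * x)
  set χ4 := iteratedDeriv 4 χ (e * x)
  set σ := mu x - 1
  set co := cos (x + γ)
  set si := sin (x + γ)
  have hco : |co| ≤ 1 := abs_cos_le_one _
  have hsi : |si| ≤ 1 := abs_sin_le_one _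
  clear_value co si σ X ω2 ρ0 ρ1 ρ2 ρ3 χ0 χ1 χ2 χ3 χ4 e ε
  have hd3 : |q.1 ^ 3| ≤ ε ^ 3 := by
    rw [abs_of_pos (by positivity)]; exact pow_le_pow_left₀ hδ.le hδε 3
  have hd2 : |q.1 ^ 2| ≤ ε ^ 2 := by
    rw [abs_of_pos (by positivity)]; exact pow_le_pow_left₀ hδ.le hδε 2
  have hε3 : ε ^ 3 ≤ ε := pow_le_of_le_one hε.le hε1 (by norm_num)
  have d0 := abs_mul_le_of hd3 r0
  have d1 := abs_mul_le_of hd3 r1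
  have d2 := abs_mul_le_of hd3 r2
  have d3 := abs_mul_le_of hd3 r3
  have hCε : ε ^ 3 * C ≤ ε * C := mul_le_mul_of_nonneg_right hε3 hC
  have hc : |ε * co| ≤ ε := by
    rw [abs_mul, abs_of_pos hε]; exact mul_le_of_le_one_right hε.le hco
  have hs : |-ε * si| ≤ ε := by
    rw [abs_mul, abs_neg, abs_of_pos hε]; exact mul_le_of_le_one_right hε.le hsi
  have hu0 : |ε * co + q.1 ^ 3 * ρ0| ≤ ε * (1 + C) :=
    (abs_add_le _ _).trans (by linarith)
  have hu1 : |-ε * si + q.1 ^ 3 * ρ1| ≤ ε * (1 + C) :=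
    (abs_add_le _ _).trans (by linarith)
  set u0 := ε * co + q.1 ^ 3 * ρ0 with hu0d
  set u1 := -ε * si + q.1 ^ 3 * ρ1 with hu1d
  have cube : |u0 ^ 3 - (ε * co) ^ 3| ≤ 3 * (ε * (1 + C)) ^ 2 * (ε ^ 3 * C) := by
    refine (abs_cube_sub_cube_le hu0 (hc.trans (by nlinarith))).trans ?_
    have : u0 - ε * co = q.1 ^ 3 * ρ0 := by rw [hu0d]; ring
    rw [this]
    exact mul_le_mul_of_nonneg_left d0 (by positivity)
  have aω : |ω2| ≤ 4 / 3 := by rw [abs_of_nonneg hω0]; exact hw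
  have aω2 : |ω2 ^ 2| ≤ 2 := by rw [abs_of_nonneg (by positivity)]; nlinarith
  have ae1 : |e| ≤ e := (abs_of_pos he0).le
  have ae2 : |e ^ 2| ≤ e := by
    rw [abs_of_pos (by positivity)]; exact pow_le_of_le_one he0.le he1 (by norm_num)
  have ae3 : |e ^ 3| ≤ e ^ 3 := (abs_of_pos (by positivity)).le
  have ae4 : |e ^ 4| ≤ e ^ 3 := by
    rw [abs_of_pos (by positivity)]; exact pow_le_pow_of_le_one he0.le he1 (by norm_num)
  have T1 := abs_mul_le_of b0 cube
  have T2 := abs_mul_le_of aω (abs_mul_le_of (abs_mul_le_of ae1 b1) d1)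
  have T3 := abs_mul_le_of aω (abs_mul_le_of (abs_mul_le_of ae2 b2) d0)
  have T4 := abs_mul_le_of aω2 (abs_mul_le_of (abs_mul_le_of ae1 b1) d3)
  have T5 := abs_mul_le_of aω2 (abs_mul_le_of (abs_mul_le_of ae2 b2) d2)
  have T6 := abs_mul_le_of aω2 (abs_mul_le_of (abs_mul_le_of ae3 b3) hu1)
  have T7 := abs_mul_le_of aω2 (abs_mul_le_of (abs_mul_le_of ae4 b4) hu0)
  have T8 := abs_mul_le_of hd2 (abs_mul_le_of bμ d0)
  -- The multiplicities are those of the commutator: 2·2 and 2 from the second-order part, then 4,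
  -- 6, 4, 1 from the fourth-order part.
  have key : ∀ t1 t2 t3 t4 t5 t6 t7 t8 : ℝ,
      |t1 + 4 * t2 + 2 * t3 + 4 * t4 + 6 * t5 + 4 * t6 + t7 - t8|
      ≤ |t1| + 4 * |t2| + 2 * |t3| + 4 * |t4| + 6 * |t5| + 4 * |t6| + |t7| + |t8| := by
    intro t1 t2 t3 t4 t5 t6 t7 t8
    rw [abs_le]
    constructor <;>
    linarith [le_abs_self t1, le_abs_self t2, le_abs_self t3, le_abs_self t4, le_abs_self t5,
      le_abs_self t6, le_abs_self t7, le_abs_self t8, neg_abs_le t1, neg_abs_le t2, neg_abs_le t3,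
      neg_abs_le t4, neg_abs_le t5, neg_abs_le t6, neg_abs_le t7, neg_abs_le t8]
  refine le_trans (le_of_eq ?_) ((key ((χ0 ^ 3 - χ0) * (u0 ^ 3 - (ε * co) ^ 3))
    (ω2 * (e * χ1 * (q.1 ^ 3 * ρ1))) (ω2 * (e ^ 2 * χ2 * (q.1 ^ 3 * ρ0)))
    (ω2 ^ 2 * (e * χ1 * (q.1 ^ 3 * ρ3))) (ω2 ^ 2 * (e ^ 2 * χ2 * (q.1 ^ 3 * ρ2)))
    (ω2 ^ 2 * (e ^ 3 * χ3 * u1)) (ω2 ^ 2 * (e ^ 4 * χ4 * u0))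
    (q.1 ^ 2 * (χ0 * σ * (q.1 ^ 3 * ρ0)))).trans ?_)
  · congr 1
    rw [hu0d, hu1d]; ring
  have z1 : 0 ≤ ε ^ 3 * e * X * K * C := by positivity
  have z2 : 0 ≤ ε * e ^ 3 * X * K * (1 + C) := by positivity
  have z3 : 0 ≤ ε ^ 5 * X * K * C := by positivity
  have z4 : 0 ≤ ε ^ 5 * X * K * (1 + C) := by positivity
  have z5 : 0 ≤ ε ^ 3 * e * X * K * (1 + C) := by positivity
  have z6 : 0 ≤ ε * e ^ 3 * X * K * C := by positivity
  have z7 : 0 ≤ ε ^ 3 * e * X * (cubicConst K * (3 * (1 + C) ^ 2 * C)) := by positivity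
  have z8 : 0 ≤ ε * e ^ 3 * X * (cubicConst K * (3 * (1 + C) ^ 2 * C)) := by positivity
  have total := add_le_add (add_le_add (add_le_add (add_le_add (add_le_add (add_le_add
    (add_le_add T1 (mul_le_mul_of_nonneg_left T2 (by norm_num : (0 : ℝ) ≤ 4)))
    (mul_le_mul_of_nonneg_left T3 (by norm_num : (0 : ℝ) ≤ 2)))
    (mul_le_mul_of_nonneg_left T4 (by norm_num : (0 : ℝ) ≤ 4)))
    (mul_le_mul_of_nonneg_left T5 (by norm_num : (0 : ℝ) ≤ 6)))
    (mul_le_mul_of_nonneg_left T6 (by norm_num : (0 : ℝ) ≤ 4))) T7) T8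
  refine total.trans ?_
  rw [← sub_nonneg]
  ring_nf
  ring_nf at z1 z2 z3 z4 z5 z6 z7 z8
  linarith

end

/-! ### The residual in powers of the amplitude. -/

noncomputable section

theorem sqrt_amp_rpow {q : ℝ × ℝ} (hq : q ∈ rollSet) (β : ℝ) :
    √(amp q.1 q.2 ^ β) = amp q.1 q.2 ^ (β / 2) := by
  rw [Real.sqrt_eq_rpow, ← Real.rpow_mul (amp_pos hq).le]
  congr 1; ring

/-- The division by the square root is the L² norm of a profile of length ε^{-β}; it produces the
three exponents of the proposition. -/
theorem residualSize_div_sqrt {q : ℝ × ℝ} (hq : q ∈ rollSet) (β : ℝ) :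
    residualSize β q / √(amp q.1 q.2 ^ β) = amp q.1 q.2 ^ (3 - β / 2)
      + amp q.1 q.2 ^ (1 + 3 * β / 2) + amp q.1 q.2 ^ (2 + β / 2) := by
  have hε := amp_pos hq
  rw [sqrt_amp_rpow hq, residualSize]
  have e1 : amp q.1 q.2 ^ β = (amp q.1 q.2 ^ (β / 2)) ^ 2 := by
    rw [← Real.rpow_natCast, ← Real.rpow_mul hε.le]; congr 1; push_cast; ring
  have e2 : amp q.1 q.2 ^ (3 - β / 2) = amp q.1 q.2 ^ 3 / amp q.1 q.2 ^ (β / 2) := by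
    rw [Real.rpow_sub hε]; norm_cast
  have e3 : amp q.1 q.2 ^ (1 + 3 * β / 2) = amp q.1 q.2 * (amp q.1 q.2 ^ (β / 2)) ^ 3 := by
    rw [Real.rpow_add hε, Real.rpow_one, ← Real.rpow_natCast (amp q.1 q.2 ^ (β / 2)),
      ← Real.rpow_mul hε.le]
    congr 2; push_cast; ring
  have e4 : amp q.1 q.2 ^ (2 + β / 2) = amp q.1 q.2 ^ 2 * amp q.1 q.2 ^ (β / 2) := by
    rw [Real.rpow_add hε]; norm_cast
  rw [e1, e2, e3, e4]
  have : 0 < amp q.1 q.2 ^ (β / 2) := Real.rpow_pos_of_pos hε _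
  field_simp

theorem amp_rpow_le {q : ℝ × ℝ} (hq : q ∈ rollSet) {a b : ℝ} (h : b ≤ a) :
    amp q.1 q.2 ^ a ≤ amp q.1 q.2 ^ b :=
  Real.rpow_le_rpow_of_exponent_ge (amp_pos hq) (amp_le_one hq) h

theorem amp_rpow_le_amp {q : ℝ × ℝ} (hq : q ∈ rollSet) {a : ℝ} (h : 1 ≤ a) :
    amp q.1 q.2 ^ a ≤ amp q.1 q.2 := by
  simpa using amp_rpow_le hq h

theorem amp_le_radius_sq {q : ℝ × ℝ} (hq : q ∈ rollSet) {τ : ℝ} (hτ : 2 * τ ≤ 1) :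
    amp q.1 q.2 ≤ (amp q.1 q.2 ^ τ) ^ 2 := by
  rw [← Real.rpow_natCast, ← Real.rpow_mul (amp_pos hq).le]
  simpa using amp_rpow_le hq (a := 1) (b := τ * (2 : ℕ)) (by push_cast; linarith)

/-- Each term of the remainder is at most ε times a term of `residualSize`, using ε^β ≤ ε for the
last one; and ε ≤ η² because 2τ ≤ 1. -/
theorem restSize_div_le {q : ℝ × ℝ} (hq : q ∈ rollSet) {τ β : ℝ} (hτ : 2 * τ ≤ 1) (hβ : 1 ≤ β) :
    restSize β q / (amp q.1 q.2 ^ τ) ^ 2 ≤ residualSize β q := by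
  have hε := amp_pos hq
  have hε1 := amp_le_one hq
  have h1 := amp_le_radius_sq hq hτ
  have h2 := amp_rpow_le_amp hq hβ
  have he : 0 < amp q.1 q.2 ^ β := Real.rpow_pos_of_pos hε β
  rw [div_le_iff₀ (hε.trans_le h1), restSize, residualSize]
  set ε := amp q.1 q.2
  set e := ε ^ β
  refine le_trans ?_ (mul_le_mul_of_nonneg_left h1 (by positivity))
  have a1 : ε ^ 5 ≤ ε ^ 3 * ε := by
    rw [← pow_succ]; exact pow_le_pow_of_le_one hε.le hε1 (by norm_num)
  have a2 : ε * e ^ 3 ≤ ε * e ^ 2 * ε := by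
    rw [pow_succ e 2, ← mul_assoc]
    exact mul_le_mul_of_nonneg_left h2 (by positivity)
  nlinarith

/-- The localised estimate handles the leading part without loss; the remainder can afford the full
multiplier norm, with 75 = 3·25. -/
theorem exists_multBound_N4 {χ : ℝ → ℝ} (hχ : IsPartition χ) {τ β : ℝ} (hτ₂ : 2 * τ ≤ 1)
    (hτ₅ : 5 * τ ≤ β) (hβ : 1 ≤ β) : ∃ C ≥ 0, ∀ q, Admissible τ q → ∀ γ,
      MultBound (farWeight τ q) (fun x => (N4 χ β q.1 q.2 γ x : ℂ))
        (C * (amp q.1 q.2 ^ (3 - β / 2) + amp q.1 q.2 ^ (1 + 3 * β / 2)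
          + amp q.1 q.2 ^ (2 + β / 2))) := by
  obtain ⟨c, K, hK⟩ := hχ.exists_bound
  obtain ⟨M, hM, hrest⟩ := exists_bound_rest hχ hK (zero_le_one.trans hβ)
  have hc := hK.rate_pos
  refine ⟨20 * (profileConst c (cubicConst K) + profileConst c K) + 75 * M / √c,
    by unfold profileConst; positivity, fun q hq γ => ?_⟩
  have hm := measurable_farWeight τ q
  have hA := hq.farWeight_le
  have he : 0 < amp q.1 q.2 ^ β := Real.rpow_pos_of_pos (amp_pos hq.mem) β
  have hmain := multBound_mainN4 hχ hK hq hτ₅ γ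
  have hsize : 0 ≤ restSize β q := by
    have := amp_pos hq.mem
    unfold restSize; positivity
  have hmr : AEStronglyMeasurable
      (fun x => (N4 χ β q.1 q.2 γ x : ℂ) - (mainN4 χ β q γ x : ℂ)) volume :=
    ((Complex.measurable_ofReal.comp (measurable_N4 hχ hq.mem β γ)).aestronglyMeasurable).sub
      hmain.1.1
  have hr := multBound_of_exp_bound hm hA hmr (b := c * amp q.1 q.2 ^ β) (K := M * restSize β q)
    (by positivity) (by positivity) (fun x => by
      rw [← Complex.ofReal_sub, Complex.norm_real]
      exact hrest q hq.mem γ x)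
  have h := hmain.add hm hA hr
  simp only [add_sub_cancel] at h
  refine h.mono ?_
  rw [← residualSize_div_sqrt hq.mem, Real.sqrt_mul hc.le]
  have hs := restSize_div_le hq.mem hτ₂ hβ
  have hη := hq.radius_pos
  have hse : 0 < √(amp q.1 q.2 ^ β) := Real.sqrt_pos.mpr he
  have hsc : 0 < √c := Real.sqrt_pos.mpr hc
  have e1 : 3 * (25 / (amp q.1 q.2 ^ τ) ^ 2)
      * (M * restSize β q / (√c * √(amp q.1 q.2 ^ β)))
      = 75 * M / √c * (restSize β q / (amp q.1 q.2 ^ τ) ^ 2 / √(amp q.1 q.2 ^ β)) := by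
    field_simp; ring
  have e2 : 75 * M / √c * (restSize β q / (amp q.1 q.2 ^ τ) ^ 2 / √(amp q.1 q.2 ^ β))
      ≤ 75 * M / √c * (residualSize β q / √(amp q.1 q.2 ^ β)) := by gcongr
  rw [e1, add_mul]
  refine add_le_add (le_of_eq ?_) e2
  ring

/-- No smallness is claimed: this supplies square integrability and a dominating function when the
parameters vary. -/
theorem exists_exp_bound_N4 {χ : ℝ → ℝ} (hχ : IsPartition χ) {β : ℝ} (hβ : 0 ≤ β) :
    ∃ c > 0, ∃ M ≥ 0, ∀ q ∈ rollSet, ∀ γ x,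
      |N4 χ β q.1 q.2 γ x| ≤ M * exp (-(c * amp q.1 q.2 ^ β) * |x|) := by
  obtain ⟨c, K, hK⟩ := hχ.exists_bound
  obtain ⟨M, hM, hrest⟩ := exists_bound_rest hχ hK hβ
  have hK1 := hK.one_le
  have hcc : 0 ≤ cubicConst K := by unfold cubicConst; positivity
  refine ⟨c, hK.rate_pos, M * 3 + (cubicConst K + 2 * K + 10 * K + 2 * K), by positivity,
    fun q hq γ x => ?_⟩
  have h := hrest q hq γ x
  have hε := amp_pos hq
  have hε1 := amp_le_one hq
  have hδ := hq.1.1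
  have hδε := (amp_mem hq).1
  have he0 : 0 < amp q.1 q.2 ^ β := Real.rpow_pos_of_pos hε β
  have he1 : amp q.1 q.2 ^ β ≤ 1 := Real.rpow_le_one hε.le hε1 hβ
  have s1 := abs_slope_coeff_le hq
  have s2 := abs_curvature_coeff_le hq
  have hX : exp (-c * |amp q.1 q.2 ^ β * x|) = exp (-(c * amp q.1 q.2 ^ β) * |x|) := by
    rw [abs_mul, abs_of_pos he0]; congr 1; ring
  have b0 := hK.abs_cubic_le (amp q.1 q.2 ^ β * x)
  have b1 := hK.deriv_le 1 (by norm_num) (by norm_num) (amp q.1 q.2 ^ β * x)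
  have b2 := hK.deriv_le 2 (by norm_num) (by norm_num) (amp q.1 q.2 ^ β * x)
  have b3 : |(Ioi (0 : ℝ)).indicator (fun x => χ (amp q.1 q.2 ^ β * x)) x|
      ≤ K * exp (-c * |amp q.1 q.2 ^ β * x|) := by
    by_cases hx : x ∈ Ioi (0 : ℝ)
    · rw [indicator_of_mem hx]
      exact hK.right _ (mul_pos he0 hx).le
    · rw [indicator_of_notMem hx, abs_zero]; positivity
  rw [hX] at b0 b1 b2 b3
  set X := exp (-(c * amp q.1 q.2 ^ β) * |x|)
  have hX0 : 0 < X := exp_pos _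
  have hsize : restSize β q ≤ 3 := by
    have a1 : amp q.1 q.2 ^ 5 ≤ 1 := pow_le_one₀ hε.le hε1
    have a2 : amp q.1 q.2 ^ 3 ≤ 1 := pow_le_one₀ hε.le hε1
    have a3 : (amp q.1 q.2 ^ β) ^ 3 ≤ 1 := pow_le_one₀ he0.le he1
    have a4 := mul_le_one₀ a2 he0.le he1
    have a5 := mul_le_one₀ hε1 (by positivity) a3
    rw [restSize]; linarith
  have hr : M * restSize β q * X ≤ M * 3 * X := by gcongr
  have c0 : |amp q.1 q.2 ^ 3| ≤ 1 := by
    rw [abs_of_pos (by positivity)]; exact pow_le_one₀ hε.le hε1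
  have ce : |amp q.1 q.2 ^ β| ≤ 1 := by rwa [abs_of_pos he0]
  have ce2 : |(amp q.1 q.2 ^ β) ^ 2| ≤ 1 := by
    rw [abs_of_pos (by positivity)]; exact pow_le_one₀ he0.le he1
  have ca : |amp q.1 q.2| ≤ 1 := by rwa [abs_of_pos hε]
  have cc := abs_cos_le_one (x + γ)
  have cs := abs_sin_le_one (x + γ)
  have cc3 : |cos (x + γ) ^ 3| ≤ 1 := by rw [abs_pow]; exact pow_le_one₀ (abs_nonneg _) cc
  have cd : |2 * q.1 ^ 2| ≤ 2 := by
    rw [abs_of_pos (by positivity)]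
    have : q.1 ^ 2 ≤ 1 := pow_le_one₀ hδ.le (hδε.trans hε1)
    linarith
  have t1 := abs_mul_le_of c0 (abs_mul_le_of b0 cc3)
  have t2 := abs_mul_le_of (abs_mul_le_of (abs_mul_le_of (s1.trans (by linarith : _ ≤ (2 : ℝ))) ca)
    ce) (abs_mul_le_of b1 cs)
  have t3 := abs_mul_le_of (abs_mul_le_of (abs_mul_le_of s2 ca) ce2) (abs_mul_le_of b2 cc)
  have t4 := abs_mul_le_of (abs_mul_le_of cd ca) (abs_mul_le_of b3 cc)
  have hmain : |mainN4 χ β q γ x| ≤ (cubicConst K + 2 * K + 10 * K + 2 * K) * X := by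
    rw [mainN4]
    refine (abs_add_le _ _).trans ((add_le_add ((abs_add_le _ _).trans (add_le_add
      ((abs_add_le _ _).trans (add_le_add t1 t2)) t3)) t4).trans (le_of_eq ?_))
    ring
  have e : N4 χ β q.1 q.2 γ x = (N4 χ β q.1 q.2 γ x - mainN4 χ β q γ x) + mainN4 χ β q γ x := by
    ring
  rw [e]
  refine (abs_add_le _ _).trans ((add_le_add (h.trans hr) hmain).trans (le_of_eq ?_))
  ring

end

noncomputable section

/-! ### The nonlinearity as a map from `H⁴` to `L²` -/

theorem continuous_farField {χ : ℝ → ℝ} (hχ : IsPartition χ) (β : ℝ) {q : ℝ × ℝ} (hq : q ∈ rollSet)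
    (γ : ℝ) : Continuous (farField χ β q.1 q.2 γ) := by
  have h : farField χ β q.1 q.2 γ = fun x => χ (amp q.1 q.2 ^ β * x)
      * (amp q.1 q.2 * cos (x + γ) + q.1 ^ 3 * rollRem q (x + γ)) := by
    funext x
    rw [farField, roll, rollProfile_eq hq, envelope]
  rw [h]
  have := hχ.smooth.continuous
  have := (contDiff_rollRem hq).continuous
  fun_prop

theorem continuous_farField_param {χ : ℝ → ℝ} (hχ : IsPartition χ) (β x : ℝ) :
    Continuous fun z : rollSet × ℝ => farField χ β z.1.1.1 z.1.1.2 z.2 x := by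
  have h : (fun z : rollSet × ℝ => farField χ β z.1.1.1 z.1.1.2 z.2 x) = fun z =>
      χ (amp z.1.1.1 z.1.1.2 ^ β * x) * (amp z.1.1.1 z.1.1.2 * cos (x + z.2)
        + z.1.1.1 ^ 3 * rollRem z.1 (x + z.2)) := by
    funext z
    rw [farField, roll, rollProfile_eq z.1.2, envelope]
  rw [h]
  have hs : Continuous fun z : rollSet × ℝ => (z.1, x + z.2) := by fun_prop
  have m0 := continuous_rollRem_derivs.1.comp hs
  simp only [Function.comp_def] at m0
  have ca : Continuous fun z : rollSet × ℝ => amp z.1.1.1 z.1.1.2 :=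
    continuous_amp.comp continuous_fst
  have ce : Continuous fun z : rollSet × ℝ => amp z.1.1.1 z.1.1.2 ^ β :=
    ca.rpow_const fun z => Or.inl (amp_pos z.1.2).ne'
  have c0 := hχ.smooth.continuous
  fun_prop

theorem exists_bound_farField {χ : ℝ → ℝ} (hχ : IsPartition χ) (β : ℝ) :
    ∃ A ≥ 0, ∀ q ∈ rollSet, ∀ γ x, |farField χ β q.1 q.2 γ x| ≤ A * amp q.1 q.2 := by
  obtain ⟨C, hC, hrem⟩ := exists_bound_rollRem
  obtain ⟨c, K, hK⟩ := hχ.exists_bound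
  have hK1 := hK.one_le
  refine ⟨(1 + K) * (1 + C), by positivity, fun q hq γ x => ?_⟩
  have hε := amp_pos hq
  have hδ := hq.1.1
  rw [farField, roll, rollProfile_eq hq, envelope, mul_assoc]
  refine abs_mul_le_of (hK.abs_apply_le _) ((abs_add_le _ _).trans ?_)
  have h1 : |amp q.1 q.2 * cos (x + γ)| ≤ amp q.1 q.2 := by
    rw [abs_mul, abs_of_pos hε]; exact mul_le_of_le_one_right hε.le (abs_cos_le_one _)
  have h2 : |q.1 ^ 3| ≤ amp q.1 q.2 := by
    rw [abs_of_pos (by positivity)]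
    exact (pow_le_pow_left₀ hδ.le (amp_mem hq).1 3).trans
      (pow_le_of_le_one hε.le (amp_le_one hq) (by norm_num))
  have h3 := abs_mul_le_of h2 (hrem q hq (x + γ)).1
  linarith

theorem abs_mu (x : ℝ) : |mu x| = 1 := by
  rw [mu]; split_ifs <;> norm_num

/-- The residual cancels in the difference, and the rest is a polynomial in f with coefficients
O(ε²), O(ε) and 1, factored through f - g. The estimate is pointwise; r will come from the Sobolev
embedding. -/
theorem exists_lipschitz_nonlinearity {χ : ℝ → ℝ} (hχ : IsPartition χ) (β : ℝ) :
    ∃ D ≥ 1, ∀ q ∈ rollSet, ∀ (γ x r : ℝ) (f g : ℝ → ℂ), ‖f x‖ ≤ r → ‖g x‖ ≤ r →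
      ‖nonlinearity χ β q.1 q.2 γ f x - nonlinearity χ β q.1 q.2 γ g x‖
        ≤ D * (amp q.1 q.2 ^ 2 + amp q.1 q.2 * r + r ^ 2) * ‖f x - g x‖ := by
  obtain ⟨A, hA, hF⟩ := exists_bound_farField hχ β
  refine ⟨1 + 3 * A ^ 2 + 6 * A + 3, by nlinarith, fun q hq γ x r f g hf hg => ?_⟩
  have hF := hF q hq γ x
  have hε := amp_pos hq
  have hδ := hq.1.1
  have hδε := (amp_mem hq).1
  have hr : 0 ≤ r := (norm_nonneg _).trans hf
  have hmu := abs_mu x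
  simp only [nonlinearity, N1, N2, N3]
  set F := farField χ β q.1 q.2 γ x
  set ε := amp q.1 q.2
  have e : -((q.1 ^ 2 * mu x - 3 * F ^ 2 : ℝ) : ℂ) * f x + ((3 * F : ℝ) : ℂ) * f x ^ 2 + f x ^ 3
      + (N4 χ β q.1 q.2 γ x : ℂ) - (-((q.1 ^ 2 * mu x - 3 * F ^ 2 : ℝ) : ℂ) * g x
        + ((3 * F : ℝ) : ℂ) * g x ^ 2 + g x ^ 3 + (N4 χ β q.1 q.2 γ x : ℂ))
      = (-((q.1 ^ 2 * mu x - 3 * F ^ 2 : ℝ) : ℂ) + ((3 * F : ℝ) : ℂ) * (f x + g x)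
        + (f x * f x + f x * g x + g x * g x)) * (f x - g x) := by ring
  rw [e, norm_mul]
  refine mul_le_mul_of_nonneg_right ?_ (norm_nonneg _)
  have b1 : ‖-((q.1 ^ 2 * mu x - 3 * F ^ 2 : ℝ) : ℂ)‖ ≤ ε ^ 2 + 3 * (A * ε) ^ 2 := by
    rw [norm_neg, Complex.norm_real, Real.norm_eq_abs]
    refine (abs_sub _ _).trans (add_le_add ?_ ?_)
    · rw [abs_mul, hmu, mul_one, abs_of_pos (by positivity)]
      exact pow_le_pow_left₀ hδ.le hδε 2
    · rw [abs_mul, abs_of_pos (by norm_num : (0 : ℝ) < 3), abs_pow]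
      gcongr
  have b2 : ‖((3 * F : ℝ) : ℂ) * (f x + g x)‖ ≤ 3 * (A * ε) * (r + r) := by
    rw [norm_mul, Complex.norm_real, norm_mul, Real.norm_of_nonneg (by norm_num : (0 : ℝ) ≤ 3),
      Real.norm_eq_abs]
    gcongr
    exact (norm_add_le _ _).trans (add_le_add hf hg)
  have b3 : ‖f x * f x + f x * g x + g x * g x‖ ≤ r * r + r * r + r * r := by
    refine (norm_add₃_le).trans ?_
    rw [norm_mul, norm_mul, norm_mul]
    gcongr
  refine (norm_add₃_le).trans ((add_le_add (add_le_add b1 b2) b3).trans ?_)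
  have z1 : 0 ≤ ε * r := by positivity
  have z2 : 0 ≤ A * (ε * r) := by positivity
  have z3 : 0 ≤ A ^ 2 * (ε * r) := by positivity
  have z4 : 0 ≤ A * ε ^ 2 := by positivity
  have z5 : 0 ≤ A * r ^ 2 := by positivity
  have z6 : 0 ≤ A ^ 2 * r ^ 2 := by positivity
  have z7 : 0 ≤ ε ^ 2 := by positivity
  have z8 : 0 ≤ r ^ 2 := by positivity
  nlinarith

theorem nonlinearity_zero (χ : ℝ → ℝ) (β δ Ω γ : ℝ) :
    nonlinearity χ β δ Ω γ 0 = fun x => (N4 χ β δ Ω γ x : ℂ) := by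
  funext x; simp [nonlinearity, N1, N2, N3]

theorem memLp_N4 {χ : ℝ → ℝ} (hχ : IsPartition χ) {β : ℝ} (hβ : 0 ≤ β) {q : ℝ × ℝ}
    (hq : q ∈ rollSet) (γ : ℝ) : MemLp (fun x => (N4 χ β q.1 q.2 γ x : ℂ)) 2 volume := by
  obtain ⟨c, hc, M, hM, h⟩ := exists_exp_bound_N4 hχ hβ
  have he : 0 < amp q.1 q.2 ^ β := Real.rpow_pos_of_pos (amp_pos hq) β
  refine memLp_of_exp_bound (Complex.measurable_ofReal.comp
    (measurable_N4 hχ hq β γ)).aestronglyMeasurable (b := c * amp q.1 q.2 ^ β) (K := M)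
    (by positivity) fun x => ?_
  rw [Complex.norm_real]
  exact h q hq γ x

theorem aestronglyMeasurable_nonlinearity {χ : ℝ → ℝ} (hχ : IsPartition χ) (β : ℝ) {q : ℝ × ℝ}
    (hq : q ∈ rollSet) (γ : ℝ) {f : ℝ → ℂ} (hf : AEStronglyMeasurable f volume) :
    AEStronglyMeasurable (nonlinearity χ β q.1 q.2 γ f) volume := by
  have hF := (continuous_farField hχ β hq γ).measurable
  have h4 := measurable_N4 hχ hq β γ
  have hmu := measurable_mu
  have m1 : Measurable fun x => -((q.1 ^ 2 * mu x - 3 * farField χ β q.1 q.2 γ x ^ 2 : ℝ) : ℂ) := by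
    fun_prop
  have m2 : Measurable fun x => ((3 * farField χ β q.1 q.2 γ x : ℝ) : ℂ) := by fun_prop
  have m4 : Measurable fun x => (N4 χ β q.1 q.2 γ x : ℂ) := by fun_prop
  exact (((m1.aestronglyMeasurable.mul hf).add (m2.aestronglyMeasurable.mul (hf.pow 2))).add
    (hf.pow 3)).add m4.aestronglyMeasurable

theorem memLp_nonlinearity {χ : ℝ → ℝ} (hχ : IsPartition χ) {β : ℝ} (hβ : 0 ≤ β) {q : ℝ × ℝ}
    (hq : q ∈ rollSet) (γ : ℝ) (v : H4) :
    MemLp (nonlinearity χ β q.1 q.2 γ (v.toL2 : ℝ → ℂ)) 2 volume := by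
  obtain ⟨D, -, hD⟩ := exists_lipschitz_nonlinearity hχ β
  have hm := aestronglyMeasurable_nonlinearity hχ β hq γ (Lp.aestronglyMeasurable v.toL2)
  have h4 := memLp_N4 hχ hβ hq γ
  have hd : MemLp (fun x => nonlinearity χ β q.1 q.2 γ (v.toL2 : ℝ → ℂ) x
      - (N4 χ β q.1 q.2 γ x : ℂ)) 2 volume := by
    refine memLp_of_le_mul (hm.sub h4.1) (Lp.memLp v.toL2)
      (C := D * (amp q.1 q.2 ^ 2 + amp q.1 q.2 * ‖v‖ + ‖v‖ ^ 2)) ?_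
    filter_upwards [v.norm_apply_le] with x hx
    have := hD q hq γ x ‖v‖ v.toL2 0 hx (by simp)
    rw [nonlinearity_zero] at this
    simpa using this
  have := hd.add h4
  refine this.ae_eq (Eventually.of_forall fun x => ?_)
  simp

open Classical in
/-- The nonlinearity as an element of `L²`. -/
def nonlinL2 (χ : ℝ → ℝ) (β : ℝ) (q : ℝ × ℝ) (γ : ℝ) (v : H4) : L2 :=
  if h : MemLp (nonlinearity χ β q.1 q.2 γ (v.toL2 : ℝ → ℂ)) 2 volume then h.toLp _ else 0

theorem nonlinL2_eq {χ : ℝ → ℝ} {β : ℝ} {q : ℝ × ℝ} {γ : ℝ} {v : H4}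
    (h : MemLp (nonlinearity χ β q.1 q.2 γ (v.toL2 : ℝ → ℂ)) 2 volume) :
    nonlinL2 χ β q γ v = h.toLp _ := dif_pos h

theorem coe_nonlinL2 {χ : ℝ → ℝ} {β : ℝ} {q : ℝ × ℝ} {γ : ℝ} {v : H4}
    (h : MemLp (nonlinearity χ β q.1 q.2 γ (v.toL2 : ℝ → ℂ)) 2 volume) :
    nonlinL2 χ β q γ v =ᵐ[volume] nonlinearity χ β q.1 q.2 γ (v.toL2 : ℝ → ℂ) := by
  rw [nonlinL2_eq h]; exact h.coeFn_toLp

theorem exists_lipschitz_nonlinL2 {χ : ℝ → ℝ} (hχ : IsPartition χ) {β : ℝ} (hβ : 0 ≤ β) :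
    ∃ D ≥ 1, ∀ q ∈ rollSet, ∀ (γ r : ℝ) (v w : H4), ‖v‖ ≤ r → ‖w‖ ≤ r →
      ‖nonlinL2 χ β q γ v - nonlinL2 χ β q γ w‖
        ≤ D * (amp q.1 q.2 ^ 2 + amp q.1 q.2 * r + r ^ 2) * ‖v - w‖ := by
  obtain ⟨D, hD1, hD⟩ := exists_lipschitz_nonlinearity hχ β
  refine ⟨D, hD1, fun q hq γ r v w hv hw => ?_⟩
  have hr : 0 ≤ r := (norm_nonneg _).trans hv
  have hε := amp_pos hq
  have h1 := memLp_nonlinearity hχ hβ hq γ v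
  have h2 := memLp_nonlinearity hχ hβ hq γ w
  rw [nonlinL2_eq h1, nonlinL2_eq h2, ← MemLp.toLp_sub]
  have h3 : ‖(h1.sub h2).toLp _‖ ≤ D * (amp q.1 q.2 ^ 2 + amp q.1 q.2 * r + r ^ 2)
      * ‖(v - w).toL2‖ := by
    refine norm_toLp_le_mul (h1.sub h2) (by positivity) ?_
    filter_upwards [v.norm_apply_le, w.norm_apply_le, Lp.coeFn_sub v.toL2 w.toL2] with x a b c
    rw [H4.toL2_sub, c]
    exact hD q hq γ x r v.toL2 w.toL2 (a.trans hv) (b.trans hw)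
  exact h3.trans (mul_le_mul_of_nonneg_left (H4.norm_toL2_le _) (by positivity))

/-- The right hand side of the fixed point equation, as a map on `H⁴`. -/
def farMap (χ : ℝ → ℝ) (β τ : ℝ) (q : ℝ × ℝ) (γ : ℝ) (v : H4) : H4 :=
  multH4 (farWeight τ q) (nonlinL2 χ β q γ v)

theorem weighted_farMap {χ : ℝ → ℝ} {β τ : ℝ} {q : ℝ × ℝ} (hq : Admissible τ q) (γ : ℝ) (v : H4) :
    weighted (farMap χ β τ q γ v).toL2
      =ᵐ[volume] fun κ => (farWeight τ q κ : ℂ) * hat (nonlinL2 χ β q γ v) κ :=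
  weighted_multH4 (measurable_farWeight τ q) hq.farWeight_le _

/-- The two formulations differ by the nowhere vanishing weight (1 + κ²)² on the Fourier side. -/
theorem isFarFixedPoint_iff {χ : ℝ → ℝ} (hχ : IsPartition χ) {β τ : ℝ} (hβ : 0 ≤ β) {q : ℝ × ℝ}
    (hq : Admissible τ q) (γ : ℝ) (v w : H4) :
    IsFarFixedPoint χ β q.1 q.2 γ τ v w ↔ farMap χ β τ q γ (v + w) = w := by
  have hm := memLp_nonlinearity hχ hβ hq.mem γ (v + w)
  have hw := weighted_farMap (χ := χ) (β := β) hq γ (v + w)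
  rw [nonlinL2_eq hm] at hw
  have key : ∀ κ : ℝ, ((farWeight τ q κ : ℝ) : ℂ) * hat (hm.toLp _) κ
      = (((1 + κ ^ 2) ^ 2 : ℝ) : ℂ) * (open Classical in if κ ∈ nearFreq (amp q.1 q.2 ^ τ) then 0
        else ((1 / symbol q.1 q.2 κ : ℝ) : ℂ) * hat (hm.toLp _) κ) := by
    intro κ
    rw [farWeight]
    split_ifs with h
    · simp
    · push_cast; ring
  constructor
  · rintro ⟨_, h⟩
    refine H4.ext_weighted (hw.trans ?_)
    filter_upwards [h] with κ hκ
    rw [key, weighted, hκ]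
  · intro h
    refine ⟨hm, ?_⟩
    rw [h] at hw
    filter_upwards [hw] with κ hκ
    have hne : (((1 + κ ^ 2) ^ 2 : ℝ) : ℂ) ≠ 0 := by
      exact_mod_cast (by positivity : ((1 + κ ^ 2) ^ 2 : ℝ) ≠ 0)
    rw [key, weighted] at hκ
    exact mul_left_cancel₀ hne hκ

theorem IsFarFixedPoint.mem_Xfar {χ : ℝ → ℝ} {β δ Ω γ τ : ℝ} {v w : H4}
    (h : IsFarFixedPoint χ β δ Ω γ τ v w) : w ∈ Xfar (amp δ Ω ^ τ) := by
  obtain ⟨_, h⟩ := h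
  filter_upwards [h] with κ hκ hmem
  rw [hκ, if_pos hmem]

theorem exists_lipschitz_farMap {χ : ℝ → ℝ} (hχ : IsPartition χ) {β : ℝ} (hβ : 0 ≤ β) (τ : ℝ) :
    ∃ D ≥ 1, ∀ q, Admissible τ q → ∀ (γ r : ℝ) (v w : H4), ‖v‖ ≤ r → ‖w‖ ≤ r →
      ‖farMap χ β τ q γ v - farMap χ β τ q γ w‖
        ≤ D * (amp q.1 q.2 ^ 2 + amp q.1 q.2 * r + r ^ 2) / (amp q.1 q.2 ^ τ) ^ 2 * ‖v - w‖ := by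
  obtain ⟨D, hD1, hD⟩ := exists_lipschitz_nonlinL2 hχ hβ
  refine ⟨75 * D, by linarith, fun q hq γ r v w hv hw => ?_⟩
  have hη := hq.radius_pos
  rw [farMap, farMap, multH4_sub (measurable_farWeight τ q) hq.farWeight_le]
  refine (norm_multH4_le (measurable_farWeight τ q) hq.farWeight_le _).trans ?_
  refine (mul_le_mul_of_nonneg_left (hD q hq.mem γ r v w hv hw) (by positivity)).trans
    (le_of_eq ?_)
  ring

theorem exists_bound_farMap_zero {χ : ℝ → ℝ} (hχ : IsPartition χ) {τ β : ℝ} (hτ₂ : 2 * τ ≤ 1)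
    (hτ₅ : 5 * τ ≤ β) (hβ : 1 ≤ β) : ∃ C ≥ 0, ∀ q, Admissible τ q → ∀ γ,
      ‖farMap χ β τ q γ 0‖ ≤ C * (amp q.1 q.2 ^ (3 - β / 2) + amp q.1 q.2 ^ (1 + 3 * β / 2)
          + amp q.1 q.2 ^ (2 + β / 2)) := by
  obtain ⟨C, hC, h⟩ := exists_multBound_N4 hχ hτ₂ hτ₅ hβ
  refine ⟨C, hC, fun q hq γ => ?_⟩
  obtain ⟨hm, hn⟩ := h q hq γ
  refine le_trans (le_of_eq ?_) hn
  have h0 := memLp_nonlinearity hχ (zero_le_one.trans hβ) hq.mem γ 0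
  rw [farMap, nonlinL2_eq h0]
  congr 2
  refine MemLp.toLp_congr _ _ ?_
  have hz : ((0 : H4).toL2 : ℝ → ℂ) =ᵐ[volume] 0 := Lp.coeFn_zero ℂ 2 volume
  filter_upwards [hz] with x hx
  rw [← congrFun (nonlinearity_zero χ β q.1 q.2 γ) x]
  simp only [nonlinearity, N1, N2, N3, hx, Pi.zero_apply]

/-! ### Continuity with respect to the parameters -/

/-- For fixed v this is dominated convergence: the part depending on v is bounded by a multiple of
|v|, the residual by an exponential. -/
theorem tendsto_nonlinL2 {χ : ℝ → ℝ} (hχ : IsPartition χ) {β : ℝ} (hβ : 0 ≤ β) {ι : Type*}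
    {l : Filter ι} [l.IsCountablyGenerated] {q : ι → rollSet} {q₀ : rollSet} {γ : ι → ℝ} {γ₀ : ℝ}
    (hq : Tendsto q l (𝓝 q₀)) (hγ : Tendsto γ l (𝓝 γ₀)) (v : H4) :
    Tendsto (fun i => nonlinL2 χ β (q i) (γ i) v) l (𝓝 (nonlinL2 χ β q₀ γ₀ v)) := by
  obtain ⟨D, hD1, hD⟩ := exists_lipschitz_nonlinearity hχ β
  obtain ⟨c, hc, M, hM, hN⟩ := exists_exp_bound_N4 hχ hβ
  have hm := fun i => memLp_nonlinearity hχ hβ (q i).2 (γ i) v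
  have hm₀ := memLp_nonlinearity hχ hβ q₀.2 γ₀ v
  have e : (fun i => nonlinL2 χ β (q i) (γ i) v) = fun i => (hm i).toLp _ :=
    funext fun i => nonlinL2_eq (hm i)
  rw [e, nonlinL2_eq hm₀]
  have hz : Tendsto (fun i => (q i, γ i)) l (𝓝 (q₀, γ₀)) := hq.prodMk_nhds hγ
  set e₀ := amp q₀.1.1 q₀.1.2 ^ β with he₀
  have he₀pos : 0 < e₀ := Real.rpow_pos_of_pos (amp_pos q₀.2) β
  have he : Tendsto (fun i => amp (q i).1.1 (q i).1.2 ^ β) l (𝓝 e₀) :=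
    ((continuous_amp.tendsto q₀).comp hq).rpow_const (Or.inl (amp_pos q₀.2).ne')
  refine tendsto_toLp_of_dominated hm hm₀
    -- The decay rate of the residual depends on the parameters; near the limit it exceeds half the
    -- limiting rate.
    (G := fun x => D * (1 + ‖v‖ + ‖v‖ ^ 2) * ‖v.toL2 x‖ + M * exp (-(c * (e₀ / 2)) * |x|)) ?_ ?_ ?_
  · exact ((Lp.memLp v.toL2).norm.const_mul _).add
      ((memLp_exp_neg_mul_abs (by positivity)).const_mul M)
  · filter_upwards [he.eventually (lt_mem_nhds (half_lt_self he₀pos))] with i hi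
    filter_upwards [v.norm_apply_le] with x hx
    have h1 := hD _ (q i).2 (γ i) x ‖v‖ v.toL2 0 hx (by simp)
    rw [nonlinearity_zero] at h1
    have h2 := hN _ (q i).2 (γ i) x
    have hε := amp_pos (q i).2
    have hε1 := amp_le_one (q i).2
    have h3 : D * (amp (q i).1.1 (q i).1.2 ^ 2 + amp (q i).1.1 (q i).1.2 * ‖v‖ + ‖v‖ ^ 2)
        ≤ D * (1 + ‖v‖ + ‖v‖ ^ 2) := by
      have a1 : amp (q i).1.1 (q i).1.2 ^ 2 ≤ 1 := pow_le_one₀ hε.le hε1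
      have a2 : amp (q i).1.1 (q i).1.2 * ‖v‖ ≤ ‖v‖ :=
        mul_le_of_le_one_left (norm_nonneg _) hε1
      gcongr
    have h4 : M * exp (-(c * amp (q i).1.1 (q i).1.2 ^ β) * |x|)
        ≤ M * exp (-(c * (e₀ / 2)) * |x|) := by
      gcongr
    simp only [Pi.zero_apply, sub_zero] at h1
    set N := nonlinearity χ β (q i).1.1 (q i).1.2 (γ i) v.toL2 x
    set n4 := N4 χ β (q i).1.1 (q i).1.2 (γ i) x
    have h5 : ‖N‖ ≤ ‖N - (n4 : ℂ)‖ + |n4| := by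
      have := norm_add_le (N - (n4 : ℂ)) (n4 : ℂ)
      rwa [sub_add_cancel, Complex.norm_real, Real.norm_eq_abs] at this
    have h6 := mul_le_mul_of_nonneg_right h3 (norm_nonneg (v.toL2 x))
    linarith
  · refine Eventually.of_forall fun x => ?_
    have hF := ((continuous_farField_param hχ β x).tendsto (q₀, γ₀)).comp hz
    have h4 := ((continuous_N4_param hχ β x).tendsto (q₀, γ₀)).comp hz
    have hδ : Tendsto (fun i => (q i).1.1) l (𝓝 q₀.1.1) :=
      ((continuous_fst.comp continuous_subtype_val).tendsto q₀).comp hq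
    simp only [Function.comp_def] at hF h4
    have o := Complex.continuous_ofReal
    simp only [nonlinearity, N1, N2, N3]
    refine Tendsto.add (Tendsto.add (Tendsto.add ?_ ?_) tendsto_const_nhds) ?_
    · exact (((o.tendsto _).comp (((hδ.pow 2).mul_const _).sub ((hF.pow 2).const_mul 3))).neg).mul_const _
    · exact ((o.tendsto _).comp (hF.const_mul 3)).mul_const _
    · exact (o.tendsto _).comp h4

/-- The change of the nonlinearity is treated with the locally bounded multiplier norm, the change
of the multiplier by strong convergence at the limiting nonlinearity. -/
theorem tendsto_farMap {χ : ℝ → ℝ} (hχ : IsPartition χ) {β τ : ℝ} (hβ : 0 ≤ β) {ι : Type*}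
    {l : Filter ι} [l.IsCountablyGenerated] {q : ι → rollSet} {q₀ : rollSet} {γ : ι → ℝ} {γ₀ : ℝ}
    (hadm : ∀ i, Admissible τ (q i)) (hadm₀ : Admissible τ q₀)
    (hq : Tendsto q l (𝓝 q₀)) (hγ : Tendsto γ l (𝓝 γ₀)) (v : H4) :
    Tendsto (fun i => farMap χ β τ (q i) (γ i) v) l (𝓝 (farMap χ β τ q₀ γ₀ v)) := by
  set η₀ := amp q₀.1.1 q₀.1.2 ^ τ
  have hη₀ : 0 < η₀ := hadm₀.radius_pos
  have hη : Tendsto (fun i => amp (q i).1.1 (q i).1.2 ^ τ) l (𝓝 η₀) :=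
    ((continuous_amp.tendsto q₀).comp hq).rpow_const (Or.inl (amp_pos q₀.2).ne')
  have hA : Tendsto (fun i => 25 / (amp (q i).1.1 (q i).1.2 ^ τ) ^ 2) l (𝓝 (25 / η₀ ^ 2)) :=
    tendsto_const_nhds.div (hη.pow 2) (by positivity)
  have hAB : ∀ᶠ i in l, 25 / (amp (q i).1.1 (q i).1.2 ^ τ) ^ 2 ≤ 25 / η₀ ^ 2 + 1 :=
    (hA.eventually (gt_mem_nhds (lt_add_one _))).mono fun i hi => hi.le
  have h1 := tendsto_multH4 (l := l) (fun i => measurable_farWeight τ (q i))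
    (measurable_farWeight τ q₀) (fun i => (hadm i).farWeight_le) hadm₀.farWeight_le hAB
    (tendsto_farWeight hadm₀ hq) (nonlinL2 χ β q₀ γ₀ v)
  have h2 := (tendsto_iff_norm_sub_tendsto_zero.mp (tendsto_nonlinL2 hχ hβ hq hγ v)).const_mul
    (3 * (25 / η₀ ^ 2 + 1))
  rw [mul_zero] at h2
  have h3 : Tendsto (fun i => farMap χ β τ (q i) (γ i) v
      - multH4 (farWeight τ (q i)) (nonlinL2 χ β q₀ γ₀ v)) l (𝓝 0) := by
    refine squeeze_zero_norm' ?_ h2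
    filter_upwards [hAB] with i hi
    have hm := measurable_farWeight τ (q i)
    have hb := (hadm i).farWeight_le
    rw [farMap, multH4_sub hm hb]
    refine (norm_multH4_le hm hb _).trans ?_
    gcongr
  simpa [farMap] using h3.add h1

end

noncomputable section

open scoped ComplexConjugate

/-! ### Smallness of the parameters -/

theorem amp_mem_Ioo {q : ℝ × ℝ} (hq : q ∈ rollSet) {b : ℝ} (h : q.1 < b / 2) :
    amp q.1 q.2 ∈ Ioo 0 b := by
  have h1 := (amp_mem hq).2
  have h2 := hq.1.1
  exact ⟨amp_pos hq, by linarith⟩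

theorem eventually_rpow_le {a b : ℝ} (ha : 0 < a) (hb : 0 < b) :
    ∀ᶠ ε : ℝ in 𝓝[>] 0, ε ^ a ≤ b := by
  have h : Tendsto (fun ε : ℝ => ε ^ a) (𝓝[>] 0) (𝓝 (0 ^ a)) :=
    ((Real.continuousAt_rpow_const 0 a (Or.inr ha.le)).tendsto).mono_left nhdsWithin_le_nhds
  rw [Real.zero_rpow ha.ne'] at h
  exact (h.eventually (gt_mem_nhds hb)).mono fun ε hε => hε.le

/-- Parameters for which the fixed point map is a contraction of the far ball. -/
structure Contracting (χ : ℝ → ℝ) (R τ β : ℝ) (q : ℝ × ℝ) : Prop where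
  adm : Admissible τ q
  contract : ∀ (γ : ℝ) (v w : H4), ‖v‖ ≤ 4 * (R * amp q.1 q.2 ^ (1 / 16 : ℝ)) →
    ‖w‖ ≤ 4 * (R * amp q.1 q.2 ^ (1 / 16 : ℝ)) →
    ‖farMap χ β τ q γ v - farMap χ β τ q γ w‖ ≤ 1 / 2 * ‖v - w‖
  near_le : R * amp q.1 q.2 ^ (β / 2) ≤ R * amp q.1 q.2 ^ (1 / 16 : ℝ)
  mapsTo : ∀ (γ : ℝ) (v w : H4), ‖v‖ ≤ R * amp q.1 q.2 ^ (β / 2) →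
    ‖w‖ ≤ R * amp q.1 q.2 ^ (1 / 16 : ℝ) →
    ‖farMap χ β τ q γ (v + w)‖ ≤ R * amp q.1 q.2 ^ (1 / 16 : ℝ)

theorem exists_admissible_threshold {τ : ℝ} (hτ₀ : 0 < τ) (hτ₁ : τ < 1) :
    ∃ b > 0, ∀ q ∈ rollSet, amp q.1 q.2 < b → Admissible τ q := by
  have h := (eventually_rpow_le hτ₀ (by norm_num : (0 : ℝ) < 1 / 2)).and
    (eventually_rpow_le (sub_pos.mpr hτ₁) (by norm_num : (0 : ℝ) < 3 / 5))
  rw [eventually_nhdsWithin_iff, Metric.eventually_nhds_iff] at h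
  obtain ⟨b, hb, h⟩ := h
  refine ⟨b, hb, fun q hq hlt => ?_⟩
  have hε := amp_pos hq
  obtain ⟨h1, h2⟩ := h (by rwa [Real.dist_eq, sub_zero, abs_of_pos hε]) hε
  refine ⟨hq, h1, ?_⟩
  have e : amp q.1 q.2 = amp q.1 q.2 ^ τ * amp q.1 q.2 ^ (1 - τ) := by
    rw [← Real.rpow_add hε]; simp
  have h3 := mul_le_mul_of_nonneg_left h2 (Real.rpow_pos_of_pos hε τ).le
  rw [← e] at h3
  linarith [(amp_mem hq).1]

/-- The contraction holds on radius 4Rε^{1/16} although sums of near and far fields need only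
2Rε^{1/16}; the slack is used for continuity in the parameters. The self-map property compares with
the value at 0: half of ‖v‖ + ‖w‖ plus a residual O(ε^{1/2}), while the near field is also
O(ε^{1/2}). -/
theorem exists_contracting_threshold {χ : ℝ → ℝ} (hχ : IsPartition χ) {R τ β : ℝ} (hR : 0 < R)
    (hτ₀ : 0 < τ) (hτ₁ : τ < 1 / 16) (hβ₀ : 1 ≤ β) (hβ₁ : β ≤ 1 + τ) :
    ∃ b > 0, ∀ q ∈ rollSet, amp q.1 q.2 < b → Contracting χ R τ β q := by
  obtain ⟨b₀, hb₀, hadm⟩ := exists_admissible_threshold hτ₀ (by linarith)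
  obtain ⟨D, hD1, hD⟩ := exists_lipschitz_farMap hχ (zero_le_one.trans hβ₀) τ
  obtain ⟨C, hC, hN⟩ := exists_bound_farMap_zero hχ (τ := τ) (by linarith) (by linarith) hβ₀
  have hD0 : 0 < D := by linarith
  -- The exponent 1/8 - 2τ is the square of ε^{1/16} against the multiplier loss ε^{-2τ}; the
  -- exponent 7/16 is the gap between 1/2 and 1/16.
  have h := (eventually_rpow_le (a := 1 / 8 - 2 * τ) (b := 1 / (2 * (D * (1 + 4 * R + 16 * R ^ 2))))
    (by linarith) (by positivity)).and
    (eventually_rpow_le (a := 7 / 16) (b := R / (2 * R + 12 * C)) (by norm_num) (by positivity))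
  rw [eventually_nhdsWithin_iff, Metric.eventually_nhds_iff] at h
  obtain ⟨b, hb, h⟩ := h
  refine ⟨min b₀ b, lt_min hb₀ hb, fun q hq hlt => ?_⟩
  have hε := amp_pos hq
  have hε1 := amp_le_one hq
  have had := hadm q hq (hlt.trans_le (min_le_left _ _))
  obtain ⟨h1, h2⟩ := h (by
    rw [Real.dist_eq, sub_zero, abs_of_pos hε]; exact hlt.trans_le (min_le_right _ _)) hε
  have hη := had.radius_pos
  have ht : 0 < amp q.1 q.2 ^ (1 / 16 : ℝ) := Real.rpow_pos_of_pos hε _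
  have hεt : amp q.1 q.2 ≤ amp q.1 q.2 ^ (1 / 16 : ℝ) := by
    simpa using amp_rpow_le hq (a := 1) (b := 1 / 16) (by norm_num)
  have hcontr : ∀ (γ : ℝ) (v w : H4), ‖v‖ ≤ 4 * (R * amp q.1 q.2 ^ (1 / 16 : ℝ)) →
      ‖w‖ ≤ 4 * (R * amp q.1 q.2 ^ (1 / 16 : ℝ)) →
      ‖farMap χ β τ q γ v - farMap χ β τ q γ w‖ ≤ 1 / 2 * ‖v - w‖ := by
    intro γ v w hv hw
    refine (hD q had γ _ v w hv hw).trans (mul_le_mul_of_nonneg_right ?_ (norm_nonneg _))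
    have e : amp q.1 q.2 ^ (1 / 8 - 2 * τ)
        = (amp q.1 q.2 ^ (1 / 16 : ℝ)) ^ 2 / (amp q.1 q.2 ^ τ) ^ 2 := by
      rw [Real.rpow_sub hε, ← Real.rpow_natCast (amp q.1 q.2 ^ (1 / 16 : ℝ)),
        ← Real.rpow_mul hε.le, ← Real.rpow_natCast (amp q.1 q.2 ^ τ), ← Real.rpow_mul hε.le]
      congr 2 <;> push_cast <;> ring
    rw [e] at h1
    set t := amp q.1 q.2 ^ (1 / 16 : ℝ)
    have h3 : amp q.1 q.2 ^ 2 + amp q.1 q.2 * (4 * (R * t)) + (4 * (R * t)) ^ 2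
        ≤ (1 + 4 * R + 16 * R ^ 2) * t ^ 2 := by
      have a1 : amp q.1 q.2 ^ 2 ≤ t ^ 2 := pow_le_pow_left₀ hε.le hεt 2
      have a2 := mul_le_mul_of_nonneg_right hεt (by positivity : 0 ≤ 4 * (R * t))
      nlinarith
    calc _ ≤ D * ((1 + 4 * R + 16 * R ^ 2) * t ^ 2) / (amp q.1 q.2 ^ τ) ^ 2 := by gcongr
      _ = D * (1 + 4 * R + 16 * R ^ 2) * (t ^ 2 / (amp q.1 q.2 ^ τ) ^ 2) := by ring
      _ ≤ D * (1 + 4 * R + 16 * R ^ 2) * (1 / (2 * (D * (1 + 4 * R + 16 * R ^ 2)))) := by gcongr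
      _ = 1 / 2 := by field_simp
  have hnear : R * amp q.1 q.2 ^ (β / 2) ≤ R * amp q.1 q.2 ^ (1 / 16 : ℝ) :=
    mul_le_mul_of_nonneg_left (amp_rpow_le hq (by linarith)) hR.le
  refine ⟨had, hcontr, hnear, fun γ v w hv hw => ?_⟩
  have h3 := hcontr γ (v + w) 0 ((norm_add_le _ _).trans (by nlinarith)) (by
    rw [norm_zero]; positivity)
  rw [sub_zero] at h3
  have h4 := hN q had γ
  have h5 : ‖farMap χ β τ q γ (v + w)‖ ≤ ‖farMap χ β τ q γ (v + w) - farMap χ β τ q γ 0‖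
      + ‖farMap χ β τ q γ 0‖ := by
    simpa using norm_add_le (farMap χ β τ q γ (v + w) - farMap χ β τ q γ 0) (farMap χ β τ q γ 0)
  have h6 := norm_add_le v w
  have p1 := amp_rpow_le hq (a := β / 2) (b := 1 / 2) (by linarith)
  have p2 := amp_rpow_le hq (a := 3 - β / 2) (b := 1 / 2) (by linarith)
  have p3 := amp_rpow_le hq (a := 1 + 3 * β / 2) (b := 1 / 2) (by linarith)
  have p4 := amp_rpow_le hq (a := 2 + β / 2) (b := 1 / 2) (by linarith)
  have e2 : amp q.1 q.2 ^ (1 / 2 : ℝ) = amp q.1 q.2 ^ (7 / 16 : ℝ) * amp q.1 q.2 ^ (1 / 16 : ℝ) := by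
    rw [← Real.rpow_add hε]; norm_num
  have h7 : (R + 6 * C) * amp q.1 q.2 ^ (1 / 2 : ℝ) ≤ R / 2 * amp q.1 q.2 ^ (1 / 16 : ℝ) := by
    rw [e2, ← mul_assoc]
    refine mul_le_mul_of_nonneg_right ?_ ht.le
    refine (mul_le_mul_of_nonneg_left h2 (by positivity)).trans (le_of_eq ?_)
    have : 0 < R + 6 * C := by positivity
    rw [show 2 * R + 12 * C = 2 * (R + 6 * C) by ring]
    field_simp
  have q1 := mul_le_mul_of_nonneg_left p1 hR.le
  have q2 := mul_le_mul_of_nonneg_left (add_le_add (add_le_add p2 p3) p4) hC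
  have hp : 0 < amp q.1 q.2 ^ (1 / 2 : ℝ) := Real.rpow_pos_of_pos hε _
  nlinarith [mul_pos hR hp, mul_nonneg hC hp.le]

namespace Contracting

variable {χ : ℝ → ℝ} {R τ β : ℝ} {q : ℝ × ℝ}

theorem norm_add_le (h : Contracting χ R τ β q) {v w : H4}
    (hv : ‖v‖ ≤ R * amp q.1 q.2 ^ (β / 2)) (hw : ‖w‖ ≤ R * amp q.1 q.2 ^ (1 / 16 : ℝ)) :
    ‖v + w‖ ≤ 2 * (R * amp q.1 q.2 ^ (1 / 16 : ℝ)) := by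
  have := _root_.norm_add_le v w
  linarith [h.near_le]

theorem exists_fixedPoint (h : Contracting χ R τ β q) (hR : 0 < R) (γ : ℝ) {v : H4}
    (hv : ‖v‖ ≤ R * amp q.1 q.2 ^ (β / 2)) :
    ∃ w : H4, ‖w‖ ≤ R * amp q.1 q.2 ^ (1 / 16 : ℝ) ∧ farMap χ β τ q γ (v + w) = w := by
  have ht : 0 < R * amp q.1 q.2 ^ (1 / 16 : ℝ) :=
    mul_pos hR (Real.rpow_pos_of_pos (amp_pos h.adm.mem) _)
  obtain ⟨w, hw, hfix⟩ := exists_fixedPoint_of_contraction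
    (s := Metric.closedBall (0 : H4) (R * amp q.1 q.2 ^ (1 / 16 : ℝ)))
    (f := fun w => farMap χ β τ q γ (v + w)) Metric.isClosed_closedBall
    ⟨0, by simpa using ht.le⟩ (fun w hw => by
      rw [mem_closedBall_zero_iff] at hw ⊢
      exact h.mapsTo γ v w hv hw) (K := 1 / 2) (by norm_num) (by norm_num) (fun x hx y hy => by
      rw [mem_closedBall_zero_iff] at hx hy
      rw [dist_eq_norm, dist_eq_norm]
      have h1 := h.contract γ (v + x) (v + y) ((h.norm_add_le hv hx).trans (by linarith))
        ((h.norm_add_le hv hy).trans (by linarith))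
      rwa [add_sub_add_left_eq_sub] at h1)
  exact ⟨w, mem_closedBall_zero_iff.mp hw, hfix⟩

theorem fixedPoint_unique (h : Contracting χ R τ β q) (hR : 0 < R) {γ : ℝ} {v w w' : H4}
    (hv : ‖v‖ ≤ R * amp q.1 q.2 ^ (β / 2)) (hw : ‖w‖ ≤ R * amp q.1 q.2 ^ (1 / 16 : ℝ))
    (hw' : ‖w'‖ ≤ R * amp q.1 q.2 ^ (1 / 16 : ℝ)) (hf : farMap χ β τ q γ (v + w) = w)
    (hf' : farMap χ β τ q γ (v + w') = w') : w = w' := by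
  have ht : 0 < R * amp q.1 q.2 ^ (1 / 16 : ℝ) :=
    mul_pos hR (Real.rpow_pos_of_pos (amp_pos h.adm.mem) _)
  have h1 := h.contract γ (v + w) (v + w') ((h.norm_add_le hv hw).trans (by linarith))
    ((h.norm_add_le hv hw').trans (by linarith))
  rw [hf, hf', add_sub_add_left_eq_sub] at h1
  have h2 : ‖w - w'‖ = 0 := le_antisymm (by linarith) (norm_nonneg _)
  exact sub_eq_zero.mp (norm_eq_zero.mp h2)

end Contracting

/-! ### The far field as a function of the near field -/

open Classical in
/-- An element of `H⁴` with the property `P`, if there is one. -/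
def chooseH4 (P : H4 → Prop) : H4 := if h : ∃ w, P w then h.choose else 0

theorem chooseH4_spec {P : H4 → Prop} (h : ∃ w, P w) : P (chooseH4 P) := by
  rw [chooseH4, dif_pos h]; exact h.choose_spec

/-- The solution of the fixed point equation in the far ball. -/
def farSol (χ : ℝ → ℝ) (R τ β : ℝ) (v : H4) (δ Ω γ : ℝ) : H4 :=
  chooseH4 fun w => 0 < δ ∧ ‖w‖ ≤ R * amp δ Ω ^ (1 / 16 : ℝ) ∧ IsFarFixedPoint χ β δ Ω γ τ v w

/-- The condition 0 < δ in the choice predicate is unsatisfiable here, so the default value 0 is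
selected. -/
theorem farSol_zero (χ : ℝ → ℝ) (R τ β : ℝ) (v : H4) (Ω γ : ℝ) : farSol χ R τ β v 0 Ω γ = 0 :=
  dif_neg fun ⟨_, h⟩ => lt_irrefl _ h.1

theorem roll_add_two_pi (δ ω γ : ℝ) : roll δ ω (γ + 2 * π) = roll δ ω γ := by
  funext x
  rw [roll, roll, ← add_assoc, rollProfile]
  split_ifs with h
  · exact h.choose_spec.periodic _
  · rfl

theorem nonlinearity_add_two_pi (χ : ℝ → ℝ) (β δ Ω γ : ℝ) :
    nonlinearity χ β δ Ω (γ + 2 * π) = nonlinearity χ β δ Ω γ := by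
  have hF : farField χ β δ Ω (γ + 2 * π) = farField χ β δ Ω γ := by
    funext x; rw [farField, farField, roll_add_two_pi]
  funext v x
  simp only [nonlinearity, N1, N2, N4, hF, roll_add_two_pi]

/-- The two choice predicates are equal, so the choices are equal; no uniqueness is needed and all
arguments are allowed. -/
theorem farSol_add_two_pi (χ : ℝ → ℝ) (R τ β : ℝ) (v : H4) (δ Ω γ : ℝ) :
    farSol χ R τ β v δ Ω (γ + 2 * π) = farSol χ R τ β v δ Ω γ := by
  have h : IsFarFixedPoint χ β δ Ω (γ + 2 * π) = IsFarFixedPoint χ β δ Ω γ := by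
    funext τ v w
    unfold IsFarFixedPoint
    rw [nonlinearity_add_two_pi]
  unfold farSol
  rw [h]

theorem Contracting.farSol_spec {χ : ℝ → ℝ} (hχ : IsPartition χ) {R τ β : ℝ} {q : ℝ × ℝ}
    (h : Contracting χ R τ β q) (hR : 0 < R) (hβ : 0 ≤ β) (γ : ℝ) {v : H4}
    (hv : ‖v‖ ≤ R * amp q.1 q.2 ^ (β / 2)) :
    ‖farSol χ R τ β v q.1 q.2 γ‖ ≤ R * amp q.1 q.2 ^ (1 / 16 : ℝ) ∧
      IsFarFixedPoint χ β q.1 q.2 γ τ v (farSol χ R τ β v q.1 q.2 γ) := by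
  obtain ⟨w, hw, hf⟩ := h.exists_fixedPoint hR γ hv
  have hex : ∃ w : H4, 0 < q.1 ∧ ‖w‖ ≤ R * amp q.1 q.2 ^ (1 / 16 : ℝ) ∧
      IsFarFixedPoint χ β q.1 q.2 γ τ v w := ⟨w, h.adm.mem.1.1, hw, (isFarFixedPoint_iff hχ hβ h.adm γ v w).mpr hf⟩
  exact (chooseH4_spec hex).2

theorem Contracting.farMap_farSol {χ : ℝ → ℝ} (hχ : IsPartition χ) {R τ β : ℝ} {q : ℝ × ℝ}
    (h : Contracting χ R τ β q) (hR : 0 < R) (hβ : 0 ≤ β) (γ : ℝ) {v : H4}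
    (hv : ‖v‖ ≤ R * amp q.1 q.2 ^ (β / 2)) :
    farMap χ β τ q γ (v + farSol χ R τ β v q.1 q.2 γ) = farSol χ R τ β v q.1 q.2 γ :=
  (isFarFixedPoint_iff hχ hβ h.adm γ _ _).mp (h.farSol_spec hχ hR hβ γ hv).2

/-! ### Real-valued solutions -/

theorem nonlinearity_conj (χ : ℝ → ℝ) (β δ Ω γ : ℝ) {f g : ℝ → ℂ} {x : ℝ} (h : g x = conj (f x)) :
    nonlinearity χ β δ Ω γ g x = conj (nonlinearity χ β δ Ω γ f x) := by
  simp only [nonlinearity, N1, N2, N3, h, map_add, map_mul, map_neg, map_pow, Complex.conj_ofReal]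

theorem coeFn_star_L2 (f : L2) : (star f : L2) =ᵐ[volume] fun x => conj (f x) := Lp.coeFn_star f

/-- The nonlinearity has real coefficients and the far multiplier is real and even, so the conjugate
of the solution solves the same equation in the same ball; uniqueness identifies them. -/
theorem Contracting.isReal_farSol {χ : ℝ → ℝ} (hχ : IsPartition χ) {R τ β : ℝ} {q : ℝ × ℝ}
    (h : Contracting χ R τ β q) (hR : 0 < R) (hβ : 0 ≤ β) (γ : ℝ) {v : H4}
    (hv : ‖v‖ ≤ R * amp q.1 q.2 ^ (β / 2)) (hreal : v.IsReal) :
    (farSol χ R τ β v q.1 q.2 γ).IsReal := by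
  obtain ⟨hn, -⟩ := h.farSol_spec hχ hR hβ γ hv
  have hf := h.farMap_farSol hχ hR hβ γ hv
  set w := farSol χ R τ β v q.1 q.2 γ
  obtain ⟨w', hw', hn', hc⟩ := w.exists_conj
  have hN : nonlinL2 χ β q γ (v + w') = star (nonlinL2 χ β q γ (v + w)) := by
    refine Lp.ext ?_
    have m1 := memLp_nonlinearity hχ hβ h.adm.mem γ (v + w')
    have m2 := memLp_nonlinearity hχ hβ h.adm.mem γ (v + w)
    have hreal' : ∀ᵐ x, (v.toL2 x).im = 0 := hreal
    filter_upwards [coe_nonlinL2 m1, coe_nonlinL2 m2, coeFn_star_L2 (nonlinL2 χ β q γ (v + w)),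
      hreal', Lp.coeFn_add v.toL2 w.toL2, Lp.coeFn_add v.toL2 w'.toL2, coeFn_star_L2 w.toL2]
      with x a1 a2 a3 a4 a5 a6 a7
    rw [a1, a3, a2]
    refine nonlinearity_conj χ β q.1 q.2 γ ?_
    rw [H4.toL2_add, H4.toL2_add, a5, a6, Pi.add_apply, Pi.add_apply, map_add, hw', a7,
      Complex.conj_eq_iff_im.mpr a4]
  have hf' : farMap χ β τ q γ (v + w') = w' := by
    refine H4.ext_weighted ?_
    have hq := (Measure.measurePreserving_neg (volume : Measure ℝ)).quasiMeasurePreserving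
    have b1 := weighted_farMap (χ := χ) (β := β) h.adm γ (v + w')
    have b2 := hq.ae (weighted_farMap (χ := χ) (β := β) h.adm γ (v + w))
    filter_upwards [b1, b2, hc, hat_star (nonlinL2 χ β q γ (v + w))] with κ c1 c2 c3 c4
    rw [hf] at c2
    rw [c1, hN, c4, c3, c2, map_mul, Complex.conj_ofReal, farWeight_neg]
  have heq := h.fixedPoint_unique hR hv (hn'.le.trans hn) hn hf' hf
  rw [heq] at hw'
  have : ∀ᵐ x, (w.toL2 x).im = 0 := by
    filter_upwards [coeFn_star_L2 w.toL2] with x hx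
    rw [← hw'] at hx
    exact Complex.conj_eq_iff_im.mp hx.symm
  exact this

end

/-! ### Quantitative bound and continuity of the far field. -/

noncomputable section

theorem sum_exponents {q : ℝ × ℝ} (hq : q ∈ rollSet) (τ β : ℝ) :
    ∑ j ∈ Finset.Icc (1 : ℕ) 3, amp q.1 q.2 ^ (3 - (j : ℝ) - 2 * τ + β / 2 * ((j : ℝ) - 1))
      = (amp q.1 q.2 ^ 2 + amp q.1 q.2 * amp q.1 q.2 ^ (β / 2) + (amp q.1 q.2 ^ (β / 2)) ^ 2)
        / (amp q.1 q.2 ^ τ) ^ 2 := by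
  have hε := amp_pos hq
  have hI : Finset.Icc (1 : ℕ) 3 = {1, 2, 3} := by decide
  have hη : (amp q.1 q.2 ^ τ) ^ 2 = amp q.1 q.2 ^ (2 * τ) := by
    rw [← Real.rpow_natCast, ← Real.rpow_mul hε.le]; congr 1; push_cast; ring
  have e1 : amp q.1 q.2 ^ (3 - ((1 : ℕ) : ℝ) - 2 * τ + β / 2 * (((1 : ℕ) : ℝ) - 1))
      = amp q.1 q.2 ^ 2 / amp q.1 q.2 ^ (2 * τ) := by
    rw [← Real.rpow_natCast (amp q.1 q.2) 2, ← Real.rpow_sub hε]; congr 1; push_cast; ring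
  have e2 : amp q.1 q.2 ^ (3 - ((2 : ℕ) : ℝ) - 2 * τ + β / 2 * (((2 : ℕ) : ℝ) - 1))
      = amp q.1 q.2 * amp q.1 q.2 ^ (β / 2) / amp q.1 q.2 ^ (2 * τ) := by
    nth_rewrite 2 [← Real.rpow_one (amp q.1 q.2)]
    rw [← Real.rpow_add hε, ← Real.rpow_sub hε]; congr 1; push_cast; ring
  have e3 : amp q.1 q.2 ^ (3 - ((3 : ℕ) : ℝ) - 2 * τ + β / 2 * (((3 : ℕ) : ℝ) - 1))
      = (amp q.1 q.2 ^ (β / 2)) ^ 2 / amp q.1 q.2 ^ (2 * τ) := by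
    rw [← Real.rpow_natCast (amp q.1 q.2 ^ (β / 2)), ← Real.rpow_mul hε.le, ← Real.rpow_sub hε]
    congr 1; push_cast; ring
  rw [hI, Finset.sum_insert (by decide), Finset.sum_insert (by decide), Finset.sum_singleton,
    e1, e2, e3, hη]
  ring

/-- Passing from v + w to v costs half of ‖w‖, which is absorbed. Passing from v to 0 uses the
Lipschitz constant on the smaller ball of radius Rε^{β/2}, which produces the sum over j. The value
at 0 is the residual. -/
theorem exists_bound_farSol {χ : ℝ → ℝ} (hχ : IsPartition χ) {R τ β : ℝ} (hR : 0 < R)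
    (hτ₁ : τ < 1 / 16) (hβ₀ : 1 ≤ β) :
    ∃ C > 0, ∀ q, Contracting χ R τ β q → ∀ (γ : ℝ) (v : H4),
      ‖v‖ ≤ R * amp q.1 q.2 ^ (β / 2) → ‖farSol χ R τ β v q.1 q.2 γ‖ ≤
        C * ((∑ j ∈ Finset.Icc (1 : ℕ) 3,
            amp q.1 q.2 ^ (3 - (j : ℝ) - 2 * τ + β / 2 * ((j : ℝ) - 1))) * ‖v‖
          + (amp q.1 q.2 ^ (3 - β / 2) + amp q.1 q.2 ^ (1 + 3 * β / 2)
            + amp q.1 q.2 ^ (2 + β / 2))) := by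
  have hβ : 0 ≤ β := zero_le_one.trans hβ₀
  obtain ⟨D, hD1, hD⟩ := exists_lipschitz_farMap hχ hβ τ
  obtain ⟨C, hC, hN⟩ := exists_bound_farMap_zero hχ (τ := τ) (by linarith) (by linarith) hβ₀
  refine ⟨2 * (D * (1 + R + R ^ 2)) + 2 * C, by positivity, fun q h γ v hv => ?_⟩
  have hε := amp_pos h.adm.mem
  have hη := h.adm.radius_pos
  obtain ⟨hn, -⟩ := h.farSol_spec hχ hR hβ γ hv
  have hf := h.farMap_farSol hχ hR hβ γ hv
  rw [sum_exponents h.adm.mem]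
  set w := farSol χ R τ β v q.1 q.2 γ
  set S := amp q.1 q.2 ^ (3 - β / 2) + amp q.1 q.2 ^ (1 + 3 * β / 2) + amp q.1 q.2 ^ (2 + β / 2)
  have hS : 0 ≤ S := by positivity
  have ht : 0 < R * amp q.1 q.2 ^ (1 / 16 : ℝ) := mul_pos hR (Real.rpow_pos_of_pos hε _)
  have h1 := h.contract γ (v + w) v ((h.norm_add_le hv hn).trans (by linarith))
    (by linarith [h.near_le])
  rw [add_sub_cancel_left, hf] at h1
  have h2 := hD q h.adm γ (R * amp q.1 q.2 ^ (β / 2)) v 0 hv (by rw [norm_zero]; positivity)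
  rw [sub_zero] at h2
  have h3 := hN q h.adm γ
  have h4 : ‖w‖ ≤ ‖w - farMap χ β τ q γ v‖ + (‖farMap χ β τ q γ v - farMap χ β τ q γ 0‖
      + ‖farMap χ β τ q γ 0‖) := by
    have e : w = (w - farMap χ β τ q γ v) + ((farMap χ β τ q γ v - farMap χ β τ q γ 0)
      + farMap χ β τ q γ 0) := by abel
    conv_lhs => rw [e]
    exact (norm_add_le _ _).trans (add_le_add le_rfl (norm_add_le _ _))
  set s := amp q.1 q.2 ^ (β / 2)
  have hs : 0 < s := Real.rpow_pos_of_pos hε _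
  set P := (amp q.1 q.2 ^ 2 + amp q.1 q.2 * s + s ^ 2) / (amp q.1 q.2 ^ τ) ^ 2 with hP
  have hP0 : 0 ≤ P := by positivity
  have h5 : D * (amp q.1 q.2 ^ 2 + amp q.1 q.2 * (R * s) + (R * s) ^ 2) / (amp q.1 q.2 ^ τ) ^ 2
      ≤ D * (1 + R + R ^ 2) * P := by
    rw [hP, mul_assoc, ← mul_div_assoc, ← mul_div_assoc]
    have : amp q.1 q.2 ^ 2 + amp q.1 q.2 * (R * s) + (R * s) ^ 2
        ≤ (1 + R + R ^ 2) * (amp q.1 q.2 ^ 2 + amp q.1 q.2 * s + s ^ 2) := by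
      have z1 : 0 ≤ R * amp q.1 q.2 ^ 2 := by positivity
      have z2 : 0 ≤ R ^ 2 * amp q.1 q.2 ^ 2 := by positivity
      have z3 : 0 ≤ amp q.1 q.2 * s := by positivity
      have z4 : 0 ≤ R ^ 2 * (amp q.1 q.2 * s) := by positivity
      have z5 : 0 ≤ s ^ 2 := by positivity
      have z6 : 0 ≤ R * s ^ 2 := by positivity
      nlinarith
    gcongr
  have h6 := mul_le_mul_of_nonneg_right h5 (norm_nonneg v)
  have z1 : 0 ≤ C * (P * ‖v‖) := by positivity
  have z2 : 0 ≤ D * (1 + R + R ^ 2) * S := by positivity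
  nlinarith

/-! ### Continuity of the far field -/

/-- The parameters of the far field: near field, `δ`, `Ω` and phase. -/
def farDomain (R τ β δs : ℝ) : Set (H4 × ℝ × ℝ × ℝ) :=
  {p | p.2.1 ∈ Ico 0 δs ∧ p.2.2.1 ∈ Ioo (-1 / 3 : ℝ) (1 / 3) ∧
    (p.2.1 = 0 ∨ p.1 ∈ nearBall R τ β p.2.1 p.2.2.1)}

/-- The solution is at most R(2δ)^{1/16} whatever the near field, since ε ≤ 2δ; no control of v is
needed as δ tends to 0. -/
theorem continuousWithinAt_farSol_zero {χ : ℝ → ℝ} (hχ : IsPartition χ) {R τ β δs : ℝ} (hR : 0 < R)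
    (hβ : 0 ≤ β) (hs : ∀ q ∈ Ioo 0 δs ×ˢ Ioo (-1 / 3 : ℝ) (1 / 3), Contracting χ R τ β q)
    {p₀ : H4 × ℝ × ℝ × ℝ} (h₀ : p₀.2.1 = 0) :
    ContinuousWithinAt (fun p : H4 × ℝ × ℝ × ℝ => farSol χ R τ β p.1 p.2.1 p.2.2.1 p.2.2.2)
      (farDomain R τ β δs) p₀ := by
  unfold ContinuousWithinAt
  beta_reduce
  rw [h₀, farSol_zero]
  have hb : ∀ p ∈ farDomain R τ β δs, ‖farSol χ R τ β p.1 p.2.1 p.2.2.1 p.2.2.2‖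
      ≤ R * (2 * p.2.1) ^ (1 / 16 : ℝ) := by
    rintro ⟨v, δ, Ω, γ⟩ ⟨h1, h2, h3⟩
    simp only at h1 h2 h3 ⊢
    rcases eq_or_lt_of_le h1.1 with h | h
    · rw [← h, farSol_zero, norm_zero]; positivity
    · have hc := hs (δ, Ω) ⟨⟨h, h1.2⟩, h2⟩
      have hv := (h3.resolve_left h.ne').2
      refine (hc.farSol_spec hχ hR hβ γ hv).1.trans (mul_le_mul_of_nonneg_left ?_ hR.le)
      refine Real.rpow_le_rpow (amp_pos hc.adm.mem).le ?_ (by norm_num)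
      have := (amp_mem hc.adm.mem).2
      simp only at this ⊢
      linarith
  refine squeeze_zero_norm' (eventually_nhdsWithin_of_forall hb) ?_
  have hc : Continuous fun p : H4 × ℝ × ℝ × ℝ => R * (2 * p.2.1) ^ (1 / 16 : ℝ) :=
    continuous_const.mul ((continuous_const.mul (continuous_fst.comp continuous_snd)).rpow_const
      fun _ => Or.inr (by norm_num))
  have := hc.tendsto p₀
  rw [h₀, mul_zero, Real.zero_rpow (by norm_num), mul_zero] at this
  exact this.mono_left nhdsWithin_le_nhds

/-- The same principle as for the rolls: contraction with rate 1/2 gives ‖w - w₀‖ ≤ ‖v - v₀‖ +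
2‖F(v₀ + w₀) - w₀‖, where F is the map at the nearby parameters, and only its convergence at the
fixed element v₀ + w₀ is required. -/
theorem continuousWithinAt_farSol_pos {χ : ℝ → ℝ} (hχ : IsPartition χ) {R τ β δs : ℝ} (hR : 0 < R)
    (hβ : 0 ≤ β) (hs : ∀ q ∈ Ioo 0 δs ×ˢ Ioo (-1 / 3 : ℝ) (1 / 3), Contracting χ R τ β q)
    {p₀ : H4 × ℝ × ℝ × ℝ} (hp₀ : p₀ ∈ farDomain R τ β δs) (h₀ : 0 < p₀.2.1) :
    ContinuousWithinAt (fun p : H4 × ℝ × ℝ × ℝ => farSol χ R τ β p.1 p.2.1 p.2.2.1 p.2.2.2)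
      (farDomain R τ β δs) p₀ := by
  set T := farDomain R τ β δs ∩ {p | 0 < p.2.1} with hT
  have hopen : {p : H4 × ℝ × ℝ × ℝ | 0 < p.2.1} ∈ 𝓝 p₀ :=
    (isOpen_lt continuous_const (continuous_fst.comp continuous_snd)).mem_nhds h₀
  -- Positivity of δ is an open condition, so the domain may be restricted to parameters for which
  -- rolls exist.
  rw [← continuousWithinAt_inter hopen, ← hT,
    continuousWithinAt_iff_continuousAt_domRestrict _ (show p₀ ∈ T from ⟨hp₀, h₀⟩)]
  have hc : ∀ p : T, Contracting χ R τ β (p.1.2.1, p.1.2.2.1) := fun p =>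
    hs _ ⟨⟨p.2.2, p.2.1.1.2⟩, p.2.1.2.1⟩
  have hv : ∀ p : T, ‖p.1.1‖ ≤ R * amp p.1.2.1 p.1.2.2.1 ^ (β / 2) := fun p =>
    (p.2.1.2.2.resolve_left (ne_of_gt p.2.2)).2
  set p₁ : T := ⟨p₀, hp₀, h₀⟩
  let q : T → rollSet := fun p => ⟨(p.1.2.1, p.1.2.2.1), (hc p).adm.mem⟩
  have hq : Continuous q := by
    refine Continuous.subtype_mk ?_ _
    fun_prop
  have hγ : Continuous fun p : T => p.1.2.2.2 := by fun_prop
  have hv1 : Continuous fun p : T => p.1.1 := by fun_prop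
  set w₀ := farSol χ R τ β p₀.1 p₀.2.1 p₀.2.2.1 p₀.2.2.2
  have hmap := tendsto_farMap hχ (β := β) (τ := τ) hβ (q := q) (q₀ := q p₁)
    (γ := fun p : T => p.1.2.2.2) (fun p => (hc p).adm) (hc p₁).adm (hq.tendsto p₁)
    (hγ.tendsto p₁) (p₀.1 + w₀)
  have hfix₀ : farMap χ β τ (q p₁) p₁.1.2.2.2 (p₀.1 + w₀) = w₀ :=
    (hc p₁).farMap_farSol hχ hR hβ _ (hv p₁)
  rw [hfix₀] at hmap
  have hbound : Tendsto (fun p : T => ‖p.1.1 - p₀.1‖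
      + 2 * ‖farMap χ β τ (q p) p.1.2.2.2 (p₀.1 + w₀) - w₀‖) (𝓝 p₁) (𝓝 0) := by
    have a1 := tendsto_iff_norm_sub_tendsto_zero.mp (hv1.tendsto p₁)
    have a2 := (tendsto_iff_norm_sub_tendsto_zero.mp hmap).const_mul 2
    simpa using a1.add a2
  -- The radius varies with the parameters; the factor 4 against 2 keeps v₀ + w₀ inside the
  -- contraction ball of nearby ones.
  have hamp : ∀ᶠ p in 𝓝 p₁, ‖p₀.1 + w₀‖
      ≤ 4 * (R * amp p.1.2.1 p.1.2.2.1 ^ (1 / 16 : ℝ)) := by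
    have hε := amp_pos (hc p₁).adm.mem
    have h1 := (hc p₁).norm_add_le (hv p₁) ((hc p₁).farSol_spec hχ hR hβ p₀.2.2.2 (hv p₁)).1
    have ht : Tendsto (fun p : T => 4 * (R * amp p.1.2.1 p.1.2.2.1 ^ (1 / 16 : ℝ))) (𝓝 p₁)
        (𝓝 (4 * (R * amp p₀.2.1 p₀.2.2.1 ^ (1 / 16 : ℝ)))) :=
      ((((continuous_amp.comp hq).tendsto p₁).rpow_const
        (Or.inr (by norm_num))).const_mul R).const_mul 4
    have hpos : 0 < R * amp p₀.2.1 p₀.2.2.1 ^ (1 / 16 : ℝ) :=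
      mul_pos hR (Real.rpow_pos_of_pos hε _)
    have hlt : ‖p₀.1 + w₀‖ < 4 * (R * amp p₀.2.1 p₀.2.2.1 ^ (1 / 16 : ℝ)) := by
      refine lt_of_le_of_lt h1 ?_
      linarith
    exact (ht.eventually (lt_mem_nhds hlt)).mono fun p hp => hp.le
  unfold ContinuousAt
  rw [tendsto_iff_norm_sub_tendsto_zero]
  refine squeeze_zero' (Eventually.of_forall fun p => norm_nonneg _) ?_ hbound
  filter_upwards [hamp] with p hp
  change ‖farSol χ R τ β p.1.1 p.1.2.1 p.1.2.2.1 p.1.2.2.2 - w₀‖ ≤ _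
  have hspec := ((hc p).farSol_spec hχ hR hβ p.1.2.2.2 (hv p)).1
  have hfix := (hc p).farMap_farSol hχ hR hβ p.1.2.2.2 (hv p)
  simp only at hspec hfix
  set w := farSol χ R τ β p.1.1 p.1.2.1 p.1.2.2.1 p.1.2.2.2
  have hpos : 0 < R * amp p.1.2.1 p.1.2.2.1 ^ (1 / 16 : ℝ) :=
    mul_pos hR (Real.rpow_pos_of_pos (amp_pos (hc p).adm.mem) _)
  have h1 := (hc p).contract p.1.2.2.2 (p.1.1 + w) (p₀.1 + w₀)
    (((hc p).norm_add_le (hv p) hspec).trans (by simp only; linarith)) hp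
  rw [hfix] at h1
  have h2 : ‖w - w₀‖ ≤ ‖w - farMap χ β τ (q p) p.1.2.2.2 (p₀.1 + w₀)‖
      + ‖farMap χ β τ (q p) p.1.2.2.2 (p₀.1 + w₀) - w₀‖ := norm_sub_le_norm_sub_add_norm_sub _ _ _
  have h3 : ‖p.1.1 + w - (p₀.1 + w₀)‖ ≤ ‖p.1.1 - p₀.1‖ + ‖w - w₀‖ := by
    rw [add_sub_add_comm]; exact norm_add_le _ _
  change ‖w - farMap χ β τ (q p) p.1.2.2.2 (p₀.1 + w₀)‖ ≤ _ at h1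
  linarith

end

end QuenchedSH

/-! ### Assembly of the proposition. -/

open QuenchedSH in
theorem proposition3p1 (χ : ℝ → ℝ) (hχ : IsPartition χ) (R τ β : ℝ) (hR : 0 < R)
    (hτ₀ : 0 < τ) (hτ₁ : τ < 1 / 16) (hβ₀ : 1 ≤ β) (hβ₁ : β ≤ 1 + τ) :
    ∃ δs > 0, ∃ C > 0, ∃ vfar : H4 → ℝ → ℝ → ℝ → H4,
      -- the rolls exist for the parameters in question
      (∀ δ ∈ Ioo 0 δs, ∀ Ω ∈ Ioo (-1 / 3 : ℝ) (1 / 3),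
        IsRollProfile δ (wavenumber δ Ω) (rollProfile δ (wavenumber δ Ω))) ∧
      -- the map into the far ball, the fixed point equation and the bound
      (∀ δ ∈ Ioo 0 δs, ∀ Ω ∈ Ioo (-1 / 3 : ℝ) (1 / 3), ∀ γ : ℝ, ∀ v ∈ nearBall R τ β δ Ω,
        vfar v δ Ω γ ∈ Xfar (amp δ Ω ^ τ) ∧
        ‖vfar v δ Ω γ‖ ≤ R * amp δ Ω ^ (1 / 16 : ℝ) ∧
        IsFarFixedPoint χ β δ Ω γ τ v (vfar v δ Ω γ) ∧
        ‖vfar v δ Ω γ‖ ≤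
          C * ((∑ j ∈ Finset.Icc (1 : ℕ) 3,
                amp δ Ω ^ (3 - (j : ℝ) - 2 * τ + β / 2 * ((j : ℝ) - 1))) * ‖v‖
            + (amp δ Ω ^ (3 - β / 2) + amp δ Ω ^ (1 + 3 * β / 2) + amp δ Ω ^ (2 + β / 2))) ∧
        (v.IsReal → (vfar v δ Ω γ).IsReal)) ∧
      -- the extension by zero at `δ = 0`, continuity in all arguments, periodicity in the phase
      (∀ (v : H4) (Ω γ : ℝ), vfar v 0 Ω γ = 0) ∧
      ContinuousOn (fun p : H4 × ℝ × ℝ × ℝ => vfar p.1 p.2.1 p.2.2.1 p.2.2.2)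
        {p | p.2.1 ∈ Ico 0 δs ∧ p.2.2.1 ∈ Ioo (-1 / 3 : ℝ) (1 / 3) ∧
          (p.2.1 = 0 ∨ p.1 ∈ nearBall R τ β p.2.1 p.2.2.1)} ∧
      (∀ (v : H4) (δ Ω γ : ℝ), vfar v δ Ω (γ + 2 * π) = vfar v δ Ω γ) := by
  have hβ : 0 ≤ β := zero_le_one.trans hβ₀
  obtain ⟨b, hb, hcontr⟩ := exists_contracting_threshold hχ hR hτ₀ hτ₁ hβ₀ hβ₁
  obtain ⟨C, hC, hbound⟩ := exists_bound_farSol hχ (τ := τ) hR hτ₁ hβ₀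
  -- Since ε ≤ 6δ/5, taking δ below b/2 puts ε below the threshold b for every Ω.
  have hroll : ∀ q ∈ Ioo 0 (min rollThreshold (b / 2)) ×ˢ Ioo (-1 / 3 : ℝ) (1 / 3),
      q ∈ rollSet := fun q hq => ⟨⟨hq.1.1, hq.1.2.trans_le (min_le_left _ _)⟩, hq.2⟩
  have hs : ∀ q ∈ Ioo 0 (min rollThreshold (b / 2)) ×ˢ Ioo (-1 / 3 : ℝ) (1 / 3),
      Contracting χ R τ β q := fun q hq => hcontr q (hroll q hq)
    (amp_mem_Ioo (hroll q hq) (hq.1.2.trans_le (min_le_right _ _))).2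
  refine ⟨min rollThreshold (b / 2), lt_min rollThreshold_pos (by positivity), C, hC,
    farSol χ R τ β, fun δ hδ Ω hΩ => (rollProfile_spec (hroll (δ, Ω) ⟨hδ, hΩ⟩)).1,
    fun δ hδ Ω hΩ γ v hv => ?_, farSol_zero χ R τ β, fun p hp => ?_, farSol_add_two_pi χ R τ β⟩
  · have h := hs (δ, Ω) ⟨hδ, hΩ⟩
    have hspec := h.farSol_spec hχ hR hβ γ hv.2
    exact ⟨hspec.2.mem_Xfar, hspec.1, hspec.2, hbound (δ, Ω) h γ v hv.2,
      h.isReal_farSol hχ hR hβ γ hv.2⟩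
  · rcases eq_or_lt_of_le hp.1.1 with h | h
    · exact continuousWithinAt_farSol_zero hχ hR hβ hs h.symm
    · exact continuousWithinAt_farSol_pos hχ hR hβ hs hp h
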